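/- Setting. Let $n\ge 1$ and let $\Omega\subset\mathbb R^n$ be a bounded, connected open set. Functions are complex valued. For an open set $U$ write $\|u\|_{H^l(U)}^2=\sum_{|\alpha|\le l}\|\partial^\alpha u\|_{L^2(U)}^2$ and $\|u\|_{W^{l,\infty}(U)}=\max_{|\alpha|\le l}\|\partial^\alpha u\|_{L^\infty(U)}$ (weak derivatives). Fix parameters $A,B,\sigma>0$, $C_0,C_1,\dots$, $\kappa$ and an integer $m\ge 1$. For $h>0$, a *GFEM-space with parameter $h$* is given by finitely many bounded open sets $\omega_1,\dots,\omega_N\subset\mathbb R^n$, open balls $\omega_j^*$, real functions $\phi_j$, and linear subspaces $\Psi_j\subset H^m(\omega_j)$ such that, with $d_j=\operatorname{diam}\omega_j$: * (A) $\omega_j$ is convex, $d_j\le h\le 1$; $\omega_j^*$ has diameter $\ge\sigma h$ and $\overline{\omega_j^*}\subset\omega_j$; and $\omega_j^*\subset\Omega$ if $\phi_j\not\equiv0$ on $\Omega$. * (B) The $\omega_j$ cover $\Omega$ and no $\kappa+1$ of them have a common point; the $\phi_j\ge 0$ are Lipschitz on $\Omega$, $\operatorname{supp}\phi_j\subset\omega_j$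 (support relative to $\Omega$), $\sum_j\phi_j=1$ on $\Omega$, $\|\partial^\alpha\phi_j\|_{L^\infty(\Omega)}\le C_k/d_j^{\,k}$ for $k=|\alpha|\le m$; and $\phi_j=1$ on $\omega_j^*\cap\Omega$. * (C) $\Psi_j$ contains all polynomials of degree $\le 1$, and $\|v\|_{H^l(\omega_j)}\le A\|v\|_{H^l(\omega_j^*)}$ for $v\in\Psi_j$ and integers $0\le l\le m$. * (D) $\|v\|_{H^t(\omega_j)}\le B\,d_j^{\,s-t}\|v\|_{H^s(\omega_j)}$ for $v\in\Psi_j$ and integers $0\le s\le t\le m$. The space itself is $S=\{\sum_j\phi_jv_j:\ v_j\in\Psi_j\}$, a space of functions on $\Omega$. Proposition (super-approximation). 1. Suppose that $\Omega$ has Lipschitz boundary. Then there is a constant $C$, depending only on $n$, $\Omega$ and the fixed parameters $A,B,C_k,\kappa,m,\sigma$ (in particular not on $h$, $N$ or $S$), such that for every $h$, every GFEM-space $S$ with parameter $h$, every $\rho\in W^{2,\infty}(\Omega)$ and every $w\in S$ there is $\tilde w\in S$ with $$\|\rho w-\tilde w\|_{H^1(\Omega)}\le C\,h\,\|\rho\|_{W^{2,\infty}(\Omega)}\|w\|_{H^1(\Omega)}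 .$$ 2. For any bounded connected open $\Omega$ (no assumption on the boundary) there is a constant $C'$, depending only on $n$, $\Omega$ and the fixed parameters, such that for every $\Omega_1\Subset\Omega$ (that is, $\overline{\Omega_1}$ is compact and contained in $\Omega$), every $h$, $S$, $\rho$ as above and every $w\in S$ with support in $\Omega_1$, there is $\tilde w\in S$ with compact support in $\Omega$ and $$\|\rho w-\tilde w\|_{H^1(\Omega)}\le C'\,\theta^{-1}\,h\,\|\rho\|_{W^{2,\infty}(\Omega)}\|w\|_{H^1(\Omega)},\qquad \theta=\operatorname{dist}(\partial\Omega,\partial\Omega_1).$$ -/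

import Mathlib

open MeasureTheory
open scoped ENNReal NNReal

noncomputable section

namespace GFEM

/-- The classical partial derivative `∂_i f` on `ℝⁿ`. -/
def pderiv {n : ℕ} (i : Fin n) (f : EuclideanSpace ℝ (Fin n) → ℝ) :
    EuclideanSpace ℝ (Fin n) → ℝ :=
  fun x => fderiv ℝ f x (EuclideanSpace.single i 1)

/-- The classical derivative `∂^α f = ∂_1^{α_1} ⋯ ∂_n^{α_n} f` (applied to smooth `f` only). -/
def mderiv {n : ℕ} (α : Fin n → ℕ) (f : EuclideanSpace ℝ (Fin n) → ℝ) :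
    EuclideanSpace ℝ (Fin n) → ℝ :=
  (List.finRange n).foldr (fun i g => (pderiv i)^[α i] g) f

/-- `g` is the weak derivative `∂^α u` on the open set `U`: both are locally integrable on `U` and
`∫_U u ∂^α ψ = (-1)^{|α|} ∫_U g ψ` for every `ψ ∈ C_c^∞(U)`. -/
def HasWeakDeriv {n : ℕ} (U : Set (EuclideanSpace ℝ (Fin n))) (α : Fin n → ℕ)
    (u g : EuclideanSpace ℝ (Fin n) → ℂ) : Prop :=
  LocallyIntegrableOn u U volume ∧ LocallyIntegrableOn g U volume ∧
    ∀ ψ : EuclideanSpace ℝ (Fin n) → ℝ, ContDiff ℝ (⊤ : ℕ∞) ψ → HasCompactSupport ψ → tsupport ψ ⊆ U →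
      ∫ x in U, mderiv α ψ x • u x = (-1) ^ (∑ i, α i) * ∫ x in U, ψ x • g x

/-- `‖∂^α u‖_{L^p(U)}`. A weak derivative is unique up to equality almost everywhere on `U`, so
the infimum runs over one value; it is `∞` when `u` has no weak derivative `∂^α u` on `U`. -/
def derivNorm {n : ℕ} (U : Set (EuclideanSpace ℝ (Fin n))) (α : Fin n → ℕ) (p : ℝ≥0∞)
    (u : EuclideanSpace ℝ (Fin n) → ℂ) : ℝ≥0∞ :=
  ⨅ (g : EuclideanSpace ℝ (Fin n) → ℂ) (_ : HasWeakDeriv U α u g),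
    eLpNorm g p (volume.restrict U)

/-- The multi-indices `α` with `|α| ≤ l`. -/
def multiIndices (n l : ℕ) : Finset (Fin n → ℕ) :=
  (Fintype.piFinset fun _ : Fin n => Finset.range (l + 1)).filter fun α => ∑ i, α i ≤ l

/-- The norm of `H^l(U)`: `(∑_{|α| ≤ l} ‖∂^α u‖²_{L²(U)})^{1/2}`, equal to `∞` when
`u ∉ H^l(U)`. -/
def hNorm {n : ℕ} (U : Set (EuclideanSpace ℝ (Fin n))) (l : ℕ)
    (u : EuclideanSpace ℝ (Fin n) → ℂ) : ℝ≥0∞ :=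
  (∑ α ∈ multiIndices n l, derivNorm U α 2 u ^ 2) ^ (1 / 2 : ℝ)

/-- `u ∈ H^l(U)`. -/
def MemH {n : ℕ} (U : Set (EuclideanSpace ℝ (Fin n))) (l : ℕ)
    (u : EuclideanSpace ℝ (Fin n) → ℂ) : Prop :=
  hNorm U l u < ∞

/-- The norm of `W^{l,∞}(U)`: `max_{|α| ≤ l} ‖∂^α u‖_{L^∞(U)}`, equal to `∞` when
`u ∉ W^{l,∞}(U)`. -/
def wInftyNorm {n : ℕ} (U : Set (EuclideanSpace ℝ (Fin n))) (l : ℕ)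
    (u : EuclideanSpace ℝ (Fin n) → ℂ) : ℝ≥0∞ :=
  (multiIndices n l).sup fun α => derivNorm U α ∞ u

/-- `u ∈ W^{l,∞}(U)`. -/
def MemWInfty {n : ℕ} (U : Set (EuclideanSpace ℝ (Fin n))) (l : ℕ)
    (u : EuclideanSpace ℝ (Fin n) → ℂ) : Prop :=
  wInftyNorm U l u < ∞

/-- The data of a generalized finite element space: finitely many sets `ω_j` with balls
`ω_j^*` (given by centre and radius), functions `φ_j`, and local approximation spaces `Ψ_j`.
The elements of `Ψ_j` matter only through their values on `ω_j`, up to null sets. -/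
structure Data (n : ℕ) where
  N : ℕ
  ω : Fin N → Set (EuclideanSpace ℝ (Fin n))
  center : Fin N → EuclideanSpace ℝ (Fin n)
  radius : Fin N → ℝ
  φ : Fin N → EuclideanSpace ℝ (Fin n) → ℝ
  Ψ : Fin N → Submodule ℂ (EuclideanSpace ℝ (Fin n) → ℂ)

/-- The ball `ω_j^*`. -/
def Data.star {n : ℕ} (G : Data n) (j : Fin G.N) : Set (EuclideanSpace ℝ (Fin n)) :=
  Metric.ball (G.center j) (G.radius j)

/-- `{ω_j}`, `{φ_j}` form a `(κ, C_0, …, C_m)` partition of unity on `Ω`: the `ω_j` are bounded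
open sets covering `Ω`, no `κ + 1` of which have a common point, and the `φ_j` are nonnegative
Lipschitz functions on `Ω` with sum `1`, with `supp φ_j ⊆ ω_j` (support relative to `Ω`) and
`‖∂^α φ_j‖_{L^∞(Ω)} ≤ C_k / (diam ω_j)^k` for `k = |α| ≤ m`. -/
structure Data.IsPartition {n : ℕ} (G : Data n) (Ω : Set (EuclideanSpace ℝ (Fin n)))
    (m κ : ℕ) (C : ℕ → ℝ) : Prop where
  isOpen : ∀ j, IsOpen (G.ω j)
  bounded : ∀ j, Bornology.IsBounded (G.ω j)
  cover : Ω ⊆ ⋃ j, G.ω j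
  overlap : ∀ J : Finset (Fin G.N), J.card = κ + 1 → ⋂ j ∈ J, G.ω j = ∅
  lipschitz : ∀ j, ∃ K : ℝ≥0, LipschitzOnWith K (G.φ j) Ω
  nonneg : ∀ j, ∀ x ∈ Ω, 0 ≤ G.φ j x
  sum_eq_one : ∀ x ∈ Ω, ∑ j, G.φ j x = 1
  supp : ∀ j, Ω ∩ closure (Ω ∩ Function.support (G.φ j)) ⊆ G.ω j
  deriv_le : ∀ j, ∀ α ∈ multiIndices n m,
    derivNorm Ω α ∞ (fun x => (G.φ j x : ℂ)) ≤
      ENNReal.ofReal (C (∑ i, α i) / Metric.diam (G.ω j) ^ (∑ i, α i))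

/-- Assumption A: the `ω_j` are convex with `diam ω_j ≤ h ≤ 1`, the ball `ω_j^*` has diameter
at least `σ h` and closure in `ω_j`, and `ω_j^* ⊆ Ω` unless `φ_j` vanishes on `Ω`. -/
structure Data.AssumptionA {n : ℕ} (G : Data n) (Ω : Set (EuclideanSpace ℝ (Fin n)))
    (σ h : ℝ) : Prop where
  convex : ∀ j, Convex ℝ (G.ω j)
  diam_le : ∀ j, Metric.diam (G.ω j) ≤ h
  h_le_one : h ≤ 1
  le_diam_star : ∀ j, σ * h ≤ 2 * G.radius j
  closure_star : ∀ j, closure (G.star j) ⊆ G.ω j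
  star_subset : ∀ j, (∃ x ∈ Ω, G.φ j x ≠ 0) → G.star j ⊆ Ω

/-- Assumption B. -/
structure Data.AssumptionB {n : ℕ} (G : Data n) (Ω : Set (EuclideanSpace ℝ (Fin n)))
    (m κ : ℕ) (C : ℕ → ℝ) : Prop where
  partition : G.IsPartition Ω m κ C
  eq_one : ∀ j, ∀ x ∈ G.star j ∩ Ω, G.φ j x = 1

/-- Assumption C, together with `Ψ_j ⊆ H^m(ω_j)`. -/
structure Data.AssumptionC {n : ℕ} (G : Data n) (m : ℕ) (A : ℝ) : Prop where
  memH : ∀ j, ∀ v ∈ G.Ψ j, MemH (G.ω j) m v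
  affine : ∀ j, ∀ (a : ℂ) (b : Fin n → ℂ), ∃ v ∈ G.Ψ j,
    v =ᵐ[volume.restrict (G.ω j)] fun x => a + ∑ i, b i * (x i : ℂ)
  doubling : ∀ j, ∀ v ∈ G.Ψ j, ∀ l ≤ m,
    hNorm (G.ω j) l v ≤ ENNReal.ofReal A * hNorm (G.star j) l v

/-- Assumption D, the inverse assumption. -/
def Data.AssumptionD {n : ℕ} (G : Data n) (m : ℕ) (B : ℝ) : Prop :=
  ∀ j, ∀ v ∈ G.Ψ j, ∀ s t : ℕ, s ≤ t → t ≤ m →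
    hNorm (G.ω j) t v ≤
      ENNReal.ofReal (B * Metric.diam (G.ω j) ^ ((s : ℤ) - (t : ℤ))) * hNorm (G.ω j) s v

/-- The data satisfy Assumptions A, B, C and D with the given parameters. -/
structure Data.SatisfiesABCD {n : ℕ} (G : Data n) (Ω : Set (EuclideanSpace ℝ (Fin n)))
    (m κ : ℕ) (σ A B : ℝ) (C : ℕ → ℝ) (h : ℝ) : Prop where
  assumptionA : G.AssumptionA Ω σ h
  assumptionB : G.AssumptionB Ω m κ C
  assumptionC : G.AssumptionC m A
  assumptionD : G.AssumptionD m B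

/-- The GFEM space `S = {∑_j φ_j v_j : v_j ∈ Ψ_j}`, as functions on `Ω` up to equality almost
everywhere. -/
def Data.space {n : ℕ} (G : Data n) (Ω : Set (EuclideanSpace ℝ (Fin n))) :
    Set (EuclideanSpace ℝ (Fin n) → ℂ) :=
  {w | ∃ v : Fin G.N → EuclideanSpace ℝ (Fin n) → ℂ, (∀ j, v j ∈ G.Ψ j) ∧
    w =ᵐ[volume.restrict Ω] fun x => ∑ j, (G.φ j x : ℂ) * v j x}

/-- The support of `u` (a function on `Ω` up to null sets), as a closed subset of `ℝⁿ`: the points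
with no neighbourhood on which `u` vanishes almost everywhere in `Ω`. -/
def essSupport {n : ℕ} (Ω : Set (EuclideanSpace ℝ (Fin n)))
    (u : EuclideanSpace ℝ (Fin n) → ℂ) : Set (EuclideanSpace ℝ (Fin n)) :=
  {x | ∀ V : Set (EuclideanSpace ℝ (Fin n)), IsOpen V → x ∈ V →
    ¬ u =ᵐ[volume.restrict (V ∩ Ω)] 0}

/-- `Ω₁ ⋐ Ω`. -/
def CompactlyIn {n : ℕ} (Ω₁ Ω : Set (EuclideanSpace ℝ (Fin n))) : Prop :=
  IsCompact (closure Ω₁) ∧ closure Ω₁ ⊆ interior Ω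

/-- The distance between two sets (used for nonempty sets only). -/
def setDist {n : ℕ} (S T : Set (EuclideanSpace ℝ (Fin n))) : ℝ :=
  sInf (Set.image2 dist S T)

/-- `Ω` has Lipschitz boundary: near each boundary point, `Ω` is the set above the graph of a
Lipschitz function on the hyperplane orthogonal to some unit vector `e`. -/
def HasLipschitzBoundary {n : ℕ} (Ω : Set (EuclideanSpace ℝ (Fin n))) : Prop :=
  ∀ p ∈ frontier Ω, ∃ e : EuclideanSpace ℝ (Fin n), ‖e‖ = 1 ∧ ∃ r > (0 : ℝ), ∃ K : ℝ≥0,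
    ∃ f : EuclideanSpace ℝ (Fin n) → ℝ, LipschitzWith K f ∧
      ∀ x ∈ Metric.ball p r, x ∈ Ω ↔ f (x - inner ℝ e x • e) < inner ℝ e x

end GFEM

end

namespace GFEM
open Set Filter Topology Function

variable {n : ℕ}

/-! ### Classical multi-index derivatives -/

/-! Let `w = ∑ φ_j v_j`. The product `ρ w` is approximated patch by patch. Choose `y` in the ball
`ω_j^*` and a constant `c` close to `v_j` in `L²(ω_j)`, and put `ṽ_j = ρ(y) v_j + c ∇ρ(y)·(x - y)`.
This lies in `Ψ_j`, because `Ψ_j` is a linear space containing the affine functions. On the patch `ρ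
v_j - ṽ_j = (ρ - ρ(y)) (v_j - c) + (ρ - ρ(y) - ∇ρ(y)·(x - y)) c`. In the first term `ρ - ρ(y)` is of
size `h`, and `v_j - c` is of size `h ‖∇v_j‖` by the Poincaré inequality; in the second the Taylor
remainder is of size `h²`, with gradient of size `h`. A derivative falling on `φ_j` costs a factor
`1/h`, and one falling on the bracket costs at most one power of `h`, so the `H¹` norm of `φ_j (ρ
v_j - ṽ_j)` is at most a constant times `h ‖ρ‖_{W^{2,∞}} ‖v_j‖_{H¹(ω_j)}` (`exists_local_approx`).

The local functions are controlled by `w` through the balls. Since `φ_j = 1` on `ω_j^*`, all the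
other `φ_i` vanish there, so `v_j = w` on `ω_j^*` and the balls of active patches are disjoint. The
doubling property then gives `∑ ‖v_j‖²_{H¹(ω_j)} ≤ A² ‖w‖²_{H¹(Ω)}` (`sum_hNorm_sq_le`), while the
bounded overlap of the patches allows the local errors to be added (`exists_approx`). The Poincaré
inequality, too, is proved on the ball `ω_j^*` and carried to `ω_j` by doubling (`poincare`).

The Taylor estimates need paths inside `Ω` of length at most a constant times `h`, whereas `ω_j ∩ Ω`
need not be convex. A bounded connected Lipschitz domain is quasiconvex
(`HasLipschitzBoundary.quasiconvex`), and the estimates are proved along polygonal chains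
(`ae_taylor_along_chains`). For the interior statement with `h < θ`, every patch whose ball meets
the support of `w` has its closure in `Ω` and is convex, so segments suffice; the approximant
vanishes off these patches. If `h ≥ θ`, the zero function is already good enough.

Weak derivatives are handled by mollification, which yields the product rule, the Poincaré
inequality and the Taylor estimates from their smooth counterparts. -/

theorem pderiv_contDiff (i : Fin n) {f : EuclideanSpace ℝ (Fin n) → ℝ}
    (hf : ContDiff ℝ (⊤ : ℕ∞) f) : ContDiff ℝ (⊤ : ℕ∞) (pderiv i f) :=
  (hf.fderiv_right (m := (⊤ : ℕ∞)) le_rfl).clm_apply contDiff_const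

theorem pderiv_iterate_contDiff (i : Fin n) (k : ℕ) {f : EuclideanSpace ℝ (Fin n) → ℝ}
    (hf : ContDiff ℝ (⊤ : ℕ∞) f) : ContDiff ℝ (⊤ : ℕ∞) ((pderiv i)^[k] f) := by
  induction k generalizing f with
  | zero => exact hf
  | succ k ih => exact ih (pderiv_contDiff i hf)

theorem pderiv_comm (i j : Fin n) {f : EuclideanSpace ℝ (Fin n) → ℝ}
    (hf : ContDiff ℝ (⊤ : ℕ∞) f) : pderiv i (pderiv j f) = pderiv j (pderiv i f) := by
  have hd : Differentiable ℝ (fderiv ℝ f) :=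
    (hf.fderiv_right (m := (⊤ : ℕ∞)) le_rfl).differentiable (by simp)
  have key : ∀ (i j : Fin n) x, pderiv i (pderiv j f) x
      = fderiv ℝ (fderiv ℝ f) x (EuclideanSpace.single i 1) (EuclideanSpace.single j 1) := by
    intro i j x
    change fderiv ℝ (fun y => fderiv ℝ f y (EuclideanSpace.single j 1)) x _ = _
    rw [fderiv_clm_apply (hd x) (differentiableAt_const _)]
    simp
  funext x
  rw [key, key]
  exact (hf.contDiffAt.isSymmSndFDerivAt (by
    simpa using WithTop.coe_le_coe.2 (le_top : (2 : ℕ∞) ≤ ⊤))) _ _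

theorem pderiv_iterate_comm (i j : Fin n) (k : ℕ) {f : EuclideanSpace ℝ (Fin n) → ℝ}
    (hf : ContDiff ℝ (⊤ : ℕ∞) f) :
    (pderiv j)^[k] (pderiv i f) = pderiv i ((pderiv j)^[k] f) := by
  induction k generalizing f with
  | zero => rfl
  | succ k ih =>
    rw [iterate_succ_apply, iterate_succ_apply, pderiv_comm j i hf, ih (pderiv_contDiff j hf)]

theorem foldr_pderiv_contDiff (α : Fin n → ℕ) (l : List (Fin n))
    {f : EuclideanSpace ℝ (Fin n) → ℝ} (hf : ContDiff ℝ (⊤ : ℕ∞) f) :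
    ContDiff ℝ (⊤ : ℕ∞) (l.foldr (fun i g => (pderiv i)^[α i] g) f) := by
  induction l with
  | nil => exact hf
  | cons k l ih => exact pderiv_iterate_contDiff k _ ih

theorem foldr_pderiv_comm (α : Fin n → ℕ) (i : Fin n) (l : List (Fin n))
    {f : EuclideanSpace ℝ (Fin n) → ℝ} (hf : ContDiff ℝ (⊤ : ℕ∞) f) :
    l.foldr (fun i g => (pderiv i)^[α i] g) (pderiv i f)
      = pderiv i (l.foldr (fun i g => (pderiv i)^[α i] g) f) := by
  induction l with
  | nil => rfl
  | cons k l ih =>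
    rw [List.foldr_cons, List.foldr_cons, ih,
      pderiv_iterate_comm i k _ (foldr_pderiv_contDiff α l hf)]

/-- Commutation carries the additional derivative to the innermost place. Without `Nodup` it would
be applied once for each occurrence of `i`. -/
theorem foldr_pderiv_add_single (α : Fin n → ℕ) (i : Fin n) (l : List (Fin n)) (hl : l.Nodup)
    {f : EuclideanSpace ℝ (Fin n) → ℝ} (hf : ContDiff ℝ (⊤ : ℕ∞) f) :
    l.foldr (fun k g => (pderiv k)^[(α + Pi.single i 1 : Fin n → ℕ) k] g) f
      = if i ∈ l then l.foldr (fun k g => (pderiv k)^[α k] g) (pderiv i f)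
        else l.foldr (fun k g => (pderiv k)^[α k] g) f := by
  induction l with
  | nil => simp
  | cons k l ih =>
    rw [List.nodup_cons] at hl
    rw [List.foldr_cons, ih hl.2]
    by_cases hki : i = k
    · subst hki
      simp only [hl.1, if_false, List.mem_cons_self, if_true, Pi.add_apply, Pi.single_eq_same,
        List.foldr_cons]
      rw [iterate_succ_apply, foldr_pderiv_comm α i l hf]
    · have h0 : (Pi.single i 1 : Fin n → ℕ) k = 0 := Pi.single_eq_of_ne (Ne.symm hki) 1
      simp only [List.mem_cons, hki, false_or, Pi.add_apply, h0, add_zero, List.foldr_cons]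
      split_ifs <;> rfl

theorem mderiv_zero (f : EuclideanSpace ℝ (Fin n) → ℝ) : mderiv 0 f = f := by
  unfold mderiv
  generalize List.finRange n = l
  induction l with
  | nil => rfl
  | cons k l ih => rw [List.foldr_cons, ih]; rfl

theorem mderiv_add_single (α : Fin n → ℕ) (i : Fin n) {f : EuclideanSpace ℝ (Fin n) → ℝ}
    (hf : ContDiff ℝ (⊤ : ℕ∞) f) :
    mderiv (α + Pi.single i 1) f = mderiv α (pderiv i f) := by
  unfold mderiv
  rw [foldr_pderiv_add_single α i _ (List.nodup_finRange n) hf]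
  simp

theorem mderiv_single (i : Fin n) {f : EuclideanSpace ℝ (Fin n) → ℝ}
    (hf : ContDiff ℝ (⊤ : ℕ∞) f) : mderiv (Pi.single i 1) f = pderiv i f := by
  have := mderiv_add_single 0 i hf
  rwa [zero_add, mderiv_zero] at this

theorem pderiv_tsupport_subset (i : Fin n) (f : EuclideanSpace ℝ (Fin n) → ℝ) :
    tsupport (pderiv i f) ⊆ tsupport f := by
  refine (closure_mono ?_).trans (tsupport_fderiv_subset ℝ (f := f))
  intro x hx h
  exact hx (by simp [pderiv, h])

theorem pderiv_hasCompactSupport (i : Fin n) {f : EuclideanSpace ℝ (Fin n) → ℝ}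
    (hf : HasCompactSupport f) : HasCompactSupport (pderiv i f) :=
  hf.mono' ((subset_tsupport _).trans (pderiv_tsupport_subset i f))

theorem pderiv_mul (i : Fin n) {f g : EuclideanSpace ℝ (Fin n) → ℝ}
    (hf : ContDiff ℝ (⊤ : ℕ∞) f) (hg : ContDiff ℝ (⊤ : ℕ∞) g) (x : EuclideanSpace ℝ (Fin n)) :
    pderiv i (fun y => f y * g y) x = pderiv i f x * g x + f x * pderiv i g x := by
  unfold pderiv
  rw [fderiv_fun_mul (hf.differentiable (by simp) x) (hg.differentiable (by simp) x)]
  simp; ring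

/-! ### Weak first-order partial derivatives -/

/-- `g` is the weak partial derivative `∂_i u` on `U`. -/
def HasWeakPartial (U : Set (EuclideanSpace ℝ (Fin n))) (i : Fin n)
    (u g : EuclideanSpace ℝ (Fin n) → ℂ) : Prop :=
  LocallyIntegrableOn u U volume ∧ LocallyIntegrableOn g U volume ∧
    ∀ ψ : EuclideanSpace ℝ (Fin n) → ℝ, ContDiff ℝ (⊤ : ℕ∞) ψ → HasCompactSupport ψ →
      tsupport ψ ⊆ U → ∫ x in U, pderiv i ψ x • u x = - ∫ x in U, ψ x • g x

theorem hasWeakDeriv_single {U : Set (EuclideanSpace ℝ (Fin n))} {i : Fin n}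
    {u g : EuclideanSpace ℝ (Fin n) → ℂ} :
    HasWeakDeriv U (Pi.single i 1) u g ↔ HasWeakPartial U i u g := by
  unfold HasWeakDeriv HasWeakPartial
  refine and_congr_right fun _ => and_congr_right fun _ => forall_congr' fun ψ =>
    forall_congr' fun hψ => ?_
  rw [mderiv_single i hψ]
  simp

theorem hasWeakDeriv_zero_self {U : Set (EuclideanSpace ℝ (Fin n))}
    {u : EuclideanSpace ℝ (Fin n) → ℂ} (hu : LocallyIntegrableOn u U volume) :
    HasWeakDeriv U 0 u u :=
  ⟨hu, hu, fun ψ _ _ _ => by simp [mderiv_zero]⟩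

theorem setIntegral_eq_of_tsupport_subset {F : Type*} [NormedAddCommGroup F] [NormedSpace ℝ F]
    {U : Set (EuclideanSpace ℝ (Fin n))}
    {ψ : EuclideanSpace ℝ (Fin n) → ℝ} (hψ : tsupport ψ ⊆ U)
    (u : EuclideanSpace ℝ (Fin n) → F) : ∫ x in U, ψ x • u x = ∫ x, ψ x • u x := by
  apply setIntegral_eq_integral_of_forall_compl_eq_zero
  intro x hx
  rw [image_eq_zero_of_notMem_tsupport (fun h => hx (hψ h)), zero_smul]

/-- Testing a locally integrable function against a continuous compactly supported one. -/
theorem integrableOn_smul_of_tsupport_subset {U : Set (EuclideanSpace ℝ (Fin n))}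
    {ψ : EuclideanSpace ℝ (Fin n) → ℝ} (hc : Continuous ψ) (hs : HasCompactSupport ψ)
    (hψ : tsupport ψ ⊆ U) {u : EuclideanSpace ℝ (Fin n) → ℂ}
    (hu : LocallyIntegrableOn u U volume) : Integrable (fun x => ψ x • u x) := by
  have h1 : IntegrableOn u (tsupport ψ) volume := hu.integrableOn_compact_subset hψ hs
  have h2 : IntegrableOn (fun x => ψ x • u x) (tsupport ψ) volume :=
    h1.continuousOn_smul hc.continuousOn hs
  rwa [integrableOn_iff_integrable_of_support_subset] at h2
  intro x hx
  apply subset_tsupport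
  intro h0
  exact hx (by simp [h0])

/-- The fundamental lemma of the calculus of variations; uniqueness of weak derivatives rests on it.
-/
theorem ae_eq_of_forall_test {U : Set (EuclideanSpace ℝ (Fin n))} (hU : IsOpen U)
    {g g' : EuclideanSpace ℝ (Fin n) → ℂ} (hg : LocallyIntegrableOn g U volume)
    (hg' : LocallyIntegrableOn g' U volume)
    (h : ∀ ψ : EuclideanSpace ℝ (Fin n) → ℝ, ContDiff ℝ (⊤ : ℕ∞) ψ → HasCompactSupport ψ →
      tsupport ψ ⊆ U → ∫ x in U, ψ x • g x = ∫ x in U, ψ x • g' x) :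
    g =ᵐ[volume.restrict U] g' := by
  have := hU.ae_eq_zero_of_integral_contDiff_smul_eq_zero (μ := volume) (hg.sub hg') ?_
  · rw [EventuallyEq, ae_restrict_iff' hU.measurableSet]
    filter_upwards [this] with x hx hxU
    simpa [sub_eq_zero] using hx hxU
  · intro ψ h1 h2 h3
    have := h ψ h1 h2 h3
    rw [setIntegral_eq_of_tsupport_subset h3, setIntegral_eq_of_tsupport_subset h3] at this
    simp only [Pi.sub_apply, smul_sub]
    rw [integral_sub (integrableOn_smul_of_tsupport_subset h1.continuous h2 h3 hg)
      (integrableOn_smul_of_tsupport_subset h1.continuous h2 h3 hg'), this, sub_self]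

theorem HasWeakDeriv.unique {U : Set (EuclideanSpace ℝ (Fin n))} (hU : IsOpen U)
    {α : Fin n → ℕ} {u g g' : EuclideanSpace ℝ (Fin n) → ℂ} (h : HasWeakDeriv U α u g)
    (h' : HasWeakDeriv U α u g') : g =ᵐ[volume.restrict U] g' := by
  refine ae_eq_of_forall_test hU h.2.1 h'.2.1 fun ψ h1 h2 h3 => ?_
  have := (h.2.2 ψ h1 h2 h3).symm.trans (h'.2.2 ψ h1 h2 h3)
  exact mul_left_cancel₀ (by simp) this

theorem derivNorm_eq {U : Set (EuclideanSpace ℝ (Fin n))} (hU : IsOpen U)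
    {α : Fin n → ℕ} {p : ℝ≥0∞} {u g : EuclideanSpace ℝ (Fin n) → ℂ}
    (h : HasWeakDeriv U α u g) : derivNorm U α p u = eLpNorm g p (volume.restrict U) := by
  refine le_antisymm (iInf₂_le g h) (le_iInf₂ fun g' h' => ?_)
  rw [eLpNorm_congr_ae (h.unique hU h')]

theorem exists_hasWeakDeriv_of_derivNorm_ne_top {U : Set (EuclideanSpace ℝ (Fin n))}
    {α : Fin n → ℕ} {p : ℝ≥0∞} {u : EuclideanSpace ℝ (Fin n) → ℂ}
    (h : derivNorm U α p u ≠ ∞) : ∃ g, HasWeakDeriv U α u g := by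
  by_contra! hn
  exact h (by simp [derivNorm, hn])

theorem LocallyIntegrableOn.congr_ae {U : Set (EuclideanSpace ℝ (Fin n))} (hU : IsOpen U)
    {u v : EuclideanSpace ℝ (Fin n) → ℂ} (hu : LocallyIntegrableOn u U volume)
    (h : u =ᵐ[volume.restrict U] v) : LocallyIntegrableOn v U volume := by
  rw [locallyIntegrableOn_iff hU.isLocallyClosed] at hu ⊢
  intro k hk hk'
  exact (hu k hk hk').congr (ae_restrict_of_ae_restrict_of_subset hk h)

theorem HasWeakDeriv.congr {U : Set (EuclideanSpace ℝ (Fin n))} (hU : IsOpen U)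
    {α : Fin n → ℕ} {u g v k : EuclideanSpace ℝ (Fin n) → ℂ} (h : HasWeakDeriv U α u g)
    (huv : u =ᵐ[volume.restrict U] v) (hgk : g =ᵐ[volume.restrict U] k) :
    HasWeakDeriv U α v k := by
  refine ⟨LocallyIntegrableOn.congr_ae hU h.1 huv, LocallyIntegrableOn.congr_ae hU h.2.1 hgk,
    fun ψ h1 h2 h3 => ?_⟩
  rw [integral_congr_ae (g := fun x => mderiv α ψ x • u x),
    integral_congr_ae (f := fun x => ψ x • k x) (g := fun x => ψ x • g x), h.2.2 ψ h1 h2 h3]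
  · filter_upwards [hgk] with x hx; simp [hx]
  · filter_upwards [huv] with x hx; simp [hx]

theorem derivNorm_congr {U : Set (EuclideanSpace ℝ (Fin n))} (hU : IsOpen U)
    {α : Fin n → ℕ} {p : ℝ≥0∞} {u v : EuclideanSpace ℝ (Fin n) → ℂ}
    (huv : u =ᵐ[volume.restrict U] v) : derivNorm U α p u = derivNorm U α p v := by
  unfold derivNorm
  refine iInf_congr fun g => iInf_congr_Prop ⟨fun h => ?_, fun h => ?_⟩ fun _ => rfl
  · exact h.congr hU huv EventuallyEq.rfl
  · exact h.congr hU huv.symm EventuallyEq.rfl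

theorem hNorm_congr {U : Set (EuclideanSpace ℝ (Fin n))} (hU : IsOpen U)
    {l : ℕ} {u v : EuclideanSpace ℝ (Fin n) → ℂ}
    (huv : u =ᵐ[volume.restrict U] v) : hNorm U l u = hNorm U l v := by
  unfold hNorm
  simp_rw [derivNorm_congr hU huv]

theorem HasWeakPartial.congr {U : Set (EuclideanSpace ℝ (Fin n))} (hU : IsOpen U)
    {i : Fin n} {u g v k : EuclideanSpace ℝ (Fin n) → ℂ} (h : HasWeakPartial U i u g)
    (huv : u =ᵐ[volume.restrict U] v) (hgk : g =ᵐ[volume.restrict U] k) :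
    HasWeakPartial U i v k :=
  hasWeakDeriv_single.1 ((hasWeakDeriv_single.2 h).congr hU huv hgk)

theorem HasWeakPartial.unique {U : Set (EuclideanSpace ℝ (Fin n))} (hU : IsOpen U)
    {i : Fin n} {u g g' : EuclideanSpace ℝ (Fin n) → ℂ} (h : HasWeakPartial U i u g)
    (h' : HasWeakPartial U i u g') : g =ᵐ[volume.restrict U] g' :=
  (hasWeakDeriv_single.2 h).unique hU (hasWeakDeriv_single.2 h')

theorem HasWeakPartial.mono {U V : Set (EuclideanSpace ℝ (Fin n))}
    {i : Fin n} {u g : EuclideanSpace ℝ (Fin n) → ℂ} (h : HasWeakPartial U i u g)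
    (hVU : V ⊆ U) : HasWeakPartial V i u g := by
  refine ⟨h.1.mono_set hVU, h.2.1.mono_set hVU, fun ψ h1 h2 h3 => ?_⟩
  have := h.2.2 ψ h1 h2 (h3.trans hVU)
  rw [setIntegral_eq_of_tsupport_subset (h3.trans hVU), setIntegral_eq_of_tsupport_subset
    ((pderiv_tsupport_subset i ψ).trans (h3.trans hVU))] at this
  rw [setIntegral_eq_of_tsupport_subset h3, setIntegral_eq_of_tsupport_subset
    ((pderiv_tsupport_subset i ψ).trans h3), this]

theorem HasWeakDeriv.ae_eq_of_zero {U : Set (EuclideanSpace ℝ (Fin n))}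
    {u g : EuclideanSpace ℝ (Fin n) → ℂ} (hU : IsOpen U) (h : HasWeakDeriv U 0 u g) :
    u =ᵐ[volume.restrict U] g :=
  (hasWeakDeriv_zero_self h.1).unique hU h

theorem HasWeakPartial.add {U : Set (EuclideanSpace ℝ (Fin n))}
    {i : Fin n} {u g v k : EuclideanSpace ℝ (Fin n) → ℂ} (h : HasWeakPartial U i u g)
    (h' : HasWeakPartial U i v k) :
    HasWeakPartial U i (fun x => u x + v x) (fun x => g x + k x) := by
  refine ⟨h.1.add h'.1, h.2.1.add h'.2.1, fun ψ h1 h2 h3 => ?_⟩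
  have hp := (pderiv_contDiff i h1).continuous
  have hpc := pderiv_hasCompactSupport i h2
  have hps := (pderiv_tsupport_subset i ψ).trans h3
  simp only [smul_add]
  rw [integral_add (integrableOn_smul_of_tsupport_subset hp hpc hps h.1).integrableOn
    (integrableOn_smul_of_tsupport_subset hp hpc hps h'.1).integrableOn,
    integral_add (integrableOn_smul_of_tsupport_subset h1.continuous h2 h3 h.2.1).integrableOn
    (integrableOn_smul_of_tsupport_subset h1.continuous h2 h3 h'.2.1).integrableOn,
    h.2.2 ψ h1 h2 h3, h'.2.2 ψ h1 h2 h3]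
  ring

theorem HasWeakPartial.const_mul {U : Set (EuclideanSpace ℝ (Fin n))}
    {i : Fin n} {u g : EuclideanSpace ℝ (Fin n) → ℂ} (h : HasWeakPartial U i u g) (c : ℂ) :
    HasWeakPartial U i (fun x => c * u x) (fun x => c * g x) := by
  refine ⟨h.1.smul c, h.2.1.smul c, fun ψ h1 h2 h3 => ?_⟩
  simp only [mul_comm c, ← smul_mul_assoc]
  rw [integral_mul_const, integral_mul_const, h.2.2 ψ h1 h2 h3]
  ring

/-- A continuously differentiable function has its classical partial derivatives as weak ones. -/
theorem hasWeakPartial_of_contDiff (U : Set (EuclideanSpace ℝ (Fin n))) (i : Fin n)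
    {u : EuclideanSpace ℝ (Fin n) → ℂ} (hu : ContDiff ℝ 1 u) :
    HasWeakPartial U i u (fun x => fderiv ℝ u x (EuclideanSpace.single i 1)) := by
  have hc : Continuous (fun x => fderiv ℝ u x (EuclideanSpace.single i 1)) :=
    (hu.continuous_fderiv (by simp)).clm_apply continuous_const
  have hl := hu.continuous.locallyIntegrable (μ := (volume : Measure (EuclideanSpace ℝ (Fin n))))
  have hl' := hc.locallyIntegrable (μ := (volume : Measure (EuclideanSpace ℝ (Fin n))))
  -- A test function on `U` is one on the whole space, where integration by parts has no boundary
  -- term.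
  refine HasWeakPartial.mono (U := univ) ⟨hl.locallyIntegrableOn _, hl'.locallyIntegrableOn _,
    fun ψ h1 h2 _ => ?_⟩ (subset_univ _)
  simp only [Measure.restrict_univ]
  have i1 := integrableOn_smul_of_tsupport_subset (h1.continuous) h2 (subset_univ _)
    (hl.locallyIntegrableOn _)
  have i2 := integrableOn_smul_of_tsupport_subset (h1.continuous) h2 (subset_univ _)
    (hl'.locallyIntegrableOn _)
  have i3 := integrableOn_smul_of_tsupport_subset (pderiv_contDiff i h1).continuous
    (pderiv_hasCompactSupport i h2) (subset_univ _) (hl.locallyIntegrableOn _)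
  have := integral_smul_fderiv_eq_neg_fderiv_smul_of_integrable (𝕜 := ℝ) (f := ψ) (g := u)
    (v := EuclideanSpace.single i (1 : ℝ)) (μ := volume) i3 i2 i1
    (fun x _ => h1.differentiable (by simp) x) (fun x _ => hu.differentiable (by simp) x)
  rw [this, neg_neg]
  rfl

/-- The second-order weak derivatives are the weak partial derivatives of the first-order ones. -/
theorem HasWeakPartial.of_second {U : Set (EuclideanSpace ℝ (Fin n))} {i j : Fin n}
    {u g k : EuclideanSpace ℝ (Fin n) → ℂ} (h : HasWeakPartial U j u g)
    (h2 : HasWeakDeriv U (Pi.single j 1 + Pi.single i 1) u k) : HasWeakPartial U i g k := by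
  refine ⟨h.2.1, h2.2.1, fun ψ h1 hc hs => ?_⟩
  -- With `∂_i ψ` as test function, the first-order relation produces the mixed derivative of `ψ`
  -- that occurs in the second-order one.
  have e1 := h.2.2 (pderiv i ψ) (pderiv_contDiff i h1) (pderiv_hasCompactSupport i hc)
    ((pderiv_tsupport_subset i ψ).trans hs)
  have e2 := h2.2.2 ψ h1 hc hs
  rw [mderiv_add_single _ i h1, mderiv_single j (pderiv_contDiff i h1), e1] at e2
  rw [← neg_inj, e2]
  simp [Finset.sum_add_distrib]

/-! ### Multi-indices of low order and the corresponding norms. -/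

theorem multiIndices_one :
    multiIndices n 1 = insert 0 (Finset.univ.image fun i : Fin n => Pi.single i 1) := by
  ext α
  simp only [multiIndices, Finset.mem_filter, Fintype.mem_piFinset, Finset.mem_range,
    Finset.mem_insert, Finset.mem_image, Finset.mem_univ, true_and]
  constructor
  · rintro ⟨_, h⟩
    by_cases h0 : α = 0
    · exact Or.inl h0
    · right
      obtain ⟨i, hi⟩ := Function.ne_iff.1 h0
      refine ⟨i, ?_⟩
      have hs := Finset.add_sum_erase Finset.univ α (Finset.mem_univ i)
      have hi' : α i ≠ 0 := hi
      have h1 : ∑ k ∈ Finset.univ.erase i, α k = 0 := by omega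
      rw [Finset.sum_eq_zero_iff] at h1
      funext k
      by_cases hk : k = i
      · subst hk; simp; omega
      · rw [Pi.single_eq_of_ne hk, h1 k (by simp [hk])]
  · rintro (rfl | ⟨i, rfl⟩)
    · simp
    · refine ⟨fun k => ?_, by simp⟩
      by_cases hk : k = i
      · subst hk; simp
      · rw [Pi.single_eq_of_ne hk]; simp

theorem sum_multiIndices_one {β : Type*} [AddCommMonoid β] (F : (Fin n → ℕ) → β) :
    ∑ α ∈ multiIndices n 1, F α = F 0 + ∑ i, F (Pi.single i 1) := by
  have hinj : Function.Injective (fun i : Fin n => (Pi.single i 1 : Fin n → ℕ)) := by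
    intro i j hij
    by_contra hne
    have := congrFun hij i
    simp [Pi.single_eq_of_ne hne] at this
  rw [multiIndices_one, Finset.sum_insert, Finset.sum_image (fun _ _ _ _ h => hinj h)]
  simp only [Finset.mem_image, Finset.mem_univ, true_and, not_exists]
  intro i h
  simpa using congrFun h i

theorem hNorm_sq (U : Set (EuclideanSpace ℝ (Fin n))) (l : ℕ)
    (u : EuclideanSpace ℝ (Fin n) → ℂ) :
    hNorm U l u ^ 2 = ∑ α ∈ multiIndices n l, derivNorm U α 2 u ^ 2 := by
  unfold hNorm
  rw [← ENNReal.rpow_natCast, ← ENNReal.rpow_mul]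
  norm_num

theorem hNorm_one_sq (U : Set (EuclideanSpace ℝ (Fin n)))
    (u : EuclideanSpace ℝ (Fin n) → ℂ) :
    hNorm U 1 u ^ 2 = derivNorm U 0 2 u ^ 2 + ∑ i, derivNorm U (Pi.single i 1) 2 u ^ 2 := by
  rw [hNorm_sq, sum_multiIndices_one]

theorem multiIndices_zero : multiIndices n 0 = {0} := by
  ext α
  simp only [multiIndices, Finset.mem_filter, Fintype.mem_piFinset, Finset.mem_range,
    Finset.mem_singleton]
  constructor
  · rintro ⟨h, _⟩
    funext i
    simpa using h i
  · rintro rfl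
    simp

theorem hNorm_zero_sq (U : Set (EuclideanSpace ℝ (Fin n)))
    (u : EuclideanSpace ℝ (Fin n) → ℂ) :
    hNorm U 0 u ^ 2 = derivNorm U 0 2 u ^ 2 := by
  rw [hNorm_sq, multiIndices_zero, Finset.sum_singleton]

theorem multiIndices_mono {l m : ℕ} (h : l ≤ m) : multiIndices n l ⊆ multiIndices n m := by
  intro α
  simp only [multiIndices, Finset.mem_filter, Fintype.mem_piFinset, Finset.mem_range]
  rintro ⟨h1, h2⟩
  exact ⟨fun i => (h1 i).trans_le (by omega), h2.trans h⟩

/-! ### Mollification -/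

/-- A standard sequence of bump functions shrinking to the origin. -/
noncomputable def bump (n k : ℕ) : ContDiffBump (0 : EuclideanSpace ℝ (Fin n)) where
  rIn := 1 / (2 * (k + 1))
  rOut := 1 / (k + 1)
  rIn_pos := by positivity
  rIn_lt_rOut := by
    apply one_div_lt_one_div_of_lt <;> linarith [k.cast_nonneg (α := ℝ)]

/-- The convolution kernel of the mollifier. -/
noncomputable def kern (n k : ℕ) : EuclideanSpace ℝ (Fin n) → ℝ :=
  (bump n k).normed volume

/-- The mollification of `u` at scale `1 / (k + 1)`. -/
noncomputable def moll (k : ℕ) (u : EuclideanSpace ℝ (Fin n) → ℂ) :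
    EuclideanSpace ℝ (Fin n) → ℂ :=
  convolution (kern n k) u (ContinuousLinearMap.lsmul ℝ ℝ) volume

theorem kern_contDiff (k : ℕ) : ContDiff ℝ (⊤ : ℕ∞) (kern n k) :=
  (bump n k).contDiff_normed

theorem kern_hasCompactSupport (k : ℕ) : HasCompactSupport (kern n k) :=
  (bump n k).hasCompactSupport_normed

theorem kern_nonneg (k : ℕ) (x : EuclideanSpace ℝ (Fin n)) : 0 ≤ kern n k x :=
  (bump n k).nonneg_normed x

theorem integral_kern (k : ℕ) : ∫ x, kern n k x = 1 :=
  (bump n k).integral_normed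

theorem integrable_kern (k : ℕ) : Integrable (kern n k) :=
  (kern_contDiff k).continuous.integrable_of_hasCompactSupport (kern_hasCompactSupport k)

theorem support_kern (k : ℕ) : support (kern n k) = Metric.ball 0 (1 / (k + 1) : ℝ) :=
  (bump n k).support_normed_eq

theorem moll_apply (k : ℕ) (u : EuclideanSpace ℝ (Fin n) → ℂ) (x : EuclideanSpace ℝ (Fin n)) :
    moll k u x = ∫ t, kern n k (x - t) • u t := by
  rw [moll, convolution_eq_swap]
  rfl

theorem moll_apply' (k : ℕ) (u : EuclideanSpace ℝ (Fin n) → ℂ) (x : EuclideanSpace ℝ (Fin n)) :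
    moll k u x = ∫ t, kern n k t • u (x - t) := rfl

theorem moll_contDiff (k : ℕ) {u : EuclideanSpace ℝ (Fin n) → ℂ} (hu : LocallyIntegrable u) :
    ContDiff ℝ (⊤ : ℕ∞) (moll k u) :=
  (kern_hasCompactSupport k).contDiff_convolution_left _ (kern_contDiff k) hu

theorem moll_tendsto {u : EuclideanSpace ℝ (Fin n) → ℂ} (hu : LocallyIntegrable u) :
    ∀ᵐ x, Tendsto (fun k => moll k u x) atTop (𝓝 (u x)) := by
  -- The outer radius is exactly twice the inner one. A bounded ratio keeps the kernels comparable
  -- with averages over balls, so Lebesgue differentiation gives convergence almost everywhere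
  -- without continuity of `u`.
  refine ContDiffBump.ae_convolution_tendsto_right_of_locallyIntegrable (φ := bump n) (K := 2)
    ?_ ?_ hu
  · exact tendsto_one_div_add_atTop_nhds_zero_nat
  · refine Eventually.of_forall fun k => ?_
    change (1 / (k + 1) : ℝ) ≤ 2 * (1 / (2 * (k + 1)))
    apply le_of_eq
    field_simp

theorem norm_moll_le (k : ℕ) {u : EuclideanSpace ℝ (Fin n) → ℂ} {M : ℝ}
    (hu : ∀ᵐ x, ‖u x‖ ≤ M) (x : EuclideanSpace ℝ (Fin n)) : ‖moll k u x‖ ≤ M := by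
  have hi : Integrable (fun t => kern n k (x - t)) := (integrable_kern k).comp_sub_left x
  rw [moll_apply]
  calc ‖∫ t, kern n k (x - t) • u t‖ ≤ ∫ t, kern n k (x - t) * M := by
        refine norm_integral_le_of_norm_le (hi.mul_const M) ?_
        filter_upwards [hu] with t ht
        rw [norm_smul, Real.norm_of_nonneg (kern_nonneg _ _)]
        exact mul_le_mul_of_nonneg_left ht (kern_nonneg _ _)
    _ = M := by
        rw [integral_mul_const, integral_sub_left_eq_self (kern n k) volume x, integral_kern,
          one_mul]

theorem support_moll_subset (k : ℕ) {u : EuclideanSpace ℝ (Fin n) → ℂ}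
    {K : Set (EuclideanSpace ℝ (Fin n))} (hu : ∀ x ∉ K, u x = 0) :
    tsupport (moll k u) ⊆ Metric.cthickening (1 / (k + 1) : ℝ) K := by
  refine closure_minimal ?_ Metric.isClosed_cthickening
  intro x hx
  by_contra hxK
  apply hx
  rw [moll_apply']
  refine integral_eq_zero_of_ae (Eventually.of_forall fun t => ?_)
  by_cases ht : t ∈ support (kern n k)
  · have : u (x - t) = 0 := by
      apply hu
      intro hK
      apply hxK
      rw [support_kern, mem_ball_zero_iff] at ht
      exact Metric.mem_cthickening_of_dist_le x (x - t) _ K hK (by simpa [dist_eq_norm] using ht.le)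
    simp [this]
  · rw [notMem_support] at ht
    simp [ht]

/-- Mollification commutes with weak derivatives, away from the boundary. -/
theorem fderiv_moll {U : Set (EuclideanSpace ℝ (Fin n))} {i : Fin n}
    {u g : EuclideanSpace ℝ (Fin n) → ℂ} (hu : LocallyIntegrable u)
    (h : HasWeakPartial U i u g) (k : ℕ) {x : EuclideanSpace ℝ (Fin n)}
    (hx : Metric.closedBall x (1 / (k + 1) : ℝ) ⊆ U) :
    fderiv ℝ (moll k u) x (EuclideanSpace.single i 1) = moll k g x := by
  have hc1 : ContDiff ℝ 1 (kern n k) := (kern_contDiff k).of_le (by simp)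
  have hfd := ((kern_hasCompactSupport k).hasFDerivAt_convolution_left
    (ContinuousLinearMap.lsmul ℝ ℝ : ℝ →L[ℝ] ℂ →L[ℝ] ℂ) hc1 hu x).fderiv
  have hex := (((kern_hasCompactSupport (n := n) k).fderiv (𝕜 := ℝ)).convolutionExists_left
    ((ContinuousLinearMap.lsmul ℝ ℝ : ℝ →L[ℝ] ℂ →L[ℝ] ℂ).precompL (EuclideanSpace ℝ (Fin n)))
    (hc1.continuous_fderiv (by simp)) hu x)
  have e1 : fderiv ℝ (moll k u) x (EuclideanSpace.single i 1)
      = ∫ t, pderiv i (kern n k) t • u (x - t) := by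
    unfold moll
    rw [hfd, convolution_def, ContinuousLinearMap.integral_apply hex]
    rfl
  -- The reflected kernel is the test function; the sign from the reflection cancels the sign in the
  -- definition of the weak derivative.
  set ψ : EuclideanSpace ℝ (Fin n) → ℝ := fun t => kern n k (x - t) with hψ
  have hψs : ContDiff ℝ (⊤ : ℕ∞) ψ := (kern_contDiff k).comp (contDiff_const.sub contDiff_id)
  have hts : tsupport ψ ⊆ Metric.closedBall x (1 / (k + 1) : ℝ) := by
    refine closure_minimal (fun t ht => ?_) Metric.isClosed_closedBall
    have : x - t ∈ support (kern n k) := ht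
    rw [support_kern, mem_ball_zero_iff] at this
    rw [Metric.mem_closedBall, dist_comm, dist_eq_norm]
    exact this.le
  have hψc : HasCompactSupport ψ :=
    HasCompactSupport.of_support_subset_isCompact (isCompact_closedBall x _)
      ((subset_tsupport _).trans hts)
  have hψd : ∀ t, pderiv i ψ t = - pderiv i (kern n k) (x - t) := by
    intro t
    have hk : HasFDerivAt (kern n k) (fderiv ℝ (kern n k) (x - t)) (x - t) :=
      ((kern_contDiff k).differentiable (by simp) _).hasFDerivAt
    have hsub : HasFDerivAt (fun t => x - t) (-ContinuousLinearMap.id ℝ _) t := by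
      simpa using (hasFDerivAt_id t).const_sub x
    have := (hk.comp t hsub).fderiv
    change fderiv ℝ (kern n k ∘ fun t => x - t) t _ = _
    rw [this]
    simp [pderiv]
  have := h.2.2 ψ hψs hψc (hts.trans hx)
  rw [setIntegral_eq_of_tsupport_subset ((pderiv_tsupport_subset i ψ).trans (hts.trans hx)),
    setIntegral_eq_of_tsupport_subset (hts.trans hx)] at this
  rw [e1, moll_apply, ← neg_inj, ← this, ← integral_sub_left_eq_self _ volume x, ← integral_neg]
  simp [hψd]

/-- Mollification does not increase the `L²` norm. -/
theorem lintegral_moll_sq_le (k : ℕ) {u : EuclideanSpace ℝ (Fin n) → ℂ}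
    (hu : AEStronglyMeasurable u) :
    ∫⁻ x, ‖moll k u x‖ₑ ^ 2 ≤ ∫⁻ x, ‖u x‖ₑ ^ 2 := by
  have hk1 : ∫⁻ t, ‖kern n k t‖ₑ = 1 := by
    have := ofReal_integral_eq_lintegral_ofReal (integrable_kern (n := n) k)
      (Eventually.of_forall (kern_nonneg k))
    rw [integral_kern] at this
    simp only [ENNReal.ofReal_one] at this
    rw [this]
    exact lintegral_congr fun t => (Real.enorm_of_nonneg (kern_nonneg k t))
  have hkm : Measurable (fun t => ‖kern n k t‖ₑ) :=
    (kern_contDiff k).continuous.measurable.enorm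
  have hu2 : AEMeasurable (fun p : EuclideanSpace ℝ (Fin n) × EuclideanSpace ℝ (Fin n) =>
      ‖u (p.1 - p.2)‖ₑ) (volume.prod volume) :=
    (hu.comp_quasiMeasurePreserving (quasiMeasurePreserving_sub_of_right_invariant _ _)).enorm
  have hsec : ∀ x, AEMeasurable (fun t => ‖u (x - t)‖ₑ) := fun x =>
    (hu.comp_quasiMeasurePreserving (quasiMeasurePreserving_sub_left _ x)).enorm
  -- Cauchy–Schwarz after splitting the kernel into two square roots. The first factor is the total
  -- mass of the kernel, which is one.
  have key : ∀ x, ‖moll k u x‖ₑ ^ 2 ≤ ∫⁻ t, ‖kern n k t‖ₑ * ‖u (x - t)‖ₑ ^ 2 := by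
    intro x
    have h1 : ‖moll k u x‖ₑ ≤ ∫⁻ t, (‖kern n k t‖ₑ ^ (1/2 : ℝ)) *
        (‖kern n k t‖ₑ ^ (1/2 : ℝ) * ‖u (x - t)‖ₑ) := by
      rw [moll_apply']
      refine (enorm_integral_le_lintegral_enorm _).trans (le_of_eq (lintegral_congr fun t => ?_))
      rw [enorm_smul, ← mul_assoc, ← ENNReal.rpow_add_of_nonneg _ _ (by norm_num) (by norm_num)]
      norm_num
    have h2 := ENNReal.lintegral_mul_le_Lp_mul_Lq (volume : Measure (EuclideanSpace ℝ (Fin n)))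
      Real.HolderConjugate.two_two (f := fun t => ‖kern n k t‖ₑ ^ (1/2 : ℝ))
      (g := fun t => ‖kern n k t‖ₑ ^ (1/2 : ℝ) * ‖u (x - t)‖ₑ)
      (hkm.pow_const _).aemeasurable ((hkm.pow_const _).aemeasurable.mul (hsec x))
    have h3 := pow_le_pow_left' (h1.trans h2) 2
    refine h3.trans (le_of_eq ?_)
    simp only [ENNReal.rpow_two, mul_pow]
    have h4 : ∀ t, (‖kern n k t‖ₑ ^ (1/2 : ℝ)) ^ 2 = ‖kern n k t‖ₑ := by
      intro t
      rw [← ENNReal.rpow_natCast, ← ENNReal.rpow_mul]; norm_num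
    have h5 : ∀ a : ℝ≥0∞, (a ^ (1/2 : ℝ)) ^ 2 = a := by
      intro a
      rw [← ENNReal.rpow_natCast, ← ENNReal.rpow_mul]; norm_num
    simp only [h5, hk1, one_mul]
  calc ∫⁻ x, ‖moll k u x‖ₑ ^ 2 ≤ ∫⁻ x, ∫⁻ t, ‖kern n k t‖ₑ * ‖u (x - t)‖ₑ ^ 2 :=
        lintegral_mono key
    _ = ∫⁻ t, ∫⁻ x, ‖kern n k t‖ₑ * ‖u (x - t)‖ₑ ^ 2 := by
        apply lintegral_lintegral_swap
        exact (hkm.comp measurable_snd).aemeasurable.mul (hu2.pow_const 2)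
    _ = ∫⁻ t, ‖kern n k t‖ₑ * ∫⁻ x, ‖u x‖ₑ ^ 2 := by
        refine lintegral_congr fun t => ?_
        rw [lintegral_const_mul' _ _ (by simp),
          lintegral_sub_right_eq_self (fun x => ‖u x‖ₑ ^ 2) t]
    _ = ∫⁻ x, ‖u x‖ₑ ^ 2 := by
        rw [lintegral_mul_const _ hkm, hk1, one_mul]

/-! ### Test functions of Sobolev regularity and the product rule -/

/-- Weak derivatives are defined with real test functions, while mollified complex functions are
complex valued; the real and imaginary parts are tested separately. -/
theorem HasWeakPartial.integral_complex_test {W : Set (EuclideanSpace ℝ (Fin n))} {i : Fin n}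
    {v g z : EuclideanSpace ℝ (Fin n) → ℂ} (h : HasWeakPartial W i v g)
    (hz : ContDiff ℝ (⊤ : ℕ∞) z) (hzc : HasCompactSupport z) (hzs : tsupport z ⊆ W) :
    ∫ x in W, fderiv ℝ z x (EuclideanSpace.single i 1) * v x = - ∫ x in W, z x * g x := by
  have hre : ContDiff ℝ (⊤ : ℕ∞) (fun x => (z x).re) := Complex.reCLM.contDiff.comp hz
  have him : ContDiff ℝ (⊤ : ℕ∞) (fun x => (z x).im) := Complex.imCLM.contDiff.comp hz
  have hcre : HasCompactSupport (fun x => (z x).re) := hzc.comp_left (g := Complex.re) rfl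
  have hcim : HasCompactSupport (fun x => (z x).im) := hzc.comp_left (g := Complex.im) rfl
  have hsre : tsupport (fun x => (z x).re) ⊆ W := by
    refine (closure_mono (t := support z) fun x hx h0 => ?_).trans hzs
    exact hx (by simp [h0])
  have hsim : tsupport (fun x => (z x).im) ⊆ W := by
    refine (closure_mono (t := support z) fun x hx h0 => ?_).trans hzs
    exact hx (by simp [h0])
  have dre : ∀ x, pderiv i (fun x => (z x).re) x
      = (fderiv ℝ z x (EuclideanSpace.single i 1)).re := by
    intro x
    have := (Complex.reCLM.hasFDerivAt.comp x
      (hz.differentiable (by simp) x).hasFDerivAt).fderiv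
    change fderiv ℝ (Complex.reCLM ∘ z) x _ = _
    rw [this]; rfl
  have dim : ∀ x, pderiv i (fun x => (z x).im) x
      = (fderiv ℝ z x (EuclideanSpace.single i 1)).im := by
    intro x
    have := (Complex.imCLM.hasFDerivAt.comp x
      (hz.differentiable (by simp) x).hasFDerivAt).fderiv
    change fderiv ℝ (Complex.imCLM ∘ z) x _ = _
    rw [this]; rfl
  have e1 := h.2.2 _ hre hcre hsre
  have e2 := h.2.2 _ him hcim hsim
  have i1 := (integrableOn_smul_of_tsupport_subset (pderiv_contDiff i hre).continuous
    (pderiv_hasCompactSupport i hcre) ((pderiv_tsupport_subset i _).trans hsre) h.1).integrableOn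
    (s := W)
  have i2 := (integrableOn_smul_of_tsupport_subset (pderiv_contDiff i him).continuous
    (pderiv_hasCompactSupport i hcim) ((pderiv_tsupport_subset i _).trans hsim) h.1).integrableOn
    (s := W)
  have i3 := (integrableOn_smul_of_tsupport_subset hre.continuous hcre hsre h.2.1).integrableOn
    (s := W)
  have i4 := (integrableOn_smul_of_tsupport_subset him.continuous hcim hsim h.2.1).integrableOn
    (s := W)
  have hsplit : ∀ a b : ℂ, a * b = a.re • b + Complex.I * (a.im • b) := by
    intro a b
    apply Complex.ext <;> simp
    ring
  simp only [hsplit _ (v _), hsplit _ (g _), ← dre, ← dim]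
  rw [integral_add i1 (i2.const_mul _), integral_add i3 (i4.const_mul _), integral_const_mul,
    integral_const_mul, e1, e2]
  ring

/-- A bounded, compactly supported function with bounded weak derivative is an admissible
test function. -/
theorem HasWeakPartial.integral_lipschitz_test {W K : Set (EuclideanSpace ℝ (Fin n))} {i : Fin n}
    (hW : IsOpen W) (hK : IsCompact K) (hKW : K ⊆ W)
    {v g ζ ζ' : EuclideanSpace ℝ (Fin n) → ℂ} (h : HasWeakPartial W i v g)
    (hζ : HasWeakPartial univ i ζ ζ') {M : ℝ} (hM : ∀ᵐ x, ‖ζ x‖ ≤ M) (hM' : ∀ᵐ x, ‖ζ' x‖ ≤ M)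
    (hζ0 : ∀ x ∉ K, ζ x = 0) :
    IntegrableOn (fun x => ζ' x * v x) W ∧ IntegrableOn (fun x => ζ x * g x) W ∧
    ∫ x in W, ζ' x * v x = - ∫ x in W, ζ x * g x := by
  have hlζ : LocallyIntegrable ζ := locallyIntegrableOn_univ.1 hζ.1
  have hlζ' : LocallyIntegrable ζ' := locallyIntegrableOn_univ.1 hζ.2.1
  obtain ⟨δ, hδ, hδW⟩ := hK.exists_cthickening_subset_open hW hKW
  set K' := Metric.cthickening δ K with hK'
  have hK'c : IsCompact K' := hK.cthickening
  have hev : ∀ᶠ k : ℕ in atTop, tsupport (moll k ζ) ⊆ K' := by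
    have : ∀ᶠ k : ℕ in atTop, (1 / (k + 1) : ℝ) < δ :=
      tendsto_one_div_add_atTop_nhds_zero_nat.eventually_lt_const hδ
    filter_upwards [this] with k hk
    exact (support_moll_subset k hζ0).trans (Metric.cthickening_mono hk.le K)
  have hfd : ∀ k x, fderiv ℝ (moll k ζ) x (EuclideanSpace.single i 1) = moll k ζ' x :=
    fun k x => fderiv_moll hlζ hζ k (subset_univ _)
  have hv0 : ∀ᶠ k : ℕ in atTop, ∀ x ∉ K', moll k ζ x = 0 := by
    filter_upwards [hev] with k hk x hx
    exact image_eq_zero_of_notMem_tsupport fun h => hx (hk h)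
  -- Nothing is assumed on the support of `ζ'`. Its mollification is a derivative of `moll k ζ` and
  -- inherits the support of that function.
  have hv1 : ∀ᶠ k : ℕ in atTop, ∀ x ∉ K', moll k ζ' x = 0 := by
    filter_upwards [hev] with k hk x hx
    rw [← hfd]
    have : x ∉ tsupport (fderiv ℝ (moll k ζ)) := fun h => hx (hk (tsupport_fderiv_subset ℝ h))
    rw [image_eq_zero_of_notMem_tsupport this]
    rfl
  -- Both sides of the identity pass to the limit by dominated convergence, with majorant `M ‖f‖` on
  -- the compact set `K'`.
  have main : ∀ {θ f : EuclideanSpace ℝ (Fin n) → ℂ}, LocallyIntegrable θ →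
      LocallyIntegrableOn f W volume → (∀ᵐ x, ‖θ x‖ ≤ M) →
      (∀ᶠ k : ℕ in atTop, ∀ x ∉ K', moll k θ x = 0) →
      IntegrableOn (fun x => θ x * f x) W ∧
      Tendsto (fun k => ∫ x in W, moll k θ x * f x) atTop (𝓝 (∫ x in W, θ x * f x)) := by
    intro θ f hθ hf hθM hθ0
    have hfK : IntegrableOn f K' := hf.integrableOn_compact_subset hδW hK'c
    have hfm : AEStronglyMeasurable f (volume.restrict W) := hf.aestronglyMeasurable
    have hb : Integrable (K'.indicator fun x => M * ‖f x‖) :=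
      (integrable_indicator_iff hK'c.measurableSet).2 (hfK.norm.const_mul M)
    have hbound : ∀ᶠ k : ℕ in atTop, ∀ᵐ x ∂volume.restrict W,
        ‖moll k θ x * f x‖ ≤ K'.indicator (fun x => M * ‖f x‖) x := by
      filter_upwards [hθ0] with k hk
      refine Eventually.of_forall fun x => ?_
      by_cases hx : x ∈ K'
      · rw [indicator_of_mem hx, norm_mul]
        exact mul_le_mul_of_nonneg_right (norm_moll_le k hθM x) (norm_nonneg _)
      · simp [indicator_of_notMem hx, hk x hx]
    have hlim : ∀ᵐ x ∂volume.restrict W,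
        Tendsto (fun k => moll k θ x * f x) atTop (𝓝 (θ x * f x)) := by
      filter_upwards [ae_restrict_of_ae (moll_tendsto hθ)] with x hx
      exact hx.mul_const _
    refine ⟨?_, tendsto_integral_filter_of_dominated_convergence _ ?_ hbound hb.integrableOn hlim⟩
    · refine Integrable.mono' (g := K'.indicator fun x => M * ‖f x‖) hb.integrableOn
        (hθ.aestronglyMeasurable.restrict.mul hfm) ?_
      filter_upwards [hlim] with x hx
      refine le_of_tendsto hx.norm ?_
      filter_upwards [hθ0] with k hk
      by_cases hxK : x ∈ K'
      · rw [indicator_of_mem hxK, norm_mul]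
        exact mul_le_mul_of_nonneg_right (norm_moll_le k hθM x) (norm_nonneg _)
      · simp [indicator_of_notMem hxK, hk x hxK]
    · exact Eventually.of_forall fun k =>
        (moll_contDiff k hθ).continuous.aestronglyMeasurable.mul hfm
  obtain ⟨I1, T1⟩ := main hlζ' h.1 hM' hv1
  obtain ⟨I2, T2⟩ := main hlζ h.2.1 hM hv0
  refine ⟨I1, I2, tendsto_nhds_unique (T1.congr' ?_) T2.neg⟩
  filter_upwards [hev] with k hk
  simp only [← hfd]
  exact h.integral_complex_test (moll_contDiff k hlζ)
    (hK'c.of_isClosed_subset (isClosed_tsupport _) hk) (hk.trans hδW)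

theorem LocallyIntegrableOn.of_cover {U V V' : Set (EuclideanSpace ℝ (Fin n))}
    {f : EuclideanSpace ℝ (Fin n) → ℂ} (hV : IsOpen V) (hV' : IsOpen V') (hU : U ⊆ V ∪ V')
    (h : LocallyIntegrableOn f V volume) (h' : LocallyIntegrableOn f V' volume) :
    LocallyIntegrableOn f U volume := by
  intro x hx
  rcases hU hx with hx | hx
  · have := h x hx
    rw [hV.nhdsWithin_eq hx] at this
    exact this.filter_mono nhdsWithin_le_nhds
  · have := h' x hx
    rw [hV'.nhdsWithin_eq hx] at this
    exact this.filter_mono nhdsWithin_le_nhds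

theorem LocallyIntegrableOn.bdd_mul {V : Set (EuclideanSpace ℝ (Fin n))}
    {a f : EuclideanSpace ℝ (Fin n) → ℂ} (hV : IsOpen V) {M : ℝ}
    (ha : LocallyIntegrableOn a V volume) (hM : ∀ᵐ x ∂volume.restrict V, ‖a x‖ ≤ M)
    (h : LocallyIntegrableOn f V volume) :
    LocallyIntegrableOn (fun x => a x * f x) V volume := by
  rw [locallyIntegrableOn_iff hV.isLocallyClosed] at ha h ⊢
  intro k hk hk'
  exact (h k hk hk').bdd_mul (c := M) (ha k hk hk').aestronglyMeasurable
    (ae_restrict_of_ae_restrict_of_subset hk hM)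

theorem hasWeakPartial_zero (U : Set (EuclideanSpace ℝ (Fin n))) (i : Fin n) :
    HasWeakPartial U i (fun _ => 0) (fun _ => 0) := by
  simpa using hasWeakPartial_of_contDiff U i (u := fun _ => (0 : ℂ)) contDiff_const

theorem HasWeakPartial.ae_eq_zero {U : Set (EuclideanSpace ℝ (Fin n))} {i : Fin n}
    {a a' : EuclideanSpace ℝ (Fin n) → ℂ} (ha : HasWeakPartial U i a a')
    {V : Set (EuclideanSpace ℝ (Fin n))} (hV : IsOpen V) (hVU : V ⊆ U)
    (h0 : ∀ᵐ x ∂volume.restrict V, a x = 0) : ∀ᵐ x ∂volume.restrict V, a' x = 0 :=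
  (ha.mono hVU).unique hV ((hasWeakPartial_zero V i).congr hV (EventuallyEq.symm h0)
    EventuallyEq.rfl)

/-- The product rule, for a factor `a` on `U` with bounded weak derivative whose support relative
to `U` lies in `V`, and a factor `b` which is weakly differentiable on `V` only. -/
theorem HasWeakPartial.mul {U V : Set (EuclideanSpace ℝ (Fin n))} (hU : IsOpen U)
    (hV : IsOpen V) (hVU : V ⊆ U) {i : Fin n} {a a' b b' : EuclideanSpace ℝ (Fin n) → ℂ}
    (ha : HasWeakPartial U i a a') {M : ℝ} (hM : ∀ᵐ x ∂volume.restrict U, ‖a x‖ ≤ M)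
    (hM' : ∀ᵐ x ∂volume.restrict U, ‖a' x‖ ≤ M)
    (hs : U ∩ closure (U ∩ support a) ⊆ V) (hb : HasWeakPartial V i b b') :
    HasWeakPartial U i (fun x => a x * b x)
      (V.indicator fun x => a' x * b x + a x * b' x) := by
  -- `U` is covered by the open sets `V` and `U \ F`. On the second, `a` vanishes and hence so does
  -- `a'` almost everywhere, so the behaviour of `b` outside `V` is irrelevant.
  set F := closure (U ∩ support a) with hF
  have hFc : IsClosed F := isClosed_closure
  have hUF : IsOpen (U \ F) := hU.sdiff hFc
  have hcov : U ⊆ V ∪ (U \ F) := fun x hx => by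
    by_cases hxF : x ∈ F
    · exact Or.inl (hs ⟨hx, hxF⟩)
    · exact Or.inr ⟨hx, hxF⟩
  have ha0 : ∀ x ∈ U \ F, a x = 0 := by
    intro x hx
    by_contra h
    exact hx.2 (subset_closure ⟨hx.1, h⟩)
  have ha0' : ∀ᵐ x ∂volume.restrict (U \ F), a x = 0 :=
    (ae_restrict_mem hUF.measurableSet).mono ha0
  have ha1' : ∀ᵐ x ∂volume.restrict (U \ F), a' x = 0 := ha.ae_eq_zero hUF sdiff_subset ha0'
  have hMV := ae_restrict_of_ae_restrict_of_subset hVU hM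
  have hMV' := ae_restrict_of_ae_restrict_of_subset hVU hM'
  have haV := ha.mono hVU
  have hlzero : LocallyIntegrableOn (fun _ : EuclideanSpace ℝ (Fin n) => (0 : ℂ)) (U \ F) volume :=
    (locallyIntegrable_const 0).locallyIntegrableOn _
  have L1 : LocallyIntegrableOn (fun x => a x * b x) U volume := by
    refine LocallyIntegrableOn.of_cover hV hUF hcov
      (LocallyIntegrableOn.bdd_mul hV haV.1 hMV hb.1) ?_
    refine LocallyIntegrableOn.congr_ae hUF hlzero ?_
    filter_upwards [ha0'] with x hx
    simp [hx]
  have L2 : LocallyIntegrableOn (V.indicator fun x => a' x * b x + a x * b' x) U volume := by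
    refine LocallyIntegrableOn.of_cover hV hUF hcov ?_ ?_
    · refine LocallyIntegrableOn.congr_ae hV
        ((LocallyIntegrableOn.bdd_mul hV haV.2.1 hMV' hb.1).add
          (LocallyIntegrableOn.bdd_mul hV haV.1 hMV hb.2.1)) ?_
      filter_upwards [ae_restrict_mem hV.measurableSet] with x hx
      rw [indicator_of_mem hx]
      rfl
    · refine LocallyIntegrableOn.congr_ae hUF hlzero ?_
      filter_upwards [ha0', ha1'] with x hx hx'
      simp [indicator, hx, hx']
  refine ⟨L1, L2, fun ψ h1 h2 h3 => ?_⟩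
  have hp := pderiv_contDiff i h1
  have hpc := pderiv_hasCompactSupport i h2
  have hps := (pderiv_tsupport_subset i ψ).trans h3
  set K := tsupport ψ ∩ F
  have hK : IsCompact K := h2.inter_right hFc
  have hKV : K ⊆ V := fun x hx => hs ⟨h3 hx.1, hx.2⟩
  obtain ⟨B, hB⟩ := h2.exists_bound_of_continuous h1.continuous
  obtain ⟨B', hB'⟩ := hpc.exists_bound_of_continuous hp.continuous
  -- The product `ψ a` vanishes outside a compact subset of `V` and has a bounded weak derivative,
  -- so it may be used as a test function for `b` on `V`.
  set ζ : EuclideanSpace ℝ (Fin n) → ℂ := fun x => ψ x • a x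
  set ζ' : EuclideanSpace ℝ (Fin n) → ℂ := fun x => pderiv i ψ x • a x + ψ x • a' x
  have hz : ∀ x, x ∉ U → ψ x = 0 ∧ pderiv i ψ x = 0 := fun x hx =>
    ⟨image_eq_zero_of_notMem_tsupport fun h => hx (h3 h),
      image_eq_zero_of_notMem_tsupport fun h => hx (hps h)⟩
  have I1 := integrableOn_smul_of_tsupport_subset h1.continuous h2 h3 ha.1
  have I2 := integrableOn_smul_of_tsupport_subset hp.continuous hpc hps ha.1
  have I3 := integrableOn_smul_of_tsupport_subset h1.continuous h2 h3 ha.2.1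
  -- The Leibniz rule with one smooth factor: `a` is tested against `ψ χ`.
  have hζ : HasWeakPartial univ i ζ ζ' := by
    refine ⟨I1.locallyIntegrable.locallyIntegrableOn _,
      (I2.add I3).locallyIntegrable.locallyIntegrableOn _, fun χ c1 c2 _ => ?_⟩
    have hm : ContDiff ℝ (⊤ : ℕ∞) (fun x => ψ x * χ x) := h1.mul c1
    have hmc : HasCompactSupport (fun x => ψ x * χ x) := h2.mul_right
    have hmt : tsupport (fun x => ψ x * χ x) ⊆ U := (tsupport_mul_subset_left).trans h3
    have := ha.2.2 _ hm hmc hmt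
    rw [setIntegral_eq_of_tsupport_subset hmt,
      setIntegral_eq_of_tsupport_subset ((pderiv_tsupport_subset i _).trans hmt)] at this
    simp only [pderiv_mul i h1 c1, add_smul] at this
    have J : ∀ {θ : EuclideanSpace ℝ (Fin n) → ℝ} {f : EuclideanSpace ℝ (Fin n) → ℂ},
        ContDiff ℝ (⊤ : ℕ∞) θ → HasCompactSupport θ → Integrable f →
        Integrable (fun x => θ x • f x) := fun hθ hθc hf =>
      integrableOn_smul_of_tsupport_subset hθ.continuous hθc (subset_univ _)
        (hf.locallyIntegrable.locallyIntegrableOn _)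
    have J1 : Integrable (fun x => (pderiv i ψ x * χ x) • a x) :=
      (J c1 c2 I2).congr (ae_of_all _ fun x => by simp only [smul_smul, mul_comm])
    have J2 : Integrable (fun x => (ψ x * pderiv i χ x) • a x) :=
      (J (pderiv_contDiff i c1) (pderiv_hasCompactSupport i c2) I1).congr
        (ae_of_all _ fun x => by simp only [smul_smul, mul_comm])
    rw [integral_add J1 J2] at this
    simp only [Measure.restrict_univ, ζ, ζ', smul_add]
    rw [integral_add (J c1 c2 I2) (J c1 c2 I3)]
    simp only [smul_smul]
    simp only [mul_comm (χ _), mul_comm (pderiv i χ _)]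
    rw [eq_comm, neg_add, ← this]
    ring
  have hbd : ∀ᵐ x, ‖ζ x‖ ≤ |B| * |M| + |B'| * |M| := by
    rw [ae_restrict_iff' hU.measurableSet] at hM
    filter_upwards [hM] with x hx
    by_cases hxU : x ∈ U
    · simp only [ζ, norm_smul]
      have := mul_le_mul ((hB x).trans (le_abs_self B)) ((hx hxU).trans (le_abs_self M))
        (norm_nonneg _) (abs_nonneg _)
      have : 0 ≤ |B'| * |M| := by positivity
      linarith
    · simp only [ζ, (hz x hxU).1, zero_smul, norm_zero]
      positivity
  have hbd' : ∀ᵐ x, ‖ζ' x‖ ≤ |B| * |M| + |B'| * |M| := by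
    rw [ae_restrict_iff' hU.measurableSet] at hM hM'
    filter_upwards [hM, hM'] with x hx hx'
    by_cases hxU : x ∈ U
    · refine (norm_add_le _ _).trans ?_
      rw [norm_smul, norm_smul]
      have := mul_le_mul ((hB x).trans (le_abs_self B)) ((hx' hxU).trans (le_abs_self M))
        (norm_nonneg _) (abs_nonneg _)
      have := mul_le_mul ((hB' x).trans (le_abs_self B')) ((hx hxU).trans (le_abs_self M))
        (norm_nonneg _) (abs_nonneg _)
      linarith
    · simp only [ζ', (hz x hxU).1, (hz x hxU).2, zero_smul, add_zero, norm_zero]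
      positivity
  have hζ0 : ∀ x ∉ K, ζ x = 0 := by
    intro x hx
    by_cases hxt : x ∈ tsupport ψ
    · have : a x = 0 := ha0 x ⟨h3 hxt, fun hf => hx ⟨hxt, hf⟩⟩
      simp [ζ, this]
    · simp [ζ, image_eq_zero_of_notMem_tsupport hxt]
  obtain ⟨A1, A2, A3⟩ := hb.integral_lipschitz_test hV hK hKV hζ hbd hbd' hζ0
  have A4 : IntegrableOn (fun x => pderiv i ψ x • (a x * b x)) V :=
    (integrableOn_smul_of_tsupport_subset hp.continuous hpc hps L1).integrableOn
  have e1 : ∫ x in U, pderiv i ψ x • (a x * b x) = ∫ x in V, pderiv i ψ x • (a x * b x) := by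
    apply setIntegral_eq_of_subset_of_forall_sdiff_eq_zero hU.measurableSet hVU
    intro x hx
    rw [ha0 x ⟨hx.1, fun hf => hx.2 (hs ⟨hx.1, hf⟩)⟩]
    simp
  -- On `V` the difference `ζ' b - (∂_i ψ) a b` is `ψ a' b`. This form lets the identity for the
  -- test function `ζ` be inserted.
  have e2 : ∫ x in U, ψ x • (V.indicator (fun x => a' x * b x + a x * b' x)) x
      = ∫ x in V, ((ζ' x * b x - pderiv i ψ x • (a x * b x)) + ζ x * b' x) := by
    rw [setIntegral_eq_of_subset_of_forall_sdiff_eq_zero hU.measurableSet hVU]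
    · refine setIntegral_congr_fun hV.measurableSet fun x hx => ?_
      simp only [indicator_of_mem hx, ζ, ζ', Complex.real_smul]
      ring
    · intro x hx
      simp [indicator_of_notMem hx.2]
  rw [e1, e2, integral_add (f := fun x => ζ' x * b x - pderiv i ψ x • (a x * b x)) (A1.sub A4) A2,
    integral_sub A1 A4, A3]
  ring

/-! ### The Poincaré inequality on balls -/

theorem lintegral_sq_le {α : Type*} [MeasurableSpace α] (μ : Measure α) {g : α → ℝ≥0∞}
    (hg : AEMeasurable g μ) : (∫⁻ x, g x ∂μ) ^ 2 ≤ μ univ * ∫⁻ x, g x ^ 2 ∂μ := by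
  have h := ENNReal.lintegral_mul_le_Lp_mul_Lq μ Real.HolderConjugate.two_two
    (f := fun _ => 1) (g := g) aemeasurable_const hg
  have h5 : ∀ a : ℝ≥0∞, (a ^ (1/2 : ℝ)) ^ 2 = a := by
    intro a
    rw [← ENNReal.rpow_natCast, ← ENNReal.rpow_mul]; norm_num
  have h3 := pow_le_pow_left' h 2
  simpa [mul_pow, h5, -one_div] using h3

theorem norm_clm_apply_sq_le (L : EuclideanSpace ℝ (Fin n) →L[ℝ] ℂ)
    (v : EuclideanSpace ℝ (Fin n)) :
    ‖L v‖ₑ ^ 2 ≤ ‖v‖ₑ ^ 2 * ∑ i, ‖L (EuclideanSpace.single i 1)‖ₑ ^ 2 := by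
  have hv : L v = ∑ i, v i • L (EuclideanSpace.single i 1) := by
    conv_lhs => rw [← (EuclideanSpace.basisFun (Fin n) ℝ).sum_repr v]
    simp
  have h1 : ‖L v‖ ≤ ∑ i, ‖v i‖ * ‖L (EuclideanSpace.single i 1)‖ := by
    rw [hv]
    refine (norm_sum_le _ _).trans (le_of_eq ?_)
    simp_rw [norm_smul]
  have h2 : ‖L v‖ ^ 2 ≤ ‖v‖ ^ 2 * ∑ i, ‖L (EuclideanSpace.single i 1)‖ ^ 2 := by
    rw [EuclideanSpace.norm_sq_eq]
    exact (pow_le_pow_left₀ (norm_nonneg _) h1 2).trans (Finset.sum_mul_sq_le_sq_mul_sq _ _ _)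
  have h3 := ENNReal.ofReal_le_ofReal h2
  rw [ENNReal.ofReal_mul (by positivity), ENNReal.ofReal_sum_of_nonneg (by intros; positivity)] at h3
  simpa only [ENNReal.ofReal_pow (norm_nonneg _), ofReal_norm] using h3

theorem lintegral_comp_add_smul_le {H : EuclideanSpace ℝ (Fin n) → ℝ≥0∞} (hH : Measurable H)
    (z : EuclideanSpace ℝ (Fin n)) {s : ℝ} (hs : 1 / 2 ≤ s) :
    ∫⁻ y, H (z + s • y) ≤ 2 ^ n * ∫⁻ y, H y := by
  have hs0 : 0 < s := by linarith
  have h1 : ∫⁻ y, H (z + s • y) = ∫⁻ y, H (z + y) ∂(volume.map (s • ·)) :=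
    (lintegral_map (hH.comp (measurable_const_add z)) (measurable_const_smul s)).symm
  rw [h1, Measure.map_addHaar_smul _ hs0.ne', lintegral_smul_measure,
    lintegral_add_left_eq_self H z, smul_eq_mul]
  refine mul_le_mul_left ?_ _
  rw [finrank_euclideanSpace_fin, abs_of_nonneg (by positivity)]
  calc ENNReal.ofReal (s ^ n)⁻¹ ≤ ENNReal.ofReal (2 ^ n) := by
        apply ENNReal.ofReal_le_ofReal
        rw [← inv_pow]
        apply pow_le_pow_left₀ (by positivity)
        rw [inv_le_comm₀ hs0 (by norm_num)]
        linarith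
    _ = 2 ^ n := by rw [ENNReal.ofReal_pow (by norm_num)]; norm_num

/-- The squared Euclidean norm of the gradient. -/
noncomputable def gradSq (f : EuclideanSpace ℝ (Fin n) → ℂ) (z : EuclideanSpace ℝ (Fin n)) :
    ℝ≥0∞ :=
  ∑ i, ‖fderiv ℝ f z (EuclideanSpace.single i 1)‖ₑ ^ 2

theorem continuous_gradSq {f : EuclideanSpace ℝ (Fin n) → ℂ} (hf : ContDiff ℝ 1 f) :
    Continuous (gradSq f) := by
  refine continuous_finsetSum _ fun i _ => ?_
  exact (ENNReal.continuous_pow 2).comp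
    ((hf.continuous_fderiv (by simp)).clm_apply continuous_const).enorm

theorem enorm_sub_sq_le {f : EuclideanSpace ℝ (Fin n) → ℂ} (hf : ContDiff ℝ 1 f)
    (x y : EuclideanSpace ℝ (Fin n)) :
    ‖f x - f y‖ₑ ^ 2 ≤ ‖x - y‖ₑ ^ 2 * ∫⁻ t in Ioc (0:ℝ) 1, gradSq f (y + t • (x - y)) := by
  have hline : Continuous fun t : ℝ => y + t • (x - y) := by fun_prop
  have hc : Continuous fun t : ℝ => fderiv ℝ f (y + t • (x - y)) (x - y) :=
    ((hf.continuous_fderiv (by simp)).comp hline).clm_apply continuous_const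
  have hd : ∀ t : ℝ, HasDerivAt (fun t : ℝ => f (y + t • (x - y)))
      (fderiv ℝ f (y + t • (x - y)) (x - y)) t := by
    intro t
    have h1 : HasDerivAt (fun t : ℝ => y + t • (x - y)) (x - y) t := by
      simpa using ((hasDerivAt_id t).smul_const (x - y)).const_add y
    exact (hf.differentiable (by simp) _).hasFDerivAt.comp_hasDerivAt t h1
  have h := intervalIntegral.integral_eq_sub_of_hasDerivAt (fun t _ => hd t)
    (hc.intervalIntegrable 0 1)
  rw [intervalIntegral.integral_of_le zero_le_one] at h
  simp only [one_smul, zero_smul, add_zero, add_sub_cancel] at h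
  rw [← h]
  calc _ ≤ (∫⁻ t in Ioc (0:ℝ) 1, ‖fderiv ℝ f (y + t • (x - y)) (x - y)‖ₑ) ^ 2 :=
        pow_le_pow_left' (enorm_integral_le_lintegral_enorm _) 2
    _ ≤ _ := lintegral_sq_le _ hc.enorm.measurable.aemeasurable
    _ = ∫⁻ t in Ioc (0:ℝ) 1, ‖fderiv ℝ f (y + t • (x - y)) (x - y)‖ₑ ^ 2 := by simp
    _ ≤ ∫⁻ t in Ioc (0:ℝ) 1, ‖x - y‖ₑ ^ 2 * gradSq f (y + t • (x - y)) :=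
        lintegral_mono fun t => norm_clm_apply_sq_le _ _
    _ = _ := lintegral_const_mul _
        ((continuous_gradSq hf).comp hline).measurable

/-- For fixed `x` the contraction `y ↦ (1 - s) x + s y` maps the convex set `B` into itself and
scales volume by `s ^ n ≥ 2 ^ (-n)`. -/
theorem setLIntegral_segment_le {D : EuclideanSpace ℝ (Fin n) → ℝ≥0∞} (hD : Measurable D)
    {B : Set (EuclideanSpace ℝ (Fin n))} (hB : Convex ℝ B) (hBm : MeasurableSet B)
    {x : EuclideanSpace ℝ (Fin n)} (hx : x ∈ B) {s : ℝ} (hs : 1 / 2 ≤ s) (hs1 : s ≤ 1) :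
    ∫⁻ y in B, D ((1 - s) • x + s • y) ≤ 2 ^ n * ∫⁻ z in B, D z := by
  rw [← lintegral_indicator hBm, ← lintegral_indicator hBm]
  refine le_trans (lintegral_mono fun y => ?_)
    (lintegral_comp_add_smul_le (hD.indicator hBm) ((1 - s) • x) hs)
  by_cases hy : y ∈ B
  · rw [indicator_of_mem hy, indicator_of_mem (hB hx hy (by linarith) (by linarith) (by ring))]
  · simp [indicator_of_notMem hy]

theorem lintegral_lintegral_enorm_sub_sq_le {f : EuclideanSpace ℝ (Fin n) → ℂ}
    (hf : ContDiff ℝ 1 f) {B : Set (EuclideanSpace ℝ (Fin n))} (hB : Convex ℝ B)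
    (hBm : MeasurableSet B) {d : ℝ} (hd : ∀ x ∈ B, ∀ y ∈ B, ‖x - y‖ ≤ d) :
    ∫⁻ x in B, ∫⁻ y in B, ‖f x - f y‖ₑ ^ 2 ≤
      ENNReal.ofReal (d ^ 2) * (2 ^ n * (∫⁻ z in B, gradSq f z) * volume B) := by
  set D := gradSq f
  have hDc : Continuous D := continuous_gradSq hf
  have hDm : Measurable D := hDc.measurable
  have hpt : ∀ x ∈ B, ∀ y ∈ B, ‖f x - f y‖ₑ ^ 2
      ≤ ENNReal.ofReal (d ^ 2) * ∫⁻ t in Ioc (0:ℝ) 1, D (y + t • (x - y)) := by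
    intro x hx y hy
    refine (enorm_sub_sq_le hf x y).trans (mul_le_mul_left ?_ _)
    rw [← ofReal_norm, ← ENNReal.ofReal_pow (norm_nonneg _)]
    exact ENNReal.ofReal_le_ofReal (pow_le_pow_left₀ (norm_nonneg _) (hd x hx y hy) 2)
  have hJ : ∀ t ∈ Ioc (0:ℝ) 1, ∫⁻ x in B, ∫⁻ y in B, D (y + t • (x - y))
      ≤ 2 ^ n * (∫⁻ z in B, D z) * volume B := by
    intro t ht
    -- The point `y + t (x - y)` gives weight at least one half to either `y` or `x`. Integrating
    -- first in that variable keeps the Jacobian factor below `2 ^ n` for every `t`.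
    rcases le_total t (1 / 2) with h | h
    · calc _ ≤ ∫⁻ x in B, 2 ^ n * ∫⁻ z in B, D z := by
            refine setLIntegral_mono measurable_const fun x hx => ?_
            refine le_trans (le_of_eq (lintegral_congr fun y => ?_))
              (setLIntegral_segment_le hDm hB hBm hx (s := 1 - t) (by linarith)
                (by linarith [ht.1]))
            congr 1
            module
        _ = _ := by rw [setLIntegral_const]
    · rw [lintegral_lintegral_swap]
      · calc _ ≤ ∫⁻ x in B, 2 ^ n * ∫⁻ z in B, D z := by
              refine setLIntegral_mono measurable_const fun x hx => ?_
              refine le_trans (le_of_eq (lintegral_congr fun y => ?_))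
                (setLIntegral_segment_le hDm hB hBm hx (s := t) h ht.2)
              congr 1
              module
          _ = _ := by rw [setLIntegral_const]
      · have : Continuous fun p : EuclideanSpace ℝ (Fin n) × EuclideanSpace ℝ (Fin n) =>
            D (p.2 + t • (p.1 - p.2)) := hDc.comp (by fun_prop)
        exact this.measurable.aemeasurable
  calc ∫⁻ x in B, ∫⁻ y in B, ‖f x - f y‖ₑ ^ 2
      ≤ ∫⁻ x in B, ∫⁻ y in B, ENNReal.ofReal (d ^ 2) *
          ∫⁻ t in Ioc (0:ℝ) 1, D (y + t • (x - y)) := by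
        refine setLIntegral_mono' hBm fun x hx => setLIntegral_mono' hBm fun y hy => hpt x hx y hy
    _ = ENNReal.ofReal (d ^ 2) *
          ∫⁻ x in B, ∫⁻ y in B, ∫⁻ t in Ioc (0:ℝ) 1, D (y + t • (x - y)) := by
        rw [← lintegral_const_mul' _ _ ENNReal.ofReal_ne_top]
        refine lintegral_congr fun x => ?_
        rw [lintegral_const_mul' _ _ ENNReal.ofReal_ne_top]
    _ = ENNReal.ofReal (d ^ 2) *
          ∫⁻ t in Ioc (0:ℝ) 1, ∫⁻ x in B, ∫⁻ y in B, D (y + t • (x - y)) := by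
        congr 1
        trans ∫⁻ x in B, ∫⁻ t in Ioc (0:ℝ) 1, ∫⁻ y in B, D (y + t • (x - y))
        · refine lintegral_congr fun x => ?_
          rw [lintegral_lintegral_swap]
          have : Continuous fun p : EuclideanSpace ℝ (Fin n) × ℝ =>
            D (p.1 + p.2 • (x - p.1)) := hDc.comp (by fun_prop)
          exact this.measurable.aemeasurable
        · rw [lintegral_lintegral_swap]
          have : Continuous fun p : (EuclideanSpace ℝ (Fin n) × ℝ) × EuclideanSpace ℝ (Fin n) =>
            D (p.2 + p.1.2 • (p.1.1 - p.2)) := hDc.comp (by fun_prop)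
          exact (this.measurable.lintegral_prod_right').aemeasurable
    _ ≤ ENNReal.ofReal (d ^ 2) *
          ∫⁻ t in Ioc (0:ℝ) 1, 2 ^ n * (∫⁻ z in B, D z) * volume B := by
        refine mul_le_mul_right (setLIntegral_mono' measurableSet_Ioc hJ) _
    _ = _ := by simp

/-- The double integral of `|u(x) - u(y)|²` over the ball is bounded by integrating the gradient
along segments. The constant is then a value `u(y)` at a well-chosen point, rather than the mean of
`u`. -/
theorem poincare_ball {c : EuclideanSpace ℝ (Fin n)} {r : ℝ} (hr : 0 < r)
    {u : EuclideanSpace ℝ (Fin n) → ℂ} {g : Fin n → EuclideanSpace ℝ (Fin n) → ℂ}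
    (hu : IntegrableOn u (Metric.ball c r)) (hg : ∀ i, IntegrableOn (g i) (Metric.ball c r))
    (h : ∀ i, HasWeakPartial (Metric.ball c r) i u (g i)) :
    ∃ a : ℂ, ∫⁻ x in Metric.ball c r, ‖u x - a‖ₑ ^ 2 ≤
      ENNReal.ofReal ((2 * r) ^ 2) *
        (2 ^ n * ∑ i, ∫⁻ x in Metric.ball c r, ‖g i x‖ₑ ^ 2) := by
  set B := Metric.ball c r with hBdef
  have hBm : MeasurableSet B := measurableSet_ball
  set U := B.indicator u with hU
  set G := fun i => B.indicator (g i) with hG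
  have hUi : Integrable U := (integrable_indicator_iff hBm).2 hu
  have hGi : ∀ i, Integrable (G i) := fun i => (integrable_indicator_iff hBm).2 (hg i)
  have hUG : ∀ i, HasWeakPartial B i U (G i) := fun i =>
    (h i).congr Metric.isOpen_ball
      (by filter_upwards [ae_restrict_mem hBm] with x hx; rw [hU, indicator_of_mem hx])
      (by filter_upwards [ae_restrict_mem hBm] with x hx
          simp only [hG]; rw [indicator_of_mem hx])
  -- On the smaller ball the mollification at scale `1 / (k + 1)` sees only points of `B`, so its
  -- gradient is the mollified weak gradient.
  set Bk : ℕ → Set (EuclideanSpace ℝ (Fin n)) := fun k => Metric.ball c (r - 1 / (k + 1))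
  have hBk : ∀ k, Bk k ⊆ B := fun k => Metric.ball_subset_ball (by
    have : (0:ℝ) < 1 / (k + 1) := by positivity
    linarith)
  have hBkm : ∀ k, MeasurableSet (Bk k) := fun k => measurableSet_ball
  have hgrad : ∀ k, ∀ x ∈ Bk k, gradSq (moll k U) x = ∑ i, ‖moll k (G i) x‖ₑ ^ 2 := by
    intro k x hx
    refine Finset.sum_congr rfl fun i _ => ?_
    rw [fderiv_moll hUi.locallyIntegrable (hUG i) k]
    refine Metric.closedBall_subset_ball' ?_
    have : dist x c < r - 1 / (k + 1) := hx
    linarith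
  set S := ∑ i, ∫⁻ x in B, ‖g i x‖ₑ ^ 2 with hS
  set Q := ENNReal.ofReal ((2 * r) ^ 2) * (2 ^ n * S) with hQ
  have hk : ∀ k, ∫⁻ x in Bk k, ∫⁻ y in Bk k, ‖moll k U x - moll k U y‖ₑ ^ 2
      ≤ Q * volume B := by
    intro k
    refine (lintegral_lintegral_enorm_sub_sq_le (d := 2 * r)
      ((moll_contDiff k hUi.locallyIntegrable).of_le (by simp))
      (convex_ball _ _) (hBkm k) ?_).trans ?_
    · intro x hx y hy
      have h1 : dist x c < r := hBk k hx
      have h2 : dist y c < r := hBk k hy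
      rw [← dist_eq_norm]
      linarith [dist_triangle_right x y c]
    · rw [hQ, mul_assoc (ENNReal.ofReal ((2 * r) ^ 2)) (2 ^ n * S)]
      refine mul_le_mul_right (mul_le_mul' (mul_le_mul_right ?_ _) (measure_mono (hBk k))) _
      rw [setLIntegral_congr_fun (hBkm k) (hgrad k), lintegral_finsetSum']
      · refine Finset.sum_le_sum fun i _ => ?_
        refine (setLIntegral_le_lintegral _ _).trans
          ((lintegral_moll_sq_le k (hGi i).aestronglyMeasurable).trans (le_of_eq ?_))
        rw [← lintegral_indicator hBm]
        refine lintegral_congr fun x => ?_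
        by_cases hx : x ∈ B <;> simp [hG, hx]
      · intro i _
        exact ((moll_contDiff k (hGi i).locallyIntegrable).continuous.enorm.measurable.pow_const
          2).aemeasurable
  have hlim : ∀ᵐ x ∂volume.restrict B, Tendsto (fun k => moll k U x) atTop (𝓝 (u x)) := by
    filter_upwards [ae_restrict_of_ae (moll_tendsto hUi.locallyIntegrable),
      ae_restrict_mem hBm] with x hx hxB
    simpa [hU, indicator_of_mem hxB] using hx
  have hmem : ∀ x ∈ B, ∀ᶠ k in atTop, x ∈ Bk k := by
    intro x hx
    have h0 : (0:ℝ) < r - dist x c := sub_pos.2 hx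
    filter_upwards [tendsto_one_div_add_atTop_nhds_zero_nat.eventually_lt_const h0] with k hk
    change dist x c < _
    linarith
  -- The indicator places all double integrals on the fixed domain `B × B`, as Fatou's lemma
  -- requires.
  set Fk : ℕ → EuclideanSpace ℝ (Fin n) × EuclideanSpace ℝ (Fin n) → ℝ≥0∞ := fun k =>
    (Bk k ×ˢ Bk k).indicator fun p => ‖moll k U p.1 - moll k U p.2‖ₑ ^ 2 with hFk
  have hFm : ∀ k, Measurable (Fk k) := fun k => by
    have hc := (moll_contDiff k hUi.locallyIntegrable).continuous
    exact ((((hc.comp continuous_fst).sub (hc.comp continuous_snd)).enorm.measurable).pow_const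
      2).indicator ((hBkm k).prod (hBkm k))
  have hFe : ∀ k, ∫⁻ x in B, ∫⁻ y in B, Fk k (x, y)
      = ∫⁻ x in Bk k, ∫⁻ y in Bk k, ‖moll k U x - moll k U y‖ₑ ^ 2 := by
    intro k
    have hin : ∀ x, ∫⁻ y in B, Fk k (x, y) = (Bk k).indicator
        (fun x => ∫⁻ y in Bk k, ‖moll k U x - moll k U y‖ₑ ^ 2) x := by
      intro x
      by_cases hx : x ∈ Bk k
      · rw [indicator_of_mem hx, ← inter_eq_left.2 (hBk k), ← setLIntegral_indicator (hBkm k)]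
        refine lintegral_congr fun y => ?_
        by_cases hy : y ∈ Bk k <;> simp [hFk, indicator, hx, hy]
      · rw [indicator_of_notMem hx]
        simp [hFk, hx]
    simp_rw [hin]
    rw [setLIntegral_indicator (hBkm k), inter_eq_left.2 (hBk k)]
  have hdouble : ∫⁻ y in B, ∫⁻ x in B, ‖u x - u y‖ₑ ^ 2 ≤ Q * volume B := by
    calc ∫⁻ y in B, ∫⁻ x in B, ‖u x - u y‖ₑ ^ 2
        ≤ ∫⁻ y in B, ∫⁻ x in B, liminf (fun k => Fk k (y, x)) atTop := by
          refine lintegral_mono_ae ?_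
          filter_upwards [hlim, ae_restrict_mem hBm] with y hy hyB
          refine lintegral_mono_ae ?_
          filter_upwards [hlim, ae_restrict_mem hBm] with x hx hxB
          have : Tendsto (fun k => Fk k (y, x)) atTop (𝓝 (‖u x - u y‖ₑ ^ 2)) := by
            have h1 : Tendsto (fun k => ‖moll k U y - moll k U x‖ₑ ^ 2) atTop
                (𝓝 (‖u y - u x‖ₑ ^ 2)) :=
              ((ENNReal.continuous_pow 2).tendsto _).comp ((hy.sub hx).enorm)
            rw [enorm_sub_rev] at h1
            refine h1.congr' ?_
            filter_upwards [hmem x hxB, hmem y hyB] with k hkx hky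
            rw [hFk]
            simp only
            rw [indicator_of_mem (show (y, x) ∈ Bk k ×ˢ Bk k from ⟨hky, hkx⟩)]
          exact this.liminf_eq.ge
      _ ≤ ∫⁻ y in B, liminf (fun k => ∫⁻ x in B, Fk k (y, x)) atTop :=
          lintegral_mono fun y => lintegral_liminf_le fun k =>
            (hFm k).comp measurable_prodMk_left
      _ ≤ liminf (fun k => ∫⁻ y in B, ∫⁻ x in B, Fk k (y, x)) atTop :=
          lintegral_liminf_le fun k => (hFm k).lintegral_prod_right'
      _ ≤ Q * volume B := by
          refine liminf_le_of_le (by isBoundedDefault) fun b hb => ?_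
          obtain ⟨k, hk'⟩ := hb.exists
          exact hk'.trans ((hFe k).le.trans (hk k))
  have hB0 : volume B ≠ 0 := (Metric.measure_ball_pos volume c hr).ne'
  have hBt : volume B ≠ ∞ := measure_ball_lt_top.ne
  have hmeas : AEMeasurable (fun y => ∫⁻ x in B, ‖u x - u y‖ₑ ^ 2) (volume.restrict B) := by
    have hu' : AEStronglyMeasurable u (volume.restrict B) := hu.aestronglyMeasurable
    have := (hu'.comp_snd (μ := volume.restrict B)).sub (hu'.comp_fst (ν := volume.restrict B))
    exact (this.enorm.pow_const 2).lintegral_prod_right'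
  -- Some `y` has an inner integral no larger than the average over `B`, and the average is at most
  -- `Q`.
  obtain ⟨y, -, hy⟩ := exists_le_setLAverage hB0 hBt hmeas
  refine ⟨u y, hy.trans ?_⟩
  rw [setLAverage_eq]
  exact ENNReal.div_le_of_le_mul hdouble

/-! ### Polygonal chains and Taylor estimates along them -/

/-- `Chain S x y ℓ`: the points `x` and `y` are joined by a polygonal line of length `ℓ` in `S`. -/
inductive Chain {E : Type*} [NormedAddCommGroup E] [NormedSpace ℝ E] (S : Set E) (x : E) :
    E → ℝ → Prop
  | refl : Chain S x x 0
  | snoc {y z : E} {ℓ : ℝ} : Chain S x y ℓ → segment ℝ y z ⊆ S → Chain S x z (ℓ + dist y z)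

namespace Chain

variable {E : Type*} [NormedAddCommGroup E] [NormedSpace ℝ E] {S T : Set E} {x y z : E} {ℓ ℓ' : ℝ}

theorem mono (h : Chain S x y ℓ) (hST : S ⊆ T) : Chain T x y ℓ := by
  induction h with
  | refl => exact .refl
  | snoc _ hs ih => exact ih.snoc (hs.trans hST)

theorem nonneg (h : Chain S x y ℓ) : 0 ≤ ℓ := by
  induction h with
  | refl => exact le_rfl
  | snoc _ _ ih => exact add_nonneg ih dist_nonneg

theorem of_segment (h : segment ℝ x y ⊆ S) : Chain S x y (dist x y) := by
  simpa using Chain.snoc (.refl : Chain S x x 0) h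

theorem trans (h : Chain S x y ℓ) (h' : Chain S y z ℓ') : Chain S x z (ℓ + ℓ') := by
  induction h' with
  | refl => simpa using h
  | snoc _ hs ih => rw [← add_assoc]; exact ih.snoc hs

theorem symm (h : Chain S x y ℓ) : Chain S y x ℓ := by
  induction h with
  | refl => exact .refl
  | @snoc a b l _ hs ih =>
    have h1 : Chain S b a (dist b a) := of_segment (by rwa [segment_symm])
    have := h1.trans ih
    rwa [add_comm, dist_comm] at this

/-- A polygonal line is compact, hence stays at positive distance from the complement of an open
set. Mollification at smaller scales is then governed by the weak derivatives along the entire line.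
-/
theorem exists_margin (hS : IsOpen S) (h : Chain S x y ℓ) :
    ∃ δ > 0, Chain {z | Metric.closedBall z δ ⊆ S} x y ℓ := by
  induction h with
  -- The trivial chain imposes no condition on its endpoint, so any margin serves.
  | refl => exact ⟨1, one_pos, .refl⟩
  | @snoc a b l _ hs ih =>
    obtain ⟨δ, hδ, hc⟩ := ih
    have hcomp : IsCompact (segment ℝ a b) := by
      rw [segment_eq_image]
      exact isCompact_Icc.image (by fun_prop)
    obtain ⟨δ', hδ', hsub⟩ := hcomp.exists_cthickening_subset_open hS hs
    refine ⟨min δ δ', lt_min hδ hδ', (hc.mono fun z hz => ?_).snoc fun z hz => ?_⟩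
    · exact (Metric.closedBall_subset_closedBall (min_le_left _ _)).trans hz
    · refine (Metric.closedBall_subset_closedBall (min_le_right _ _)).trans ?_
      exact (Metric.closedBall_subset_cthickening hz δ').trans hsub

theorem norm_sub_le {F : Type*} [NormedAddCommGroup F] [NormedSpace ℝ F] {f : E → F}
    (hf : Differentiable ℝ f) {M : ℝ} (hM : ∀ z ∈ S, ‖fderiv ℝ f z‖ ≤ M) (h : Chain S x y ℓ) :
    ‖f y - f x‖ ≤ M * ℓ := by
  induction h with
  | refl => simp
  | @snoc a b l _ hs ih =>
    have := (convex_segment a b).norm_image_sub_le_of_norm_fderiv_le (fun z _ => hf z)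
      (fun z hz => hM z (hs hz)) (left_mem_segment ℝ a b) (right_mem_segment ℝ a b)
    rw [← dist_eq_norm b a, dist_comm] at this
    calc ‖f b - f x‖ = ‖(f b - f a) + (f a - f x)‖ := by congr 1; abel
      _ ≤ ‖f b - f a‖ + ‖f a - f x‖ := norm_add_le _ _
      _ ≤ M * (l + dist a b) := by linarith

/-- The mean value inequality is applied to `f - L₀` on each new segment of length `d`, where the
derivative is at most `M (l + d)`. The induction closes because `l² + (l + d) d ≤ (l + d)²`. -/
theorem taylor {F : Type*} [NormedAddCommGroup F] [NormedSpace ℝ F] {f : E → F}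
    (hf : Differentiable ℝ f) {M : ℝ} (hM0 : 0 ≤ M) {L₀ : E →L[ℝ] F}
    (hM : ∀ z ∈ S, ∀ ℓ, Chain S x z ℓ → ‖fderiv ℝ f z - L₀‖ ≤ M * ℓ) (h : Chain S x y ℓ) :
    ‖f y - f x - L₀ (y - x)‖ ≤ M * ℓ ^ 2 := by
  induction h with
  | refl => simp
  | @snoc a b l hc hs ih =>
    have hd : ∀ z, HasFDerivAt (fun z => f z - L₀ z) (fderiv ℝ f z - L₀) z := fun z =>
      (hf z).hasFDerivAt.sub L₀.hasFDerivAt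
    have := (convex_segment a b).norm_image_sub_le_of_norm_fderiv_le
      (f := fun z => f z - L₀ z) (C := M * (l + dist a b)) (𝕜 := ℝ)
      (fun z _ => (hd z).differentiableAt) (fun z hz => ?_)
      (left_mem_segment ℝ a b) (right_mem_segment ℝ a b)
    · rw [← dist_eq_norm b a, dist_comm b a] at this
      have hl := hc.nonneg
      have hdab : 0 ≤ dist a b := dist_nonneg
      calc ‖f b - f x - L₀ (b - x)‖
          = ‖(f b - L₀ b - (f a - L₀ a)) + (f a - f x - L₀ (a - x))‖ := by
            congr 1; simp only [map_sub]; abel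
        _ ≤ M * (l + dist a b) * dist a b + M * l ^ 2 := (norm_add_le _ _).trans (add_le_add this ih)
        _ ≤ M * (l + dist a b) ^ 2 := by nlinarith [mul_nonneg hM0 (mul_nonneg hl hdab)]
    · rw [(hd z).fderiv]
      -- Cutting the last segment at `z` gives a chain from `x` to `z`, of length at most `l + dist
      -- a b`.
      have hza : segment ℝ a z ⊆ segment ℝ a b :=
        (convex_segment a b).segment_subset (left_mem_segment ℝ a b) hz
      refine (hM z (hs hz) _ (hc.snoc (hza.trans hs))).trans ?_
      have hdz : dist a z ≤ dist a b := by
        have h1 := dist_add_dist_of_mem_segment hz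
        have h2 : 0 ≤ dist z b := dist_nonneg
        linarith
      gcongr

end Chain

theorem norm_clm_le_of_basis {L : EuclideanSpace ℝ (Fin n) →L[ℝ] ℂ} {M : ℝ} (hM : 0 ≤ M)
    (h : ∀ i, ‖L (EuclideanSpace.single i 1)‖ ≤ M) : ‖L‖ ≤ n * M := by
  refine L.opNorm_le_bound (by positivity) fun v => ?_
  have hv : L v = ∑ i, v i • L (EuclideanSpace.single i 1) := by
    conv_lhs => rw [← (EuclideanSpace.basisFun (Fin n) ℝ).sum_repr v]
    simp
  rw [hv]
  calc ‖∑ i, v i • L (EuclideanSpace.single i 1)‖ ≤ ∑ i : Fin n, ‖v‖ * M := by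
        refine norm_sum_le_of_le _ fun i _ => ?_
        rw [norm_smul]
        exact mul_le_mul (PiLp.norm_apply_le v i) (h i) (norm_nonneg _) (norm_nonneg _)
    _ = n * M * ‖v‖ := by simp; ring

/-- The linear functional with prescribed values on the standard basis. -/
noncomputable def linOf (b : Fin n → ℂ) : EuclideanSpace ℝ (Fin n) →L[ℝ] ℂ :=
  ∑ i, (EuclideanSpace.proj i : EuclideanSpace ℝ (Fin n) →L[ℝ] ℝ).smulRight (b i)

theorem linOf_apply (b : Fin n → ℂ) (v : EuclideanSpace ℝ (Fin n)) :
    linOf b v = ∑ i, b i * (v i : ℂ) := by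
  simp [linOf, mul_comm]

theorem linOf_single (b : Fin n → ℂ) (i : Fin n) : linOf b (EuclideanSpace.single i 1) = b i := by
  rw [linOf_apply, Finset.sum_eq_single i]
  · simp
  · intro j _ hj
    simp [hj]
  · simp

/-- First- and second-order Taylor estimates along chains, for `W^{2,∞}` functions. -/
theorem ae_taylor_along_chains {Ω : Set (EuclideanSpace ℝ (Fin n))} (hΩ : IsOpen Ω)
    {ρ : EuclideanSpace ℝ (Fin n) → ℂ} {g : Fin n → EuclideanSpace ℝ (Fin n) → ℂ}
    {k : Fin n → Fin n → EuclideanSpace ℝ (Fin n) → ℂ} {M : ℝ} (hM : 0 ≤ M)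
    (hρ0 : LocallyIntegrableOn ρ Ω volume)
    (hg : ∀ i, HasWeakPartial Ω i ρ (g i)) (hk : ∀ i j, HasWeakPartial Ω i (g j) (k i j))
    (hρM : ∀ᵐ x ∂volume.restrict Ω, ‖ρ x‖ ≤ M)
    (hgM : ∀ i, ∀ᵐ x ∂volume.restrict Ω, ‖g i x‖ ≤ M)
    (hkM : ∀ i j, ∀ᵐ x ∂volume.restrict Ω, ‖k i j x‖ ≤ M) :
    ∃ Z : Set (EuclideanSpace ℝ (Fin n)), (∀ᵐ x ∂volume.restrict Ω, x ∈ Z) ∧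
      ∀ x ∈ Z, ∀ y ∈ Z, ∀ ℓ, Chain Ω x y ℓ →
        ‖ρ y - ρ x‖ ≤ n * M * ℓ ∧ (∀ i, ‖g i y - g i x‖ ≤ n * M * ℓ) ∧
        ‖ρ y - ρ x - ∑ i, g i x * ((y i - x i : ℝ) : ℂ)‖ ≤ n * (n * M) * ℓ ^ 2 := by
  have hΩm := hΩ.measurableSet
  -- Extension by zero makes mollification meaningful on the whole space and preserves the bound
  -- `M`. The jump at the boundary does no harm, as derivatives are only computed at points with a
  -- small ball inside `Ω`.
  have hloc : ∀ f : EuclideanSpace ℝ (Fin n) → ℂ, LocallyIntegrableOn f Ω volume →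
      (∀ᵐ x ∂volume.restrict Ω, ‖f x‖ ≤ M) →
      LocallyIntegrable (Ω.indicator f) ∧ (∀ᵐ x, ‖Ω.indicator f x‖ ≤ M) := by
    intro f hf hfM
    have hb : ∀ᵐ x, ‖Ω.indicator f x‖ ≤ M := by
      rw [ae_restrict_iff' hΩm] at hfM
      filter_upwards [hfM] with x hx
      by_cases hxΩ : x ∈ Ω
      · simpa [hxΩ] using hx hxΩ
      · simpa [hxΩ] using hM
    refine ⟨?_, hb⟩
    have hm : AEStronglyMeasurable (Ω.indicator f) :=
      (aestronglyMeasurable_indicator_iff hΩm).2 hf.aestronglyMeasurable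
    refine (locallyIntegrable_const M).mono hm ?_
    filter_upwards [hb] with x hx
    rwa [Real.norm_of_nonneg hM]
  have hind : ∀ f : EuclideanSpace ℝ (Fin n) → ℂ, f =ᵐ[volume.restrict Ω] Ω.indicator f := by
    intro f
    filter_upwards [ae_restrict_mem hΩm] with x hx
    rw [indicator_of_mem hx]
  obtain ⟨hρl, -⟩ := hloc ρ hρ0 hρM
  have hgl := fun i => (hloc (g i) (hg i).2.1 (hgM i))
  have hkl := fun i j => (hloc (k i j) (hk i j).2.1 (hkM i j))
  have hg' : ∀ i, HasWeakPartial Ω i (Ω.indicator ρ) (Ω.indicator (g i)) := fun i =>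
    (hg i).congr hΩ (hind _) (hind _)
  have hk' : ∀ i j, HasWeakPartial Ω i (Ω.indicator (g j)) (Ω.indicator (k i j)) := fun i j =>
    (hk i j).congr hΩ (hind _) (hind _)
  -- The set of good points depends on `ρ` and its first derivatives alone. One null set thus serves
  -- all chains; only their endpoints have to be good, since on the way the smooth mollifications
  -- are used.
  refine ⟨{x | x ∈ Ω ∧ Tendsto (fun q => moll q (Ω.indicator ρ) x) atTop (𝓝 (Ω.indicator ρ x)) ∧
    ∀ i, Tendsto (fun q => moll q (Ω.indicator (g i)) x) atTop (𝓝 (Ω.indicator (g i) x))}, ?_, ?_⟩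
  · filter_upwards [ae_restrict_mem hΩm, ae_restrict_of_ae (moll_tendsto hρl),
      ae_all_iff.2 fun i => ae_restrict_of_ae (moll_tendsto (hgl i).1)] with x h1 h2 h3
    exact ⟨h1, h2, h3⟩
  rintro x ⟨hxΩ, hx1, hx2⟩ y ⟨hyΩ, hy1, hy2⟩ ℓ hc
  simp only [indicator_of_mem hxΩ, indicator_of_mem hyΩ] at hx1 hx2 hy1 hy2
  obtain ⟨δ, hδ, hcδ⟩ := hc.exists_margin hΩ
  set S := {z | Metric.closedBall z δ ⊆ Ω}
  have hev : ∀ᶠ q : ℕ in atTop, (1 / (q + 1) : ℝ) < δ :=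
    tendsto_one_div_add_atTop_nhds_zero_nat.eventually_lt_const hδ
  have hball : ∀ q : ℕ, (1 / (q + 1) : ℝ) < δ → ∀ z ∈ S,
      Metric.closedBall z (1 / (q + 1) : ℝ) ⊆ Ω := fun q hq z hz =>
    (Metric.closedBall_subset_closedBall hq.le).trans hz
  have hdρ : ∀ q, Differentiable ℝ (moll q (Ω.indicator ρ)) := fun q =>
    (moll_contDiff q hρl).differentiable (by simp)
  have hdg : ∀ q i, Differentiable ℝ (moll q (Ω.indicator (g i))) := fun q i =>
    (moll_contDiff q (hgl i).1).differentiable (by simp)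
  have E1 : ∀ᶠ q : ℕ in atTop,
      ‖moll q (Ω.indicator ρ) y - moll q (Ω.indicator ρ) x‖ ≤ n * M * ℓ := by
    filter_upwards [hev] with q hq
    refine hcδ.norm_sub_le (hdρ q) fun z hz => norm_clm_le_of_basis hM fun i => ?_
    rw [fderiv_moll hρl (hg' i) q (hball q hq z hz)]
    exact norm_moll_le q (hgl i).2 z
  have E2' : ∀ q : ℕ, (1 / (q + 1) : ℝ) < δ → ∀ i z l, Chain S x z l →
      ‖moll q (Ω.indicator (g i)) z - moll q (Ω.indicator (g i)) x‖ ≤ n * M * l := by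
    intro q hq i z l hcz
    refine hcz.norm_sub_le (hdg q i) fun z hz => norm_clm_le_of_basis hM fun j => ?_
    rw [fderiv_moll (hgl i).1 (hk' j i) q (hball q hq z hz)]
    exact norm_moll_le q (hkl j i).2 z
  have E3 : ∀ᶠ q : ℕ in atTop,
      ‖moll q (Ω.indicator ρ) y - moll q (Ω.indicator ρ) x
        - ∑ i, moll q (Ω.indicator (g i)) x * ((y i - x i : ℝ) : ℂ)‖ ≤ n * (n * M) * ℓ ^ 2 := by
    filter_upwards [hev] with q hq
    have := hcδ.taylor (hdρ q) (M := n * (n * M)) (by positivity)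
      (L₀ := linOf fun i => moll q (Ω.indicator (g i)) x) fun z hz l hcz => ?_
    · rwa [linOf_apply] at this
    · have hl := hcz.nonneg
      rw [mul_assoc]
      refine norm_clm_le_of_basis (by positivity) fun i => ?_
      rw [sub_apply, linOf_single, fderiv_moll hρl (hg' i) q (hball q hq z hz)]
      exact E2' q hq i z l hcz
  refine ⟨le_of_tendsto (hy1.sub hx1).norm E1, fun i => ?_, ?_⟩
  · refine le_of_tendsto ((hy2 i).sub (hx2 i)).norm ?_
    filter_upwards [hev] with q hq using E2' q hq i y ℓ hcδ
  · refine le_of_tendsto (Tendsto.norm ?_) E3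
    exact (hy1.sub hx1).sub (tendsto_finsetSum _ fun i _ => (hx2 i).mul_const _)

/-! ### Bounded Lipschitz domains are quasiconvex -/

/-- The chain rises from `x` by `t = (2K + 1) d` in the direction `e`, crosses parallel to the
segment from `x` to `y`, and descends to `y`; its length is `2t + d = (4K + 3) d`. Along the
crossing the graph rises by at most `2 K d` and the height drops by at most `d`, which the lift `t`
compensates. -/
theorem exists_chain_near_frontier {Ω : Set (EuclideanSpace ℝ (Fin n))}
    {p e : EuclideanSpace ℝ (Fin n)} (he : ‖e‖ = 1) {r : ℝ} (hr : 0 < r) {K : ℝ≥0}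
    {f : EuclideanSpace ℝ (Fin n) → ℝ} (hf : LipschitzWith K f)
    (h : ∀ x ∈ Metric.ball p r, x ∈ Ω ↔ f (x - inner ℝ e x • e) < inner ℝ e x) :
    ∀ x ∈ Ω ∩ Metric.ball p (r / (4 * K + 4)), ∀ y ∈ Ω ∩ Metric.ball p (r / (4 * K + 4)),
      ∃ ℓ ≤ (4 * K + 3) * dist x y, Chain Ω x y ℓ := by
  rintro x ⟨hxΩ, hx⟩ y ⟨hyΩ, hy⟩
  -- Two points in the ball of radius `s` have `d < 2s`, so after the lift they are within `s + (2K
  -- + 1) · 2s < r` of `p`, where the graph description holds.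
  set s := r / (4 * K + 4) with hs
  have hK : (0 : ℝ) ≤ K := K.2
  have hsr : s * (4 * K + 4) = r := by rw [hs]; field_simp
  have hs0 : 0 < s := by positivity
  rw [Metric.mem_ball, dist_eq_norm] at hx hy
  set d := dist x y with hd
  have hd0 : 0 ≤ d := dist_nonneg
  have hd2 : d < 2 * s := by
    rw [hd, dist_eq_norm]
    calc ‖x - y‖ = ‖(x - p) - (y - p)‖ := by congr 1; abel
      _ ≤ ‖x - p‖ + ‖y - p‖ := norm_sub_le _ _
      _ < 2 * s := by linarith
  have hee : inner ℝ e e = (1 : ℝ) := by rw [real_inner_self_eq_norm_sq, he]; norm_num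
  have hmem : ∀ z : EuclideanSpace ℝ (Fin n), ‖z - p‖ < s → ∀ τ : ℝ, 0 ≤ τ →
      τ ≤ (2 * K + 1) * d → f (z - inner ℝ e z • e) < inner ℝ e z + τ → z + τ • e ∈ Ω := by
    intro z hz τ hτ0 hτ hlt
    rw [h]
    · rw [inner_add_right, inner_smul_right, hee, mul_one]
      convert hlt using 2
      rw [add_smul]; abel
    · rw [Metric.mem_ball, dist_eq_norm]
      calc ‖z + τ • e - p‖ = ‖(z - p) + τ • e‖ := by congr 1; abel
        _ ≤ ‖z - p‖ + ‖τ • e‖ := norm_add_le _ _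
        _ = ‖z - p‖ + τ := by rw [norm_smul, he, Real.norm_of_nonneg hτ0, mul_one]
        _ < r := by nlinarith
  have hbase : ∀ z ∈ Ω, ‖z - p‖ < s → f (z - inner ℝ e z • e) < inner ℝ e z := by
    intro z hz hzs
    refine (h z ?_).1 hz
    rw [Metric.mem_ball, dist_eq_norm]
    nlinarith
  set t := (2 * K + 1) * d with ht
  have ht0 : 0 ≤ t := by positivity
  have hvert : ∀ z ∈ Ω, ‖z - p‖ < s → segment ℝ z (z + t • e) ⊆ Ω := by
    intro z hz hzs q hq
    rw [segment_eq_image'] at hq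
    obtain ⟨θ, ⟨hθ0, hθ1⟩, rfl⟩ := hq
    simp only [add_sub_cancel_left, smul_smul]
    have h1 : 0 ≤ θ * t := mul_nonneg hθ0 ht0
    exact hmem z hzs _ h1 (by nlinarith) (by linarith [hbase z hz hzs])
  have hhor : segment ℝ (x + t • e) (y + t • e) ⊆ Ω := by
    intro q hq
    rw [segment_eq_image'] at hq
    obtain ⟨θ, ⟨hθ0, hθ1⟩, rfl⟩ := hq
    set z := x + θ • (y - x) with hz
    have hzq : x + t • e + θ • (y + t • e - (x + t • e)) = z + t • e := by
      rw [hz, add_sub_add_right_eq_sub]; abel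
    simp only [hzq]
    have hzx : ‖z - x‖ ≤ d := by
      rw [hz, add_sub_cancel_left, norm_smul, Real.norm_of_nonneg hθ0, hd, dist_comm, dist_eq_norm]
      exact mul_le_of_le_one_left (norm_nonneg _) hθ1
    have hzs : ‖z - p‖ < s := by
      have hseg : z ∈ segment ℝ x y := by
        rw [segment_eq_image']
        exact ⟨θ, ⟨hθ0, hθ1⟩, rfl⟩
      have := (convex_ball p s).segment_subset (mem_ball_iff_norm.2 hx) (mem_ball_iff_norm.2 hy) hseg
      exact mem_ball_iff_norm.1 this
    refine hmem z hzs t ht0 le_rfl ?_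
    have hin : |inner ℝ e (z - x)| ≤ ‖z - x‖ := by
      have := abs_real_inner_le_norm e (z - x)
      rwa [he, one_mul] at this
    have hL : f (z - inner ℝ e z • e) - f (x - inner ℝ e x • e) ≤ K * (2 * ‖z - x‖) := by
      have h1 := hf.dist_le_mul (z - inner ℝ e z • e) (x - inner ℝ e x • e)
      have h2 : dist (z - inner ℝ e z • e) (x - inner ℝ e x • e) ≤ 2 * ‖z - x‖ := by
        rw [dist_eq_norm]
        calc _ = ‖(z - x) - (inner ℝ e (z - x) : ℝ) • e‖ := by
              congr 1; rw [inner_sub_right, sub_smul]; abel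
          _ ≤ ‖z - x‖ + ‖(inner ℝ e (z - x) : ℝ) • e‖ := norm_sub_le _ _
          _ ≤ 2 * ‖z - x‖ := by
              rw [norm_smul, he, mul_one, Real.norm_eq_abs]; linarith
      have h3 := (le_abs_self _).trans (Real.dist_eq _ _ ▸ h1)
      exact h3.trans (mul_le_mul_of_nonneg_left h2 hK)
    have h4 := hbase x hxΩ hx
    have h5 : inner ℝ e z = inner ℝ e x + inner ℝ e (z - x) := by rw [inner_sub_right]; ring
    have h6 := (abs_le.1 hin).1
    have h7 : (K:ℝ) * (2 * ‖z - x‖) ≤ K * (2 * d) := by gcongr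
    rw [ht]
    nlinarith
  have c1 : Chain Ω x (x + t • e) t := by
    have := Chain.of_segment (hvert x hxΩ hx)
    rwa [dist_self_add_right, norm_smul, he, mul_one, Real.norm_of_nonneg ht0] at this
  have c3 : Chain Ω (y + t • e) y t := by
    have := (Chain.of_segment (hvert y hyΩ hy)).symm
    rwa [dist_self_add_right, norm_smul, he, mul_one, Real.norm_of_nonneg ht0] at this
  have c2 : Chain Ω (x + t • e) (y + t • e) d := by
    have := Chain.of_segment hhor
    rwa [dist_add_right] at this
  exact ⟨_, le_of_eq (by rw [ht]; ring), (c1.trans c2).trans c3⟩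

theorem exists_chain_of_isPreconnected {Ω : Set (EuclideanSpace ℝ (Fin n))} (hΩ : IsOpen Ω)
    (hΩc : IsPreconnected Ω) {x y : EuclideanSpace ℝ (Fin n)} (hx : x ∈ Ω) (hy : y ∈ Ω) :
    ∃ ℓ, Chain Ω x y ℓ := by
  refine hΩc.induction₂ (fun x y => ∃ ℓ, Chain Ω x y ℓ) ?_ ?_ ?_ hx hy
  · intro x hx
    obtain ⟨ε, hε, hball⟩ := Metric.isOpen_iff.1 hΩ x hx
    filter_upwards [mem_nhdsWithin_of_mem_nhds (Metric.ball_mem_nhds x hε)] with y hy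
    exact ⟨_, Chain.of_segment (((convex_ball x ε).segment_subset
      (Metric.mem_ball_self hε) hy).trans hball)⟩
  · rintro x y z _ _ _ ⟨l, h⟩ ⟨l', h'⟩
    exact ⟨_, h.trans h'⟩
  · rintro x y _ _ ⟨l, h⟩
    exact ⟨_, h.symm⟩

/-- By compactness of the closure there is a Lebesgue number `δ` such that points closer than `δ`
share a ball on which quasiconvexity is known. Distant points are joined through a finite `δ`-net,
whose connecting chains have bounded length by connectedness; for `dist x y ≥ δ` a bounded length is
at most a multiple of the distance. -/
theorem HasLipschitzBoundary.quasiconvex {Ω : Set (EuclideanSpace ℝ (Fin n))} (hΩ : IsOpen Ω)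
    (hΩc : IsPreconnected Ω) (hΩb : Bornology.IsBounded Ω) (hL : HasLipschitzBoundary Ω) :
    ∃ Λ > 0, ∀ x ∈ Ω, ∀ y ∈ Ω, ∃ ℓ ≤ Λ * dist x y, Chain Ω x y ℓ := by
  have hcpt : IsCompact (closure Ω) := hΩb.isCompact_closure
  have hlocal : ∀ p ∈ closure Ω, ∃ r > 0, ∃ Λ > 0, ∀ x ∈ Ω ∩ Metric.ball p r,
      ∀ y ∈ Ω ∩ Metric.ball p r, ∃ ℓ ≤ Λ * dist x y, Chain Ω x y ℓ := by
    intro p hp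
    by_cases hpΩ : p ∈ Ω
    · obtain ⟨ε, hε, hball⟩ := Metric.isOpen_iff.1 hΩ p hpΩ
      exact ⟨ε, hε, 1, one_pos, fun x hx y hy => ⟨_, (one_mul _).ge, Chain.of_segment
        (((convex_ball p ε).segment_subset hx.2 hy.2).trans hball)⟩⟩
    · obtain ⟨e, he, r, hr, K, f, hf, h⟩ := hL p ⟨hp, by rwa [hΩ.interior_eq]⟩
      exact ⟨r / (4 * K + 4), by positivity, 4 * K + 3, by positivity,
        exists_chain_near_frontier he hr hf h⟩
  choose! R hR Λ hΛ hch using hlocal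
  obtain ⟨T, hT, hTcov⟩ := hcpt.elim_nhds_subcover (fun p => Metric.ball p (R p))
    (fun p hp => Metric.ball_mem_nhds p (hR p hp))
  obtain ⟨δ, hδ, hleb⟩ := lebesgue_number_lemma_of_metric hcpt
    (c := fun p : T => Metric.ball p.1 (R p.1)) (fun _ => Metric.isOpen_ball)
    (fun x hx => by
      obtain ⟨p, hp, hxp⟩ := mem_iUnion₂.1 (hTcov hx)
      exact mem_iUnion.2 ⟨⟨p, hp⟩, hxp⟩)
  -- The sum replaces the maximum of the finitely many local constants.
  set Λ₀ := ∑ p ∈ T, Λ p with hΛ₀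
  have hΛ₀0 : 0 ≤ Λ₀ := Finset.sum_nonneg fun p hp => (hΛ p (hT p hp)).le
  have hnear : ∀ x ∈ Ω, ∀ y ∈ Ω, dist x y < δ → ∃ ℓ ≤ Λ₀ * dist x y, Chain Ω x y ℓ := by
    intro x hx y hy hxy
    obtain ⟨⟨p, hp⟩, hsub⟩ := hleb x (subset_closure hx)
    obtain ⟨l, hl, hc⟩ := hch p (hT p hp) x ⟨hx, hsub (Metric.mem_ball_self hδ)⟩ y
      ⟨hy, hsub (by rwa [Metric.mem_ball, dist_comm])⟩
    refine ⟨l, hl.trans (mul_le_mul_of_nonneg_right ?_ dist_nonneg), hc⟩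
    exact Finset.single_le_sum (fun p hp => (hΛ p (hT p hp)).le) hp
  obtain ⟨X, hXΩ, hXf, hXcov⟩ : ∃ X ⊆ Ω, X.Finite ∧ Ω ⊆ ⋃ x ∈ X, Metric.ball x δ :=
    Metric.finite_approx_of_totallyBounded 
      (hcpt.totallyBounded.subset subset_closure) δ hδ
  have hpair : ∃ D, ∀ a ∈ X, ∀ b ∈ X, ∃ ℓ ≤ D, Chain Ω a b ℓ := by
    have h1 : ∀ q ∈ X ×ˢ X, ∃ ℓ, Chain Ω q.1 q.2 ℓ := fun q hq =>
      exists_chain_of_isPreconnected hΩ hΩc (hXΩ hq.1) (hXΩ hq.2)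
    choose! len hlen using h1
    obtain ⟨D, hD⟩ := ((hXf.prod hXf).image len).bddAbove
    exact ⟨D, fun a ha b hb => ⟨len (a, b), hD ⟨_, ⟨ha, hb⟩, rfl⟩, hlen (a, b) ⟨ha, hb⟩⟩⟩
  obtain ⟨D, hD⟩ := hpair
  -- The first term serves close pairs. The second turns the length `2 Λ₀ δ + D` of a detour through
  -- the net into a multiple of a distance at least `δ`, and the final `1` secures positivity.
  refine ⟨Λ₀ + |2 * (Λ₀ * δ) + D| / δ + 1, by positivity, fun x hx y hy => ?_⟩
  have hq : 0 ≤ |2 * (Λ₀ * δ) + D| / δ := by positivity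
  have hdxy : 0 ≤ dist x y := dist_nonneg
  rcases lt_or_ge (dist x y) δ with hxy | hxy
  · obtain ⟨l, hl, hc⟩ := hnear x hx y hy hxy
    exact ⟨l, by nlinarith, hc⟩
  · obtain ⟨a, ha, hxa⟩ := mem_iUnion₂.1 (hXcov hx)
    obtain ⟨b, hb, hyb⟩ := mem_iUnion₂.1 (hXcov hy)
    obtain ⟨l1, hl1, c1⟩ := hnear x hx a (hXΩ ha) hxa
    obtain ⟨l3, hl3, c3⟩ := hnear y hy b (hXΩ hb) hyb
    obtain ⟨l2, hl2, c2⟩ := hD a ha b hb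
    refine ⟨_, ?_, (c1.trans c2).trans c3.symm⟩
    have e1 : l1 ≤ Λ₀ * δ := hl1.trans (mul_le_mul_of_nonneg_left (Metric.mem_ball.1 hxa).le hΛ₀0)
    have e3 : l3 ≤ Λ₀ * δ := hl3.trans (mul_le_mul_of_nonneg_left (Metric.mem_ball.1 hyb).le hΛ₀0)
    have e4 : |2 * (Λ₀ * δ) + D| ≤ |2 * (Λ₀ * δ) + D| / δ * dist x y := by
      rw [div_mul_eq_mul_div, le_div_iff₀ hδ]
      exact mul_le_mul_of_nonneg_left hxy (abs_nonneg _)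
    have e5 := le_abs_self (2 * (Λ₀ * δ) + D)
    have e6 : 0 ≤ Λ₀ * dist x y := mul_nonneg hΛ₀0 hdxy
    nlinarith

/-! ### The local approximation error -/

theorem HasWeakPartial.sub_const {U : Set (EuclideanSpace ℝ (Fin n))} {i : Fin n}
    {u g : EuclideanSpace ℝ (Fin n) → ℂ} (h : HasWeakPartial U i u g) (c : ℂ) :
    HasWeakPartial U i (fun x => u x - c) g := by
  have h2 := hasWeakPartial_of_contDiff U i (u := fun _ => -c) contDiff_const
  simpa [sub_eq_add_neg] using h.add h2

theorem HasWeakPartial.sub_affine {U : Set (EuclideanSpace ℝ (Fin n))} {i : Fin n}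
    {u g : EuclideanSpace ℝ (Fin n) → ℂ} (h : HasWeakPartial U i u g) (a : ℂ) (b : Fin n → ℂ)
    (y : EuclideanSpace ℝ (Fin n)) :
    HasWeakPartial U i (fun x => u x - a - ∑ k, b k * ((x k - y k : ℝ) : ℂ))
      (fun x => g x - b i) := by
  have hd : ∀ x, HasFDerivAt (fun x : EuclideanSpace ℝ (Fin n) => -linOf b (x - y))
      (-linOf b) x := fun x =>
    ((linOf b).hasFDerivAt.comp x ((hasFDerivAt_id x).sub_const y)).neg
  have h2 := hasWeakPartial_of_contDiff U i
    (u := fun x : EuclideanSpace ℝ (Fin n) => -linOf b (x - y))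
    ((linOf b).contDiff.comp (contDiff_id.sub contDiff_const)).neg
  have h3 := (h.sub_const a).add h2
  simp_rw [fun x => (hd x).fderiv] at h3
  simp only [neg_apply, linOf_single] at h3
  simp only [linOf_apply, PiLp.sub_apply] at h3
  simpa [sub_eq_add_neg] using h3

/-- The weak derivatives of the local error `φ (ρ v - ṽ)`, with pointwise bounds. -/
theorem exists_local_error_partials {Ω ω : Set (EuclideanSpace ℝ (Fin n))} (hΩ : IsOpen Ω)
    (hω : IsOpen ω) {φ : EuclideanSpace ℝ (Fin n) → ℝ}
    {φ' : Fin n → EuclideanSpace ℝ (Fin n) → ℂ}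
    (hφ : ∀ i, HasWeakPartial Ω i (fun x => (φ x : ℂ)) (φ' i)) (hφ1 : ∀ x ∈ Ω, |φ x| ≤ 1)
    {N : ℝ} (hφN : ∀ i, ∀ᵐ x ∂volume.restrict Ω, ‖φ' i x‖ ≤ N)
    (hs : Ω ∩ closure (Ω ∩ support φ) ⊆ ω)
    {ρ : EuclideanSpace ℝ (Fin n) → ℂ} {g : Fin n → EuclideanSpace ℝ (Fin n) → ℂ} {M L : ℝ}
    (hg : ∀ i, HasWeakPartial Ω i ρ (g i))
    (hρM : ∀ᵐ x ∂volume.restrict Ω, ‖ρ x‖ ≤ M)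
    (hgM : ∀ i, ∀ᵐ x ∂volume.restrict Ω, ‖g i x‖ ≤ M)
    {v : EuclideanSpace ℝ (Fin n) → ℂ} {v' : Fin n → EuclideanSpace ℝ (Fin n) → ℂ}
    (hv : ∀ i, HasWeakPartial ω i v (v' i)) (y : EuclideanSpace ℝ (Fin n)) (c : ℂ)
    (hT : ∀ᵐ x ∂volume.restrict (ω ∩ Ω), ‖ρ x - ρ y‖ ≤ n * M * L ∧
      (∀ i, ‖g i x - g i y‖ ≤ n * M * L) ∧
      ‖ρ x - ρ y - ∑ i, g i y * ((x i - y i : ℝ) : ℂ)‖ ≤ n * (n * M) * L ^ 2)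
    {E : EuclideanSpace ℝ (Fin n) → ℂ} (hE : ∀ x, E x = φ x * ((ρ x - ρ y) * (v x - c) +
      (ρ x - ρ y - ∑ i, g i y * ((x i - y i : ℝ) : ℂ)) * c)) :
    ∃ E' : Fin n → EuclideanSpace ℝ (Fin n) → ℂ, (∀ i, HasWeakPartial Ω i E (E' i)) ∧
      (∀ i, ∀ x ∉ ω ∩ Ω, E' i x = 0) ∧
      ∀ᵐ x ∂volume.restrict (ω ∩ Ω),
        ‖E x‖ ≤ n * M * L * ‖v x - c‖ + n * (n * M) * L ^ 2 * ‖c‖ ∧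
        ∀ i, ‖E' i x‖ ≤ N * (n * M * L * ‖v x - c‖ + n * (n * M) * L ^ 2 * ‖c‖) +
          (M * ‖v x - c‖ + n * M * L * ‖v' i x‖ + n * M * L * ‖c‖) := by
  set V := ω ∩ Ω with hVdef
  have hV : IsOpen V := hω.inter hΩ
  have hVΩ : V ⊆ Ω := inter_subset_right
  have hVω : V ⊆ ω := inter_subset_left
  set p : EuclideanSpace ℝ (Fin n) → ℂ := fun x =>
    ρ x - ρ y - ∑ i, g i y * ((x i - y i : ℝ) : ℂ) with hp
  set e : EuclideanSpace ℝ (Fin n) → ℂ := fun x => (ρ x - ρ y) * (v x - c) + p x * c with he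
  -- The Taylor remainder `p` has partial derivatives `g i x - g i y`, which are small of first
  -- order in `L`.
  set e' : Fin n → EuclideanSpace ℝ (Fin n) → ℂ := fun i x =>
    (g i x * (v x - c) + (ρ x - ρ y) * v' i x) + (g i x - g i y) * c with he'
  have hρV := ae_restrict_of_ae_restrict_of_subset hVΩ hρM
  have hgV := fun i => ae_restrict_of_ae_restrict_of_subset hVΩ (hgM i)
  have heW : ∀ i, HasWeakPartial V i e (e' i) := by
    intro i
    have h1 := HasWeakPartial.mul hV hV subset_rfl (((hg i).mono hVΩ).sub_const (ρ y))
      (M := M + ‖ρ y‖) (by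
        filter_upwards [hρV] with x hx
        exact (norm_sub_le _ _).trans (by linarith)) (by
        filter_upwards [hgV i] with x hx
        linarith [norm_nonneg (ρ y)]) inter_subset_left (((hv i).mono hVω).sub_const c)
    have h2 := (((hg i).mono hVΩ).sub_affine (ρ y) (fun k => g k y) y).const_mul c
    refine (h1.add h2).congr hV ?_ ?_
    · refine ae_of_all _ fun x => ?_
      simp only [he, hp]; ring
    · filter_upwards [ae_restrict_mem hV.measurableSet] with x hx
      simp only [he', indicator_of_mem hx]; ring
  have hsupp : support (fun x => (φ x : ℂ)) = support φ := by ext x; simp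
  refine ⟨fun i => V.indicator fun x => φ' i x * e x + φ x * e' i x, fun i => ?_, ?_, ?_⟩
  · have h1 : ∀ᵐ x ∂volume.restrict Ω, ‖(φ x : ℂ)‖ ≤ max 1 N := by
      filter_upwards [ae_restrict_mem hΩ.measurableSet] with x hx
      rw [Complex.norm_real]
      exact (hφ1 x hx).trans (le_max_left _ _)
    have h2 : ∀ᵐ x ∂volume.restrict Ω, ‖φ' i x‖ ≤ max 1 N := by
      filter_upwards [hφN i] with x hx using hx.trans (le_max_right _ _)
    have h3 := HasWeakPartial.mul hΩ hV hVΩ (hφ i) h1 h2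
      (by rw [hsupp]; exact fun x hx => ⟨hs hx, hx.1⟩) (heW i)
    have hEe : E = fun x => (φ x : ℂ) * e x := funext hE
    rw [hEe]
    exact h3
  · intro i x hx
    exact indicator_of_notMem hx _
  · filter_upwards [hT, ae_restrict_mem hV.measurableSet, hρV, ae_all_iff.2 hgV,
      ae_all_iff.2 fun i => ae_restrict_of_ae_restrict_of_subset hVΩ (hφN i)]
      with x ⟨t1, t2, t3⟩ hx hρx hgx hφx
    have hex : ‖e x‖ ≤ n * M * L * ‖v x - c‖ + n * (n * M) * L ^ 2 * ‖c‖ := by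
      refine (norm_add_le _ _).trans ?_
      rw [norm_mul, norm_mul]
      gcongr
    have hφx1 : ‖(φ x : ℂ)‖ ≤ 1 := by rw [Complex.norm_real]; exact hφ1 x (hVΩ hx)
    refine ⟨?_, fun i => ?_⟩
    · rw [hE x, norm_mul]
      exact (mul_le_of_le_one_left (norm_nonneg _) hφx1).trans hex
    · have he'x : ‖e' i x‖ ≤ M * ‖v x - c‖ + n * M * L * ‖v' i x‖ + n * M * L * ‖c‖ := by
        refine (norm_add₃_le).trans ?_
        rw [norm_mul, norm_mul, norm_mul]
        have := hgx i
        have := t2 i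
        gcongr
      simp only [indicator_of_mem hx]
      refine (norm_add_le _ _).trans ?_
      rw [norm_mul, norm_mul]
      refine add_le_add ?_ ((mul_le_of_le_one_left (norm_nonneg _) hφx1).trans he'x)
      exact mul_le_mul (hφx i) hex (norm_nonneg _) ((norm_nonneg _).trans (hφx i))

/-! ### Sobolev norms expressed through weak partial derivatives. -/

theorem derivNorm_two_sq {U : Set (EuclideanSpace ℝ (Fin n))} (hU : IsOpen U) {α : Fin n → ℕ}
    {u g : EuclideanSpace ℝ (Fin n) → ℂ} (h : HasWeakDeriv U α u g) :
    derivNorm U α 2 u ^ 2 = ∫⁻ x in U, ‖g x‖ₑ ^ 2 := by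
  rw [derivNorm_eq hU h, eLpNorm_eq_lintegral_rpow_enorm_toReal (by norm_num) (by norm_num)]
  rw [← ENNReal.rpow_natCast, ← ENNReal.rpow_mul]
  norm_num

theorem hNorm_one_sq_eq {U : Set (EuclideanSpace ℝ (Fin n))} (hU : IsOpen U)
    {u : EuclideanSpace ℝ (Fin n) → ℂ} {g : Fin n → EuclideanSpace ℝ (Fin n) → ℂ}
    (h0 : LocallyIntegrableOn u U volume) (h : ∀ i, HasWeakPartial U i u (g i)) :
    hNorm U 1 u ^ 2 = (∫⁻ x in U, ‖u x‖ₑ ^ 2) + ∑ i, ∫⁻ x in U, ‖g i x‖ₑ ^ 2 := by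
  rw [hNorm_one_sq, derivNorm_two_sq hU (hasWeakDeriv_zero_self h0)]
  simp_rw [fun i => derivNorm_two_sq hU (hasWeakDeriv_single.2 (h i))]

theorem hNorm_zero_sq_eq {U : Set (EuclideanSpace ℝ (Fin n))} (hU : IsOpen U)
    {u : EuclideanSpace ℝ (Fin n) → ℂ} (h0 : LocallyIntegrableOn u U volume) :
    hNorm U 0 u ^ 2 = ∫⁻ x in U, ‖u x‖ₑ ^ 2 := by
  rw [hNorm_zero_sq, derivNorm_two_sq hU (hasWeakDeriv_zero_self h0)]

theorem derivNorm_ne_top_of_hNorm {U : Set (EuclideanSpace ℝ (Fin n))} {l : ℕ}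
    {u : EuclideanSpace ℝ (Fin n) → ℂ} (h : hNorm U l u ≠ ∞) {α : Fin n → ℕ}
    (hα : α ∈ multiIndices n l) : derivNorm U α 2 u ≠ ∞ := by
  have h2 : hNorm U l u ^ 2 ≠ ∞ := ENNReal.pow_ne_top h
  rw [hNorm_sq, ENNReal.sum_ne_top] at h2
  intro h3
  exact h2 α hα (by rw [h3]; rfl)

theorem single_mem_multiIndices (i : Fin n) : Pi.single i 1 ∈ multiIndices n 1 := by
  rw [multiIndices_one]; simp

theorem zero_mem_multiIndices (l : ℕ) : 0 ∈ multiIndices n l := by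
  simp [multiIndices]

/-- A function in `H¹(U)` has square-integrable weak partial derivatives. -/
theorem exists_partials_of_hNorm_ne_top {U : Set (EuclideanSpace ℝ (Fin n))}
    {u : EuclideanSpace ℝ (Fin n) → ℂ} (h : hNorm U 1 u ≠ ∞) :
    LocallyIntegrableOn u U volume ∧
      ∃ g : Fin n → EuclideanSpace ℝ (Fin n) → ℂ, ∀ i, HasWeakPartial U i u (g i) := by
  obtain ⟨_, h0⟩ := exists_hasWeakDeriv_of_derivNorm_ne_top
    (derivNorm_ne_top_of_hNorm h (zero_mem_multiIndices 1))
  choose g hg using fun i => exists_hasWeakDeriv_of_derivNorm_ne_top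
    (derivNorm_ne_top_of_hNorm h (single_mem_multiIndices i))
  exact ⟨h0.1, g, fun i => hasWeakDeriv_single.1 (hg i)⟩

theorem hNorm_one_ne_top {U : Set (EuclideanSpace ℝ (Fin n))} {m : ℕ} (hm : 1 ≤ m)
    {u : EuclideanSpace ℝ (Fin n) → ℂ} (h : hNorm U m u ≠ ∞) : hNorm U 1 u ≠ ∞ := by
  have h2 : hNorm U 1 u ^ 2 ≠ ∞ := by
    rw [hNorm_sq, ENNReal.sum_ne_top]
    exact fun α hα => ENNReal.pow_ne_top (derivNorm_ne_top_of_hNorm h (multiIndices_mono hm hα))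
  intro h3
  exact h2 (by rw [h3]; rfl)

/-- The data carried by a `W^{2,∞}` function, with all derivatives bounded by its norm. -/
theorem exists_partials_of_memWInfty {U : Set (EuclideanSpace ℝ (Fin n))} (hU : IsOpen U)
    {ρ : EuclideanSpace ℝ (Fin n) → ℂ} (h : MemWInfty U 2 ρ) :
    LocallyIntegrableOn ρ U volume ∧
    (∀ᵐ x ∂volume.restrict U, ‖ρ x‖ ≤ (wInftyNorm U 2 ρ).toReal) ∧
    ∃ (g : Fin n → EuclideanSpace ℝ (Fin n) → ℂ)
      (k : Fin n → Fin n → EuclideanSpace ℝ (Fin n) → ℂ),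
      (∀ i, HasWeakPartial U i ρ (g i)) ∧ (∀ i j, HasWeakPartial U i (g j) (k i j)) ∧
      (∀ i, ∀ᵐ x ∂volume.restrict U, ‖g i x‖ ≤ (wInftyNorm U 2 ρ).toReal) ∧
      (∀ i j, ∀ᵐ x ∂volume.restrict U, ‖k i j x‖ ≤ (wInftyNorm U 2 ρ).toReal) := by
  have hlt : wInftyNorm U 2 ρ ≠ ∞ := ne_of_lt h
  have hle : ∀ α ∈ multiIndices n 2, derivNorm U α ∞ ρ ≤ wInftyNorm U 2 ρ := fun α hα =>
    Finset.le_sup (f := fun α => derivNorm U α ∞ ρ) hα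
  have hex : ∀ α ∈ multiIndices n 2, ∃ g, HasWeakDeriv U α ρ g ∧
      ∀ᵐ x ∂volume.restrict U, ‖g x‖ ≤ (wInftyNorm U 2 ρ).toReal := by
    intro α hα
    obtain ⟨g, hg⟩ := exists_hasWeakDeriv_of_derivNorm_ne_top (ne_top_of_le_ne_top hlt (hle α hα))
    refine ⟨g, hg, ?_⟩
    have h1 := hle α hα
    rw [derivNorm_eq hU hg, eLpNorm_exponent_top] at h1
    filter_upwards [ae_le_eLpNormEssSup (f := g) (μ := volume.restrict U)] with x hx
    have := ENNReal.toReal_mono hlt (hx.trans h1)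
    simpa using this
  have m1 : ∀ i, Pi.single i 1 ∈ multiIndices n 2 := fun i =>
    multiIndices_mono one_le_two (single_mem_multiIndices i)
  have m2 : ∀ i j, (Pi.single j 1 + Pi.single i 1 : Fin n → ℕ) ∈ multiIndices n 2 := by
    intro i j
    simp only [multiIndices, Finset.mem_filter, Fintype.mem_piFinset, Finset.mem_range]
    have hs : ∑ l, (Pi.single j 1 + Pi.single i 1 : Fin n → ℕ) l ≤ 2 := by
      simp [Finset.sum_add_distrib]
    refine ⟨fun l => ?_, hs⟩
    have := Finset.single_le_sum (f := (Pi.single j 1 + Pi.single i 1 : Fin n → ℕ))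
      (fun _ _ => Nat.zero_le _) (Finset.mem_univ l)
    omega
  obtain ⟨g0, hg0, hb0⟩ := hex 0 (zero_mem_multiIndices 2)
  choose g hg hgb using fun i => hex _ (m1 i)
  choose k hk hkb using fun i j => hex _ (m2 i j)
  refine ⟨hg0.1, ?_, g, k, fun i => hasWeakDeriv_single.1 (hg i), fun i j =>
    (hasWeakDeriv_single.1 (hg j)).of_second (hk i j), hgb, hkb⟩
  filter_upwards [hb0, hg0.ae_eq_of_zero hU] with x hx hx'
  rwa [hx']

/-- A common form for two uses: the error itself, with `q = 0`, and each of its partial derivatives,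
with `q` the matching partial derivative of `v`. -/
theorem lintegral_error_le {Ω ω : Set (EuclideanSpace ℝ (Fin n))} (hΩ : IsOpen Ω)
    (hω : IsOpen ω) {F v q : EuclideanSpace ℝ (Fin n) → ℂ} {c : ℂ} {D h : ℝ} (hh : 0 < h)
    (hF0 : ∀ x ∈ Ω, x ∉ ω → F x = 0)
    (hv : AEStronglyMeasurable v (volume.restrict ω))
    (hF : ∀ᵐ x ∂volume.restrict (ω ∩ Ω), ‖F x‖ ≤ D * (‖v x - c‖ + h * ‖c‖ + h * ‖q x‖)) :
    ∫⁻ x in Ω, ‖F x‖ₑ ^ 2 ≤ ENNReal.ofReal (3 * D ^ 2) * ((∫⁻ x in ω, ‖v x - c‖ₑ ^ 2) +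
      ENNReal.ofReal (h ^ 2) * (∫⁻ x in ω, ‖c‖ₑ ^ 2) +
      ENNReal.ofReal (h ^ 2) * (∫⁻ x in ω, ‖q x‖ₑ ^ 2)) := by
  have hpt : ∀ᵐ x ∂volume.restrict (ω ∩ Ω), ‖F x‖ₑ ^ 2 ≤ ENNReal.ofReal (3 * D ^ 2) *
      (‖v x - c‖ₑ ^ 2 + ENNReal.ofReal (h ^ 2) * ‖c‖ₑ ^ 2 +
        ENNReal.ofReal (h ^ 2) * ‖q x‖ₑ ^ 2) := by
    filter_upwards [hF] with x hx
    have h1 : ‖F x‖ ^ 2 ≤ 3 * D ^ 2 * (‖v x - c‖ ^ 2 + h ^ 2 * ‖c‖ ^ 2 + h ^ 2 * ‖q x‖ ^ 2) := by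
      refine (pow_le_pow_left₀ (norm_nonneg _) hx 2).trans ?_
      have : ∀ a b d : ℝ, (D * (a + b + d)) ^ 2 ≤ 3 * D ^ 2 * (a ^ 2 + b ^ 2 + d ^ 2) := by
        intro a b d
        rw [mul_pow, mul_comm 3, mul_assoc]
        refine mul_le_mul_of_nonneg_left ?_ (sq_nonneg D)
        nlinarith [sq_nonneg (a - b), sq_nonneg (a - d), sq_nonneg (b - d)]
      simpa [mul_pow] using this ‖v x - c‖ (h * ‖c‖) (h * ‖q x‖)
    have h2 := ENNReal.ofReal_le_ofReal h1
    rw [ENNReal.ofReal_mul (p := 3 * D ^ 2) (by positivity),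
      ENNReal.ofReal_add (by positivity) (by positivity),
      ENNReal.ofReal_add (by positivity) (by positivity),
      ENNReal.ofReal_mul (p := h ^ 2) (by positivity),
      ENNReal.ofReal_mul (p := h ^ 2) (by positivity)] at h2
    simpa only [ENNReal.ofReal_pow (norm_nonneg _), ofReal_norm] using h2
  have hmv : AEMeasurable (fun x => ‖v x - c‖ₑ ^ 2) (volume.restrict (ω ∩ Ω)) :=
    (((hv.mono_measure (Measure.restrict_mono_set _ inter_subset_left)).sub
      aestronglyMeasurable_const).enorm.pow_const 2)
  calc ∫⁻ x in Ω, ‖F x‖ₑ ^ 2 = ∫⁻ x in ω ∩ Ω, ‖F x‖ₑ ^ 2 := by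
        rw [← setLIntegral_indicator hω.measurableSet]
        refine setLIntegral_congr_fun hΩ.measurableSet fun x hx => ?_
        by_cases hxω : x ∈ ω
        · simp [hxω]
        · simp [hxω, hF0 x hx hxω]
    _ ≤ _ := lintegral_mono_ae hpt
    _ = ENNReal.ofReal (3 * D ^ 2) * ((∫⁻ x in ω ∩ Ω, ‖v x - c‖ₑ ^ 2) +
          ENNReal.ofReal (h ^ 2) * (∫⁻ x in ω ∩ Ω, ‖c‖ₑ ^ 2) +
          ENNReal.ofReal (h ^ 2) * (∫⁻ x in ω ∩ Ω, ‖q x‖ₑ ^ 2)) := by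
        rw [lintegral_const_mul' _ _ ENNReal.ofReal_ne_top,
          lintegral_add_left' (f := fun x => ‖v x - c‖ₑ ^ 2 + ENNReal.ofReal (h ^ 2) * ‖c‖ₑ ^ 2)
            (hmv.add aemeasurable_const), lintegral_add_left' hmv,
          lintegral_const_mul' _ _ ENNReal.ofReal_ne_top,
          lintegral_const_mul' _ _ ENNReal.ofReal_ne_top]
    _ ≤ _ := by
        gcongr <;> exact inter_subset_left

/-! ### A single patch: geometry, Poincaré inequality and local approximant. -/

/-- Two antipodal points of the closed ball lie in `ω_j`; this needs dimension at least one.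
Consequently `diam ω_j` lies between `σ h` and `h`, and bounds in negative powers of the diameter
become bounds in negative powers of `h`. -/
theorem Data.AssumptionA.two_mul_radius_le {G : Data n} {Ω : Set (EuclideanSpace ℝ (Fin n))}
    {σ h : ℝ} (hn : 1 ≤ n) (hA : G.AssumptionA Ω σ h)
    (hb : ∀ j, Bornology.IsBounded (G.ω j)) {j : Fin G.N} (hr : 0 < G.radius j) :
    2 * G.radius j ≤ Metric.diam (G.ω j) := by
  set e : EuclideanSpace ℝ (Fin n) := EuclideanSpace.single ⟨0, hn⟩ 1
  have he : ‖e‖ = 1 := by simp [e]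
  have hcl : Metric.closedBall (G.center j) (G.radius j) ⊆ G.ω j := by
    rw [← closure_ball _ hr.ne']
    exact hA.closure_star j
  have h1 : G.center j + G.radius j • e ∈ G.ω j := hcl (by
    rw [Metric.mem_closedBall, dist_self_add_left, norm_smul, he, Real.norm_of_nonneg hr.le]
    simp)
  have h2 : G.center j - G.radius j • e ∈ G.ω j := hcl (by
    rw [Metric.mem_closedBall, dist_self_sub_left, norm_smul, he, Real.norm_of_nonneg hr.le]
    simp)
  have h3 := Metric.dist_le_diam_of_mem (hb j) h1 h2
  have h4 : G.center j + G.radius j • e - (G.center j - G.radius j • e)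
      = (2 * G.radius j) • e := by module
  rwa [dist_eq_norm, h4, norm_smul, he, mul_one, Real.norm_of_nonneg (by positivity)] at h3

theorem Data.SatisfiesABCD.abs_φ_le_one {G : Data n} {Ω : Set (EuclideanSpace ℝ (Fin n))}
    {m κ : ℕ} {σ A B h : ℝ} {Ck : ℕ → ℝ} (hG : G.SatisfiesABCD Ω m κ σ A B Ck h)
    (j : Fin G.N) {x : EuclideanSpace ℝ (Fin n)} (hx : x ∈ Ω) : |G.φ j x| ≤ 1 := by
  have hp := hG.assumptionB.partition
  rw [abs_of_nonneg (hp.nonneg j x hx), ← hp.sum_eq_one x hx]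
  exact Finset.single_le_sum (fun i _ => hp.nonneg i x hx) (Finset.mem_univ j)

theorem Data.SatisfiesABCD.exists_φ_partials {G : Data n} {Ω : Set (EuclideanSpace ℝ (Fin n))}
    {m κ : ℕ} {σ A B h : ℝ} {Ck : ℕ → ℝ} (hG : G.SatisfiesABCD Ω m κ σ A B Ck h) (hn : 1 ≤ n)
    (hm : 1 ≤ m) (hσ : 0 < σ) (hh : 0 < h) (hΩ : IsOpen Ω) (j : Fin G.N) :
    ∃ φ' : Fin n → EuclideanSpace ℝ (Fin n) → ℂ,
      (∀ i, HasWeakPartial Ω i (fun x => (G.φ j x : ℂ)) (φ' i)) ∧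
      ∀ i, ∀ᵐ x ∂volume.restrict Ω, ‖φ' i x‖ ≤ |Ck 1| / σ / h := by
  have hr : 0 < G.radius j := by
    have := hG.assumptionA.le_diam_star j
    nlinarith [mul_pos hσ hh]
  have hd : σ * h ≤ Metric.diam (G.ω j) := (hG.assumptionA.le_diam_star j).trans
    (hG.assumptionA.two_mul_radius_le hn hG.assumptionB.partition.bounded hr)
  have hle : ∀ i : Fin n, derivNorm Ω (Pi.single i 1) ∞ (fun x => (G.φ j x : ℂ)) ≤
      ENNReal.ofReal (|Ck 1| / σ / h) := by
    intro i
    refine (hG.assumptionB.partition.deriv_le j _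
      (multiIndices_mono hm (single_mem_multiIndices i))).trans (ENNReal.ofReal_le_ofReal ?_)
    have hs : ∑ k, (Pi.single i 1 : Fin n → ℕ) k = 1 := by simp
    rw [hs, pow_one, div_div]
    have : 0 < σ * h := mul_pos hσ hh
    gcongr
    exact le_abs_self _
  choose φ' hφ' using fun i => exists_hasWeakDeriv_of_derivNorm_ne_top
    (ne_top_of_le_ne_top ENNReal.ofReal_ne_top (hle i))
  refine ⟨φ', fun i => hasWeakDeriv_single.1 (hφ' i), fun i => ?_⟩
  have h1 := hle i
  rw [derivNorm_eq hΩ (hφ' i), eLpNorm_exponent_top] at h1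
  filter_upwards [ae_le_eLpNormEssSup (f := φ' i) (μ := volume.restrict Ω)] with x hx
  have := ENNReal.toReal_mono ENNReal.ofReal_ne_top (hx.trans h1)
  rw [ENNReal.toReal_ofReal (by positivity)] at this
  simpa using this

/-- The Poincaré inequality on the ball `ω_j^*`, transported to `ω_j` by the doubling property. -/
theorem Data.SatisfiesABCD.poincare {G : Data n} {Ω : Set (EuclideanSpace ℝ (Fin n))}
    {m κ : ℕ} {σ A B h : ℝ} {Ck : ℕ → ℝ} (hG : G.SatisfiesABCD Ω m κ σ A B Ck h) (hn : 1 ≤ n)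
    (hσ : 0 < σ) (hh : 0 < h) (hA : 0 < A) (j : Fin G.N)
    {v : EuclideanSpace ℝ (Fin n) → ℂ} (hvΨ : v ∈ G.Ψ j)
    {v' : Fin n → EuclideanSpace ℝ (Fin n) → ℂ} (hv0 : LocallyIntegrableOn v (G.ω j) volume)
    (hv : ∀ i, HasWeakPartial (G.ω j) i v (v' i)) :
    ∃ c : ℂ, ∫⁻ x in G.ω j, ‖v x - c‖ₑ ^ 2 ≤
      ENNReal.ofReal (A ^ 2 * (h ^ 2 * 2 ^ n)) * ∑ i, ∫⁻ x in G.ω j, ‖v' i x‖ₑ ^ 2 := by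
  have hr : 0 < G.radius j := by
    have := hG.assumptionA.le_diam_star j
    nlinarith [mul_pos hσ hh]
  have hω := hG.assumptionB.partition.isOpen j
  have hrh : 2 * G.radius j ≤ h :=
    (hG.assumptionA.two_mul_radius_le hn hG.assumptionB.partition.bounded hr).trans
      (hG.assumptionA.diam_le j)
  have hstar : G.star j ⊆ G.ω j := subset_closure.trans (hG.assumptionA.closure_star j)
  have hcpt : IsCompact (closure (G.star j)) := Metric.isBounded_ball.isCompact_closure
  obtain ⟨c, hc⟩ := poincare_ball hr
    ((hv0.integrableOn_compact_subset (hG.assumptionA.closure_star j) hcpt).mono_set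
      subset_closure)
    (fun i => ((hv i).2.1.integrableOn_compact_subset (hG.assumptionA.closure_star j)
      hcpt).mono_set subset_closure) (fun i => (hv i).mono hstar)
  obtain ⟨u, huΨ, hu⟩ := hG.assumptionC.affine j 1 0
  simp only [Pi.zero_apply, zero_mul, Finset.sum_const_zero, add_zero] at hu
  -- Since constants belong to `Ψ_j` up to null sets, `v - c` has a representative in `Ψ_j`, and
  -- doubling in `L²` applies to it.
  have hmem : v - c • u ∈ G.Ψ j := (G.Ψ j).sub_mem hvΨ ((G.Ψ j).smul_mem c huΨ)
  have hae : (v - c • u) =ᵐ[volume.restrict (G.ω j)] fun x => v x - c := by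
    filter_upwards [hu] with x hx
    simp [hx]
  have hLI : LocallyIntegrableOn (fun x => v x - c) (G.ω j) volume :=
    hv0.sub ((locallyIntegrable_const c).locallyIntegrableOn _)
  have hd := hG.assumptionC.doubling j _ hmem 0 (Nat.zero_le m)
  rw [hNorm_congr hω hae, hNorm_congr (show IsOpen (G.star j) from Metric.isOpen_ball)
    (ae_restrict_of_ae_restrict_of_subset hstar hae)] at hd
  have hd2 := pow_le_pow_left' hd 2
  rw [mul_pow, hNorm_zero_sq_eq hω hLI, hNorm_zero_sq_eq (show IsOpen (G.star j) from
    Metric.isOpen_ball) (hLI.mono_set hstar)] at hd2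
  refine ⟨c, hd2.trans ?_⟩
  calc ENNReal.ofReal A ^ 2 * ∫⁻ x in G.star j, ‖v x - c‖ₑ ^ 2
      ≤ ENNReal.ofReal A ^ 2 * (ENNReal.ofReal (h ^ 2) *
          (2 ^ n * ∑ i, ∫⁻ x in G.ω j, ‖v' i x‖ₑ ^ 2)) := by
        refine mul_le_mul_right (hc.trans ?_) _
        gcongr
        exact hstar
    _ = _ := by
        rw [ENNReal.ofReal_mul (by positivity), ENNReal.ofReal_mul (by positivity),
          ENNReal.ofReal_pow hA.le, ENNReal.ofReal_pow (p := 2) (by norm_num),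
          ENNReal.ofReal_ofNat]
        ring

/-- The constant in the local approximation estimate. -/
noncomputable def localConst (n : ℕ) (T A Λ : ℝ) : ℝ :=
  3 * ((T + 1) * (n * Λ + n * n * Λ ^ 2) + 1 + n * Λ) * (A + 1) * 2 ^ n

theorem localConst_pos {T A Λ : ℝ} (hT : 0 ≤ T) (hA : 0 < A) (hΛ : 0 ≤ Λ) :
    0 < localConst n T A Λ := by
  unfold localConst
  positivity

/-- `I` stands for the Poincaré term, `N` for the squared `H¹` norm of `v`, and `S` for a squared
partial derivative; `2 I + 2 N` bounds the squared `L²` norm of the constant `c`. Each summand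
carries a factor `h²`, and the surplus powers are absorbed by `h ≤ 1`. -/
theorem error_arith {n : ℕ} {D h A M : ℝ} (hA : 0 < A) (hh : 0 < h) (hh1 : h ≤ 1)
    {I N S : ℝ≥0∞} (hN : N ≠ ∞) (hI : I ≤ ENNReal.ofReal (A ^ 2 * (h ^ 2 * 2 ^ n)) * N)
    (hS : S ≤ N) :
    ENNReal.ofReal (3 * (M * D) ^ 2) * (I + ENNReal.ofReal (h ^ 2) * (2 * I + 2 * N) +
      ENNReal.ofReal (h ^ 2) * S) ≤ ENNReal.ofReal ((3 * D * (A + 1) * 2 ^ n * h * M) ^ 2) * N := by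
  lift N to ℝ≥0 using hN
  have hNn : (N : ℝ≥0∞) = ENNReal.ofReal N := by simp
  have hN0 : (0 : ℝ) ≤ N := N.2
  calc _ ≤ ENNReal.ofReal (3 * (M * D) ^ 2) * (ENNReal.ofReal (A ^ 2 * (h ^ 2 * 2 ^ n)) * N +
        ENNReal.ofReal (h ^ 2) * (ENNReal.ofReal 2 *
          (ENNReal.ofReal (A ^ 2 * (h ^ 2 * 2 ^ n)) * N) + ENNReal.ofReal 2 * N) +
      ENNReal.ofReal (h ^ 2) * N) := by
        rw [ENNReal.ofReal_ofNat]
        gcongr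
    _ = ENNReal.ofReal (3 * (M * D) ^ 2 * (A ^ 2 * (h ^ 2 * 2 ^ n) * N +
          h ^ 2 * (2 * (A ^ 2 * (h ^ 2 * 2 ^ n) * N) + 2 * N) + h ^ 2 * N)) := by
        rw [hNn]
        rw [ENNReal.ofReal_mul (p := 3 * (M * D) ^ 2) (by positivity),
          ENNReal.ofReal_add (by positivity) (by positivity), ENNReal.ofReal_add (by positivity) (by positivity),
          ENNReal.ofReal_mul (p := h ^ 2) (by positivity),
          ENNReal.ofReal_add (by positivity) (by positivity),
          ENNReal.ofReal_mul (p := 2) (by positivity), ENNReal.ofReal_mul (p := 2) (by positivity),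
          ENNReal.ofReal_mul (p := A ^ 2 * (h ^ 2 * 2 ^ n)) (by positivity),
          ENNReal.ofReal_mul (p := h ^ 2) (q := (N : ℝ)) (by positivity)]
    _ ≤ ENNReal.ofReal ((3 * D * (A + 1) * 2 ^ n * h * M) ^ 2 * N) := by
        apply ENNReal.ofReal_le_ofReal
        have hp : (1 : ℝ) ≤ 2 ^ n := one_le_pow₀ (by norm_num)
        have hh2 : h ^ 2 ≤ 1 := pow_le_one₀ hh.le hh1
        set P : ℝ := 2 ^ n
        have h1 : A ^ 2 * (h ^ 2 * P) * N + h ^ 2 * (2 * (A ^ 2 * (h ^ 2 * P) * N) + 2 * N)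
            + h ^ 2 * N ≤ h ^ 2 * N * (3 * (A ^ 2 * P + 1)) := by
          have : h ^ 2 * (2 * (A ^ 2 * (h ^ 2 * P) * N)) ≤ 1 * (2 * (A ^ 2 * (h ^ 2 * P) * N)) := by
            gcongr
          nlinarith
        have h2 : A ^ 2 * P + 1 ≤ (A + 1) ^ 2 * P ^ 2 := by
          have : P ≤ P ^ 2 := by nlinarith
          nlinarith [mul_le_mul_of_nonneg_left this (sq_nonneg A), mul_pos hA (by positivity : 0 < P ^ 2)]
        calc 3 * (M * D) ^ 2 * (A ^ 2 * (h ^ 2 * P) * N +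
              h ^ 2 * (2 * (A ^ 2 * (h ^ 2 * P) * N) + 2 * N) + h ^ 2 * N)
            ≤ 3 * (M * D) ^ 2 * (h ^ 2 * N * (3 * ((A + 1) ^ 2 * P ^ 2))) := by
              refine mul_le_mul_of_nonneg_left (h1.trans ?_) (by positivity)
              gcongr
          _ = _ := by ring
    _ = _ := by rw [ENNReal.ofReal_mul (by positivity), ← hNn]

/-- The approximant is `ρ(y) v + c ∇ρ(y)·(x - y)`. Freezing `ρ` alone would leave `(ρ - ρ(y)) v`,
which is of order one once the gradient falls on `φ_j`; the affine correction removes the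
first-order part on the constant `c`, and `v - c` is itself of order `h`. -/
theorem Data.SatisfiesABCD.exists_local_approx {G : Data n} {Ω : Set (EuclideanSpace ℝ (Fin n))}
    {m κ : ℕ} {σ A B h : ℝ} {Ck : ℕ → ℝ} (hG : G.SatisfiesABCD Ω m κ σ A B Ck h) (hn : 1 ≤ n)
    (hm : 1 ≤ m) (hσ : 0 < σ) (hA : 0 < A) (hh : 0 < h) (hΩ : IsOpen Ω) {Λ : ℝ} (hΛ : 0 ≤ Λ)
    {ρ : EuclideanSpace ℝ (Fin n) → ℂ} (hρ : MemWInfty Ω 2 ρ) (j : Fin G.N)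
    (hsΩ : G.star j ⊆ Ω)
    (hch : ∀ x ∈ G.ω j ∩ Ω, ∀ y ∈ G.star j, ∃ ℓ ≤ Λ * h, Chain Ω x y ℓ)
    {v : EuclideanSpace ℝ (Fin n) → ℂ} (hvΨ : v ∈ G.Ψ j) :
    ∃ vt ∈ G.Ψ j, ∃ E' : Fin n → EuclideanSpace ℝ (Fin n) → ℂ,
      (∀ i, HasWeakPartial Ω i (fun x => G.φ j x * (ρ x * v x - vt x)) (E' i)) ∧
      (∀ i, ∀ x ∉ G.ω j, E' i x = 0) ∧
      ∫⁻ x in Ω, ‖G.φ j x * (ρ x * v x - vt x)‖ₑ ^ 2 ≤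
        ENNReal.ofReal ((localConst n (|Ck 1| / σ) A Λ * h * (wInftyNorm Ω 2 ρ).toReal) ^ 2) *
          hNorm (G.ω j) 1 v ^ 2 ∧
      ∀ i, ∫⁻ x in Ω, ‖E' i x‖ₑ ^ 2 ≤
        ENNReal.ofReal ((localConst n (|Ck 1| / σ) A Λ * h * (wInftyNorm Ω 2 ρ).toReal) ^ 2) *
          hNorm (G.ω j) 1 v ^ 2 := by
  have hp := hG.assumptionB.partition
  have hω := hp.isOpen j
  have hr : 0 < G.radius j := by
    have := hG.assumptionA.le_diam_star j
    nlinarith [mul_pos hσ hh]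
  have hh1 := hG.assumptionA.h_le_one
  obtain ⟨hρ0, hρM, g, k, hg, hk, hgM, hkM⟩ := exists_partials_of_memWInfty hΩ hρ
  set M := (wInftyNorm Ω 2 ρ).toReal with hMdef
  have hM : 0 ≤ M := ENNReal.toReal_nonneg
  set T := |Ck 1| / σ with hTdef
  have hT0 : 0 ≤ T := by positivity
  have hvt : hNorm (G.ω j) 1 v ≠ ∞ :=
    hNorm_one_ne_top hm (ne_of_lt (hG.assumptionC.memH j v hvΨ))
  obtain ⟨hv0, v', hv⟩ := exists_partials_of_hNorm_ne_top hvt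
  obtain ⟨c, hc⟩ := hG.poincare hn hσ hh hA j hvΨ hv0 hv
  obtain ⟨φ', hφ, hφN⟩ := hG.exists_φ_partials hn hm hσ hh hΩ j
  obtain ⟨Z, hZ, hTay⟩ := ae_taylor_along_chains hΩ hM hρ0 hg hk hρM hgM hkM
  -- The ball has positive measure, so it contains a point at which the Taylor estimates for the
  -- chosen representatives hold.
  obtain ⟨y, hyZ, hyS⟩ : ∃ y ∈ Z, y ∈ G.star j := by
    have h1 : ∀ᵐ x ∂volume.restrict (G.star j), x ∈ Z :=
      ae_restrict_of_ae_restrict_of_subset hsΩ hZ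
    have h2 : ∀ᵐ x ∂volume.restrict (G.star j), x ∈ G.star j :=
      ae_restrict_mem measurableSet_ball
    have hne : (ae (volume.restrict (G.star j))).NeBot := by
      rw [ae_restrict_neBot]
      exact (Metric.measure_ball_pos volume _ hr).ne'
    obtain ⟨y, hy⟩ := (h1.and h2).exists
    exact ⟨y, hy⟩
  have hTx : ∀ᵐ x ∂volume.restrict (G.ω j ∩ Ω), ‖ρ x - ρ y‖ ≤ n * M * (Λ * h) ∧
      (∀ i, ‖g i x - g i y‖ ≤ n * M * (Λ * h)) ∧
      ‖ρ x - ρ y - ∑ i, g i y * ((x i - y i : ℝ) : ℂ)‖ ≤ n * (n * M) * (Λ * h) ^ 2 := by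
    filter_upwards [ae_restrict_of_ae_restrict_of_subset inter_subset_right hZ,
      ae_restrict_mem (hω.inter hΩ).measurableSet] with x hxZ hx
    obtain ⟨l, hl, hcx⟩ := hch x hx y hyS
    have hl0 := hcx.nonneg
    obtain ⟨t1, t2, t3⟩ := hTay y hyZ x hxZ l hcx.symm
    exact ⟨t1.trans (by gcongr), fun i => (t2 i).trans (by gcongr), t3.trans (by gcongr)⟩
  -- `u` represents the affine function `x ↦ ∇ρ(y)·(x - y)` in `Ψ_j`.
  obtain ⟨u, huΨ, hu⟩ := hG.assumptionC.affine j (-∑ i, g i y * (y i : ℂ)) (fun i => g i y)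
  set E : EuclideanSpace ℝ (Fin n) → ℂ := fun x => G.φ j x * ((ρ x - ρ y) * (v x - c) +
      (ρ x - ρ y - ∑ i, g i y * ((x i - y i : ℝ) : ℂ)) * c) with hEdef
  obtain ⟨E', hE', hE'0, hbd⟩ := exists_local_error_partials hΩ hω hφ
    (fun x hx => hG.abs_φ_le_one j hx) hφN (hp.supp j) hg hρM hgM hv y c hTx (E := E)
    (fun x => rfl)
  have hφ0 : ∀ x ∈ Ω, x ∉ G.ω j → G.φ j x = 0 := by
    intro x hx hxω
    by_contra hne
    exact hxω (hp.supp j ⟨hx, subset_closure ⟨hx, hne⟩⟩)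
  have hEae : E =ᵐ[volume.restrict Ω]
      fun x => G.φ j x * (ρ x * v x - (ρ y • v + c • u) x) := by
    rw [EventuallyEq, ae_restrict_iff' hω.measurableSet] at hu
    filter_upwards [ae_restrict_of_ae hu, ae_restrict_mem hΩ.measurableSet] with x hx hxΩ
    by_cases hxω : x ∈ G.ω j
    · simp only [hEdef, Pi.add_apply, Pi.smul_apply, smul_eq_mul, hx hxω]
      have : ∑ i, g i y * ((x i - y i : ℝ) : ℂ)
          = (∑ i, g i y * (x i : ℂ)) - ∑ i, g i y * (y i : ℂ) := by
        rw [← Finset.sum_sub_distrib]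
        refine Finset.sum_congr rfl fun i _ => ?_
        push_cast; ring
      rw [this]; ring
    · simp [hEdef, hφ0 x hxΩ hxω]
  set D := (T + 1) * (n * Λ + n * n * Λ ^ 2) + 1 + n * Λ with hD
  have hD0 : 0 ≤ D := by positivity
  set a := n * Λ with ha
  have ha0 : 0 ≤ a := by positivity
  set b := n * n * Λ ^ 2 with hb
  have hb0 : 0 ≤ b := by positivity
  have hbE : ∀ᵐ x ∂volume.restrict (G.ω j ∩ Ω),
      ‖E x‖ ≤ M * D * (‖v x - c‖ + h * ‖c‖ + h * ‖(0 : EuclideanSpace ℝ (Fin n) → ℂ) x‖) := by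
    filter_upwards [hbd] with x hx
    refine hx.1.trans ?_
    have e1 : n * M * (Λ * h) * ‖v x - c‖ + n * (n * M) * (Λ * h) ^ 2 * ‖c‖
        = M * (a * h * ‖v x - c‖ + b * h * (h * ‖c‖)) := by rw [ha, hb]; ring
    rw [e1, mul_assoc M D]
    refine mul_le_mul_of_nonneg_left ?_ hM
    simp only [Pi.zero_apply, norm_zero, mul_zero, add_zero, mul_add]
    have : a * h ≤ D := by nlinarith [mul_nonneg hT0 ha0, mul_nonneg hT0 hb0]
    have : b * h ≤ D := by nlinarith [mul_nonneg hT0 ha0, mul_nonneg hT0 hb0]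
    gcongr
  have hbE' : ∀ i, ∀ᵐ x ∂volume.restrict (G.ω j ∩ Ω),
      ‖E' i x‖ ≤ M * D * (‖v x - c‖ + h * ‖c‖ + h * ‖v' i x‖) := by
    intro i
    filter_upwards [hbd] with x hx
    refine (hx.2 i).trans ?_
    -- The factor `1 / h` from the gradient of `φ_j` cancels one power of `h`, leaving order one on
    -- `v - c` and order `h` on both `c` and the partial derivative of `v`.
    have e1 : T / h * (n * M * (Λ * h) * ‖v x - c‖ + n * (n * M) * (Λ * h) ^ 2 * ‖c‖) +
        (M * ‖v x - c‖ + n * M * (Λ * h) * ‖v' i x‖ + n * M * (Λ * h) * ‖c‖)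
        = M * ((T * a + 1) * ‖v x - c‖ + (T * b + a) * (h * ‖c‖) + a * (h * ‖v' i x‖)) := by
      rw [ha, hb]; field_simp; ring
    rw [e1, mul_assoc M D]
    refine mul_le_mul_of_nonneg_left ?_ hM
    rw [mul_add, mul_add]
    have : T * a + 1 ≤ D := by nlinarith [mul_nonneg hT0 ha0, mul_nonneg hT0 hb0]
    have : T * b + a ≤ D := by nlinarith [mul_nonneg hT0 ha0, mul_nonneg hT0 hb0]
    have : a ≤ D := by nlinarith [mul_nonneg hT0 ha0, mul_nonneg hT0 hb0]
    gcongr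
  have hN := hNorm_one_sq_eq hω hv0 hv
  have hvm : AEStronglyMeasurable v (volume.restrict (G.ω j)) := hv0.aestronglyMeasurable
  have hcI : ∫⁻ x in G.ω j, ‖c‖ₑ ^ 2 ≤
      2 * (∫⁻ x in G.ω j, ‖v x - c‖ₑ ^ 2) + 2 * hNorm (G.ω j) 1 v ^ 2 := by
    calc ∫⁻ x in G.ω j, ‖c‖ₑ ^ 2
        ≤ ∫⁻ x in G.ω j, (2 * ‖v x - c‖ₑ ^ 2 + 2 * ‖v x‖ₑ ^ 2) := by
          refine lintegral_mono fun x => ?_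
          have h1 : ‖c‖ ^ 2 ≤ 2 * ‖v x - c‖ ^ 2 + 2 * ‖v x‖ ^ 2 := by
            have h2 : ‖c‖ ≤ ‖v x‖ + ‖v x - c‖ := by
              calc ‖c‖ = ‖v x - (v x - c)‖ := by congr 1; ring
                _ ≤ _ := norm_sub_le _ _
            nlinarith [norm_nonneg c, sq_nonneg (‖v x‖ - ‖v x - c‖)]
          have h3 := ENNReal.ofReal_le_ofReal h1
          rw [ENNReal.ofReal_add (by positivity) (by positivity),
            ENNReal.ofReal_mul (by positivity), ENNReal.ofReal_mul (by positivity),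
            ENNReal.ofReal_ofNat] at h3
          simpa only [ENNReal.ofReal_pow (norm_nonneg _), ofReal_norm] using h3
      _ = 2 * (∫⁻ x in G.ω j, ‖v x - c‖ₑ ^ 2) + 2 * ∫⁻ x in G.ω j, ‖v x‖ₑ ^ 2 := by
          rw [lintegral_add_left', lintegral_const_mul' _ _ (by norm_num),
            lintegral_const_mul' _ _ (by norm_num)]
          exact ((hvm.sub aestronglyMeasurable_const).enorm.pow_const 2).const_mul 2
      _ ≤ _ := by
          gcongr
          rw [hN]
          exact le_self_add
  have hvi : ∀ i, ∫⁻ x in G.ω j, ‖v' i x‖ₑ ^ 2 ≤ hNorm (G.ω j) 1 v ^ 2 := by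
    intro i
    rw [hN]
    exact (Finset.single_le_sum (f := fun i => ∫⁻ x in G.ω j, ‖v' i x‖ₑ ^ 2)
      (fun _ _ => zero_le) (Finset.mem_univ i)).trans le_add_self
  have hI : ∫⁻ x in G.ω j, ‖v x - c‖ₑ ^ 2 ≤
      ENNReal.ofReal (A ^ 2 * (h ^ 2 * 2 ^ n)) * hNorm (G.ω j) 1 v ^ 2 := by
    refine hc.trans (mul_le_mul_right ?_ _)
    rw [hN]
    exact le_add_self
  have hfin : ∀ {F q : EuclideanSpace ℝ (Fin n) → ℂ}, (∀ x ∈ Ω, x ∉ G.ω j → F x = 0) →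
      (∀ᵐ x ∂volume.restrict (G.ω j ∩ Ω),
        ‖F x‖ ≤ M * D * (‖v x - c‖ + h * ‖c‖ + h * ‖q x‖)) →
      ∫⁻ x in G.ω j, ‖q x‖ₑ ^ 2 ≤ hNorm (G.ω j) 1 v ^ 2 →
      ∫⁻ x in Ω, ‖F x‖ₑ ^ 2 ≤ ENNReal.ofReal ((localConst n T A Λ * h * M) ^ 2) *
        hNorm (G.ω j) 1 v ^ 2 := by
    intro F q hF0 hF hq
    refine (lintegral_error_le hΩ hω hh hF0 hvm hF).trans ?_
    refine le_trans ?_ (error_arith (D := D) (M := M) hA hh hh1 (ENNReal.pow_ne_top hvt) hI hq)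
    gcongr
  refine ⟨ρ y • v + c • u, (G.Ψ j).add_mem ((G.Ψ j).smul_mem _ hvΨ) ((G.Ψ j).smul_mem _ huΨ),
    E', fun i => (hE' i).congr hΩ hEae EventuallyEq.rfl, fun i x hx => hE'0 i x fun h => hx h.1,
    ?_, fun i => ?_⟩
  · rw [lintegral_congr_ae (g := fun x => ‖E x‖ₑ ^ 2)]
    · refine hfin (fun x hx hxω => ?_) hbE (by simp)
      simp [hEdef, hφ0 x hx hxω]
    · filter_upwards [hEae] with x hx
      rw [hx]
  · exact hfin (fun x hx hxω => hE'0 i x fun h => hxω h.1) (hbE' i) (hvi i)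

/-! ### Summation of the local errors -/

theorem HasWeakPartial.sum {U : Set (EuclideanSpace ℝ (Fin n))} {i : Fin n} {ι : Type*}
    (s : Finset ι) {F F' : ι → EuclideanSpace ℝ (Fin n) → ℂ}
    (h : ∀ j, HasWeakPartial U i (F j) (F' j)) :
    HasWeakPartial U i (fun x => ∑ j ∈ s, F j x) (fun x => ∑ j ∈ s, F' j x) := by
  classical
  induction s using Finset.induction_on with
  | empty => simpa using hasWeakPartial_zero U i
  | insert a s ha ih =>
    simp only [Finset.sum_insert ha]
    exact (h a).add ih

/-- At each point at most `κ` summands are nonzero, so Cauchy–Schwarz costs `κ` instead of the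
number of patches. -/
theorem Data.IsPartition.norm_sum_sq_le {G : Data n} {Ω : Set (EuclideanSpace ℝ (Fin n))}
    {m κ : ℕ} {Ck : ℕ → ℝ} (hp : G.IsPartition Ω m κ Ck) {x : EuclideanSpace ℝ (Fin n)}
    {a : Fin G.N → ℂ} (ha : ∀ j, x ∉ G.ω j → a j = 0) :
    ‖∑ j, a j‖ ^ 2 ≤ κ * ∑ j, ‖a j‖ ^ 2 := by
  classical
  set J := Finset.univ.filter fun j => x ∈ G.ω j with hJ
  have hcard : J.card ≤ κ := by
    by_contra! hlt
    obtain ⟨J', hJ', hc⟩ := Finset.exists_subset_card_eq (show κ + 1 ≤ J.card from hlt)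
    have h1 := hp.overlap J' hc
    have h2 : x ∈ ⋂ j ∈ J', G.ω j := by
      refine mem_iInter₂.2 fun j hj => ?_
      exact (Finset.mem_filter.1 (hJ' hj)).2
    rw [h1] at h2
    exact h2
  have hsum : ∑ j, a j = ∑ j ∈ J, a j := by
    symm
    refine Finset.sum_subset (Finset.subset_univ J) fun j _ hj => ha j fun hx => ?_
    exact hj (Finset.mem_filter.2 ⟨Finset.mem_univ j, hx⟩)
  calc ‖∑ j, a j‖ ^ 2 ≤ (∑ j ∈ J, ‖a j‖) ^ 2 := by
        rw [hsum]
        exact pow_le_pow_left₀ (norm_nonneg _) (norm_sum_le _ _) 2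
    _ ≤ J.card * ∑ j ∈ J, ‖a j‖ ^ 2 := sq_sum_le_card_mul_sum_sq
    _ ≤ κ * ∑ j, ‖a j‖ ^ 2 := by
        gcongr
        exact Finset.subset_univ J

theorem Data.IsPartition.lintegral_sum_sq_le {G : Data n} {Ω : Set (EuclideanSpace ℝ (Fin n))}
    {m κ : ℕ} {Ck : ℕ → ℝ} (hp : G.IsPartition Ω m κ Ck) (hΩ : IsOpen Ω)
    {F : Fin G.N → EuclideanSpace ℝ (Fin n) → ℂ}
    (hm : ∀ j, AEStronglyMeasurable (F j) (volume.restrict Ω))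
    (hF : ∀ j, ∀ x ∈ Ω, x ∉ G.ω j → F j x = 0) :
    ∫⁻ x in Ω, ‖∑ j, F j x‖ₑ ^ 2 ≤ κ * ∑ j, ∫⁻ x in Ω, ‖F j x‖ₑ ^ 2 := by
  rw [← lintegral_finsetSum' _ fun j _ => (hm j).enorm.pow_const 2,
    ← lintegral_const_mul' _ _ (ENNReal.natCast_ne_top κ)]
  refine setLIntegral_mono' hΩ.measurableSet fun x hx => ?_
  have h1 := ENNReal.ofReal_le_ofReal (hp.norm_sum_sq_le (x := x) fun j => hF j x hx)
  rw [ENNReal.ofReal_mul (by positivity), ENNReal.ofReal_sum_of_nonneg (by intros; positivity),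
    ENNReal.ofReal_natCast] at h1
  simpa only [ENNReal.ofReal_pow (norm_nonneg _), ofReal_norm] using h1

/-- Where `φ_j = 1`, the other members of a nonnegative partition of unity vanish, and the sum
defining `w` reduces to `v j`. -/
theorem Data.SatisfiesABCD.ae_eq_on_star {G : Data n} {Ω : Set (EuclideanSpace ℝ (Fin n))}
    {m κ : ℕ} {σ A B h : ℝ} {Ck : ℕ → ℝ} (hG : G.SatisfiesABCD Ω m κ σ A B Ck h)
    {v : Fin G.N → EuclideanSpace ℝ (Fin n) → ℂ} {w : EuclideanSpace ℝ (Fin n) → ℂ}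
    (hw : w =ᵐ[volume.restrict Ω] fun x => ∑ j, (G.φ j x : ℂ) * v j x)
    {j : Fin G.N} (hj : G.star j ⊆ Ω) : v j =ᵐ[volume.restrict (G.star j)] w := by
  have hp := hG.assumptionB.partition
  filter_upwards [ae_restrict_of_ae_restrict_of_subset hj hw,
    ae_restrict_mem (show MeasurableSet (G.star j) from measurableSet_ball)] with x hx hxs
  have hxΩ := hj hxs
  have h1 := hG.assumptionB.eq_one j x ⟨hxs, hxΩ⟩
  have h2 := hp.sum_eq_one x hxΩ
  rw [← Finset.add_sum_erase _ _ (Finset.mem_univ j), h1] at h2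
  have h3 : ∑ i ∈ Finset.univ.erase j, G.φ i x = 0 := by linarith
  rw [Finset.sum_eq_zero_iff_of_nonneg fun i _ => hp.nonneg i x hxΩ] at h3
  rw [hx, Finset.sum_eq_single j]
  · simp [h1]
  · intro i _ hij
    simp [h3 i (by simp [hij])]
  · simp

/-- At a common point two members of the partition of unity would equal one, which their sum
forbids. -/
theorem Data.SatisfiesABCD.disjoint_star {G : Data n} {Ω : Set (EuclideanSpace ℝ (Fin n))}
    {m κ : ℕ} {σ A B h : ℝ} {Ck : ℕ → ℝ} (hG : G.SatisfiesABCD Ω m κ σ A B Ck h)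
    {i j : Fin G.N} (hij : i ≠ j) (hi : G.star i ⊆ Ω) : Disjoint (G.star i) (G.star j) := by
  have hp := hG.assumptionB.partition
  rw [Set.disjoint_left]
  intro x hxi hxj
  have hxΩ := hi hxi
  have h1 := hG.assumptionB.eq_one i x ⟨hxi, hxΩ⟩
  have h2 := hG.assumptionB.eq_one j x ⟨hxj, hxΩ⟩
  have h3 := hp.sum_eq_one x hxΩ
  have h4 : ∑ k ∈ {i, j}, G.φ k x ≤ ∑ k, G.φ k x :=
    Finset.sum_le_sum_of_subset_of_nonneg (Finset.subset_univ _)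
      fun k _ _ => hp.nonneg k x hxΩ
  rw [Finset.sum_pair hij] at h4
  linarith

/-- Doubling moves each norm to the ball, where `v j` coincides with `w`. The balls are disjoint, so
no overlap constant appears. -/
theorem Data.SatisfiesABCD.sum_hNorm_sq_le {G : Data n} {Ω : Set (EuclideanSpace ℝ (Fin n))}
    {m κ : ℕ} {σ A B h : ℝ} {Ck : ℕ → ℝ} (hG : G.SatisfiesABCD Ω m κ σ A B Ck h) (hm : 1 ≤ m)
    (hA : 0 < A) (hΩ : IsOpen Ω)
    {v : Fin G.N → EuclideanSpace ℝ (Fin n) → ℂ} (hv : ∀ j, v j ∈ G.Ψ j)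
    {w : EuclideanSpace ℝ (Fin n) → ℂ}
    (hw : w =ᵐ[volume.restrict Ω] fun x => ∑ j, (G.φ j x : ℂ) * v j x)
    (J : Finset (Fin G.N)) (hJ : ∀ j ∈ J, G.star j ⊆ Ω) :
    ∑ j ∈ J, hNorm (G.ω j) 1 (v j) ^ 2 ≤ ENNReal.ofReal A ^ 2 * hNorm Ω 1 w ^ 2 := by
  -- Positivity of `A` makes the right-hand side infinite here, rather than the default product `0 *
  -- ∞ = 0`.
  by_cases htop : hNorm Ω 1 w = ∞
  · rw [htop, ENNReal.top_pow two_ne_zero, ENNReal.mul_top]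
    · exact le_top
    · simpa using hA
  obtain ⟨hw0, g, hg⟩ := exists_partials_of_hNorm_ne_top htop
  have hstar : ∀ j, IsOpen (G.star j) := fun j => Metric.isOpen_ball
  have hsum : ∀ f : EuclideanSpace ℝ (Fin n) → ℝ≥0∞,
      ∑ j ∈ J, ∫⁻ x in G.star j, f x ≤ ∫⁻ x in Ω, f x := by
    intro f
    rw [← lintegral_biUnion_finset (fun i hi j _ hij => hG.disjoint_star hij (hJ i hi))
      fun j _ => (hstar j).measurableSet]
    exact lintegral_mono_set (iUnion₂_subset hJ)
  calc ∑ j ∈ J, hNorm (G.ω j) 1 (v j) ^ 2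
      ≤ ∑ j ∈ J, ENNReal.ofReal A ^ 2 * hNorm (G.star j) 1 w ^ 2 := by
        refine Finset.sum_le_sum fun j hj => ?_
        rw [← mul_pow, ← hNorm_congr (hstar j) (hG.ae_eq_on_star hw (hJ j hj))]
        exact pow_le_pow_left' (hG.assumptionC.doubling j _ (hv j) 1 hm) 2
    _ = ENNReal.ofReal A ^ 2 * ∑ j ∈ J, hNorm (G.star j) 1 w ^ 2 := by rw [Finset.mul_sum]
    _ ≤ ENNReal.ofReal A ^ 2 * hNorm Ω 1 w ^ 2 := by
        refine mul_le_mul_right ?_ _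
        rw [hNorm_one_sq_eq hΩ hw0 hg]
        have : ∀ j ∈ J, hNorm (G.star j) 1 w ^ 2 =
            (∫⁻ x in G.star j, ‖w x‖ₑ ^ 2) + ∑ i, ∫⁻ x in G.star j, ‖g i x‖ₑ ^ 2 := fun j hj =>
          hNorm_one_sq_eq (hstar j) (hw0.mono_set (hJ j hj)) fun i => (hg i).mono (hJ j hj)
        rw [Finset.sum_congr rfl this, Finset.sum_add_distrib, Finset.sum_comm]
        exact add_le_add (hsum _) (Finset.sum_le_sum fun i _ => hsum _)

/-- The constant in the global approximation estimate. -/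
noncomputable def globalConst (n κ : ℕ) (T A Λ : ℝ) : ℝ :=
  (κ + 1) * (n + 1) * A * localConst n T A Λ

theorem globalConst_pos {κ : ℕ} {T A Λ : ℝ} (hT : 0 ≤ T) (hA : 0 < A) (hΛ : 0 ≤ Λ) :
    0 < globalConst n κ T A Λ := by
  have := localConst_pos (n := n) hT hA hΛ
  unfold globalConst
  positivity

theorem ennreal_le_of_sq_le_sq {a b : ℝ≥0∞} (h : a ^ 2 ≤ b ^ 2) : a ≤ b :=
  (ENNReal.pow_right_strictMono two_ne_zero).le_iff_le.1 h

/-- Super-approximation, given that each active patch is quasiconvex inside `Ω`. -/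
theorem Data.SatisfiesABCD.exists_approx {G : Data n} {Ω : Set (EuclideanSpace ℝ (Fin n))}
    {m κ : ℕ} {σ A B h : ℝ} {Ck : ℕ → ℝ} (hG : G.SatisfiesABCD Ω m κ σ A B Ck h) (hn : 1 ≤ n)
    (hm : 1 ≤ m) (hσ : 0 < σ) (hA : 0 < A) (hh : 0 < h) (hΩ : IsOpen Ω) {Λ : ℝ} (hΛ : 0 ≤ Λ)
    {ρ : EuclideanSpace ℝ (Fin n) → ℂ} (hρ : MemWInfty Ω 2 ρ)
    {v : Fin G.N → EuclideanSpace ℝ (Fin n) → ℂ} (hv : ∀ j, v j ∈ G.Ψ j)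
    {w : EuclideanSpace ℝ (Fin n) → ℂ}
    (hw : w =ᵐ[volume.restrict Ω] fun x => ∑ j, (G.φ j x : ℂ) * v j x)
    (P : Fin G.N → Prop) (hPs : ∀ j, P j → G.star j ⊆ Ω)
    (hPc : ∀ j, P j → ∀ x ∈ G.ω j ∩ Ω, ∀ y ∈ G.star j, ∃ ℓ ≤ Λ * h, Chain Ω x y ℓ)
    (hnP : ∀ j, ¬ P j → (∀ x ∈ Ω, G.φ j x = 0) ∨ v j =ᵐ[volume.restrict (G.ω j)] 0) :
    ∃ vt : Fin G.N → EuclideanSpace ℝ (Fin n) → ℂ, (∀ j, vt j ∈ G.Ψ j) ∧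
      (∀ j, ¬ P j → vt j = 0) ∧
      hNorm Ω 1 (fun x => ρ x * w x - ∑ j, (G.φ j x : ℂ) * vt j x) ≤
        ENNReal.ofReal (globalConst n κ (|Ck 1| / σ) A Λ * h) * wInftyNorm Ω 2 ρ *
          hNorm Ω 1 w := by
  classical
  have hp := hG.assumptionB.partition
  set M := (wInftyNorm Ω 2 ρ).toReal with hMdef
  have hM0 : 0 ≤ M := ENNReal.toReal_nonneg
  set T := |Ck 1| / σ
  have hT : 0 ≤ T := by positivity
  set Q := ENNReal.ofReal ((localConst n T A Λ * h * M) ^ 2) with hQ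
  -- Inactive patches contribute nothing. They must be left out of the sum, because only active
  -- balls are known to lie in `Ω`.
  set H : Fin G.N → ℝ≥0∞ := fun j => if P j then hNorm (G.ω j) 1 (v j) ^ 2 else 0 with hH
  have hφ0 : ∀ j, ∀ x ∈ Ω, x ∉ G.ω j → G.φ j x = 0 := by
    intro j x hx hxω
    by_contra hne
    exact hxω (hp.supp j ⟨hx, subset_closure ⟨hx, hne⟩⟩)
  have hex : ∀ j, ∃ vt ∈ G.Ψ j, (¬ P j → vt = 0) ∧
      ∃ E' : Fin n → EuclideanSpace ℝ (Fin n) → ℂ,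
      (∀ i, HasWeakPartial Ω i (fun x => G.φ j x * (ρ x * v j x - vt x)) (E' i)) ∧
      (∀ i, ∀ x ∉ G.ω j, E' i x = 0) ∧
      ∫⁻ x in Ω, ‖G.φ j x * (ρ x * v j x - vt x)‖ₑ ^ 2 ≤ Q * H j ∧
      ∀ i, ∫⁻ x in Ω, ‖E' i x‖ₑ ^ 2 ≤ Q * H j := by
    intro j
    by_cases hP : P j
    · obtain ⟨vt, h1, E', h2, h3, h4, h5⟩ := hG.exists_local_approx hn hm hσ hA hh hΩ hΛ hρ j
        (hPs j hP) (hPc j hP) (hv j)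
      exact ⟨vt, h1, fun h => absurd hP h, E', h2, h3, by simpa only [hH, hP, if_true] using h4,
        by simpa only [hH, hP, if_true] using h5⟩
    -- On an inactive patch `φ_j` or `v j` vanishes, so the zero approximant has zero error.
    · have h0 : (fun _ => 0) =ᵐ[volume.restrict Ω]
          fun x => (G.φ j x : ℂ) * (ρ x * v j x - (0 : EuclideanSpace ℝ (Fin n) → ℂ) x) := by
        rcases hnP j hP with h | h
        · filter_upwards [ae_restrict_mem hΩ.measurableSet] with x hx
          simp [h x hx]
        · rw [EventuallyEq, ae_restrict_iff' (hp.isOpen j).measurableSet] at h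
          filter_upwards [ae_restrict_mem hΩ.measurableSet, ae_restrict_of_ae h] with x hx hx'
          by_cases hxω : x ∈ G.ω j
          · simp [hx' hxω]
          · simp [hφ0 j x hx hxω]
      refine ⟨0, (G.Ψ j).zero_mem, fun _ => rfl, fun _ _ => 0, fun i =>
        (hasWeakPartial_zero Ω i).congr hΩ h0 EventuallyEq.rfl, fun _ _ _ => rfl, ?_, by simp⟩
      rw [lintegral_congr_ae (g := fun _ => 0)]
      · simp
      · filter_upwards [h0] with x hx
        rw [← hx]
        simp
  choose vt hvt hvt0 E' hE' hE'0 hE hE'' using hex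
  refine ⟨vt, hvt, hvt0, ?_⟩
  set F : Fin G.N → EuclideanSpace ℝ (Fin n) → ℂ :=
    fun j x => G.φ j x * (ρ x * v j x - vt j x) with hF
  have hae : (fun x => ρ x * w x - ∑ j, (G.φ j x : ℂ) * vt j x)
      =ᵐ[volume.restrict Ω] fun x => ∑ j, F j x := by
    filter_upwards [hw] with x hx
    rw [hx, Finset.mul_sum, ← Finset.sum_sub_distrib]
    refine Finset.sum_congr rfl fun j _ => ?_
    simp only [hF]; ring
  have hpart : ∀ i, HasWeakPartial Ω i (fun x => ∑ j, F j x) (fun x => ∑ j, E' j i x) :=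
    fun i => HasWeakPartial.sum _ fun j => hE' j i
  have hFl : ∀ j, LocallyIntegrableOn (F j) Ω volume := fun j => (hE' j ⟨0, hn⟩).1
  rw [hNorm_congr hΩ hae]
  apply ennreal_le_of_sq_le_sq
  rw [hNorm_one_sq_eq hΩ (hpart ⟨0, hn⟩).1 hpart]
  have b1 : ∀ {f : Fin G.N → EuclideanSpace ℝ (Fin n) → ℂ},
      (∀ j, AEStronglyMeasurable (f j) (volume.restrict Ω)) →
      (∀ j, ∀ x ∈ Ω, x ∉ G.ω j → f j x = 0) → (∀ j, ∫⁻ x in Ω, ‖f j x‖ₑ ^ 2 ≤ Q * H j) →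
      ∫⁻ x in Ω, ‖∑ j, f j x‖ₑ ^ 2 ≤ κ * (Q * ∑ j, H j) := by
    intro f h1 h2 h3
    refine (hp.lintegral_sum_sq_le hΩ h1 h2).trans (mul_le_mul_right ?_ _)
    rw [Finset.mul_sum]
    exact Finset.sum_le_sum fun j _ => h3 j
  have hHs : ∑ j, H j ≤ ENNReal.ofReal A ^ 2 * hNorm Ω 1 w ^ 2 := by
    simp only [hH]
    rw [← Finset.sum_filter]
    exact hG.sum_hNorm_sq_le hm hA hΩ hv hw _ fun j hj => hPs j (Finset.mem_filter.1 hj).2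
  calc _ ≤ (κ * (Q * ∑ j, H j)) + ∑ i : Fin n, (κ * (Q * ∑ j, H j)) := by
        refine add_le_add (b1 (fun j => (hFl j).aestronglyMeasurable) ?_ hE)
          (Finset.sum_le_sum fun i _ => b1 (fun j => (hE' j i).2.1.aestronglyMeasurable)
            (fun j x _ hx => hE'0 j i x hx) fun j => hE'' j i)
        intro j x hx hxω
        simp [hF, hφ0 j x hx hxω]
    _ = (n + 1) * κ * Q * ∑ j, H j := by
        simp only [Finset.sum_const, Finset.card_univ, Fintype.card_fin, nsmul_eq_mul]
        ring
    _ ≤ (n + 1) * κ * Q * (ENNReal.ofReal A ^ 2 * hNorm Ω 1 w ^ 2) := by gcongr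
    _ = ENNReal.ofReal ((n + 1) * κ * (localConst n T A Λ * h * M) ^ 2 * A ^ 2) *
          hNorm Ω 1 w ^ 2 := by
        rw [ENNReal.ofReal_mul (by positivity), ENNReal.ofReal_mul (by positivity),
          ENNReal.ofReal_mul (by positivity), ENNReal.ofReal_add (by positivity) (by positivity),
          ENNReal.ofReal_natCast, ENNReal.ofReal_natCast, ENNReal.ofReal_one,
          ENNReal.ofReal_pow hA.le, hQ]
        ring
    _ ≤ ENNReal.ofReal ((globalConst n κ T A Λ * h * M) ^ 2) * hNorm Ω 1 w ^ 2 := by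
        refine mul_le_mul_left (ENNReal.ofReal_le_ofReal ?_) _
        unfold globalConst
        set l := localConst n T A Λ
        -- The error and its `n` partial derivatives each lose a factor `κ`. A cruder bound that is
        -- a perfect square allows the square root to be taken.
        have hκ : ((n : ℝ) + 1) * κ ≤ ((κ + 1) * (n + 1)) ^ 2 := by
          have hk : (0:ℝ) ≤ κ := κ.cast_nonneg
          have hn' : (0:ℝ) ≤ n := n.cast_nonneg
          have e1 : ((n : ℝ) + 1) * κ ≤ (κ + 1) * (n + 1) := by nlinarith
          have e2 : (1:ℝ) ≤ (κ + 1) * (n + 1) := by nlinarith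
          nlinarith
        calc ((n : ℝ) + 1) * κ * (l * h * M) ^ 2 * A ^ 2
            = ((n + 1) * κ) * ((l * h * M) ^ 2 * A ^ 2) := by ring
          _ ≤ ((κ + 1) * (n + 1)) ^ 2 * ((l * h * M) ^ 2 * A ^ 2) := by gcongr
          _ = _ := by ring
    _ = _ := by
        have hgc := globalConst_pos (n := n) (κ := κ) hT hA hΛ
        rw [ENNReal.ofReal_pow (by positivity),
          ENNReal.ofReal_mul (q := M) (by positivity), hMdef, ENNReal.ofReal_toReal (ne_of_lt hρ),
          ← mul_pow]

theorem hNorm_one_eq_zero {Ω : Set (EuclideanSpace ℝ (Fin n))} (hΩ : IsOpen Ω)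
    {u : EuclideanSpace ℝ (Fin n) → ℂ} (hu : u =ᵐ[volume.restrict Ω] 0) : hNorm Ω 1 u = 0 := by
  have h : hNorm Ω 1 u ^ 2 = 0 := by
    rw [hNorm_congr hΩ hu, show (0 : EuclideanSpace ℝ (Fin n) → ℂ) = fun _ => 0 from rfl,
      hNorm_one_sq_eq hΩ ((locallyIntegrable_const 0).locallyIntegrableOn Ω)
        (hasWeakPartial_zero Ω)]
    simp
  simpa using h

/-- Multiplication by a `W^{2,∞}` function is bounded on `H¹`. -/
theorem hNorm_one_mul_le {Ω : Set (EuclideanSpace ℝ (Fin n))} (hΩ : IsOpen Ω)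
    {ρ w : EuclideanSpace ℝ (Fin n) → ℂ} (hρ : MemWInfty Ω 2 ρ) :
    hNorm Ω 1 (fun x => ρ x * w x) ≤
      ENNReal.ofReal (2 * (n + 1)) * wInftyNorm Ω 2 ρ * hNorm Ω 1 w := by
  obtain ⟨hρ0, hρM, g, k, hg, hk, hgM, hkM⟩ := exists_partials_of_memWInfty hΩ hρ
  have hlt : wInftyNorm Ω 2 ρ ≠ ∞ := ne_of_lt hρ
  set M := (wInftyNorm Ω 2 ρ).toReal with hMdef
  have hM0 : 0 ≤ M := ENNReal.toReal_nonneg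
  by_cases htop : hNorm Ω 1 w = ∞
  -- If both `w` has infinite norm and `ρ` has norm zero, the right-hand side is `0` by convention,
  -- and the left-hand side vanishes because `ρ = 0` almost everywhere.
  · by_cases hz : wInftyNorm Ω 2 ρ = 0
    · have : hNorm Ω 1 (fun x => ρ x * w x) = 0 := by
        refine hNorm_one_eq_zero hΩ ?_
        filter_upwards [hρM] with x hx
        rw [hMdef, hz, ENNReal.toReal_zero, norm_le_zero_iff] at hx
        simp [hx]
      rw [this]
      exact zero_le
    · rw [htop, ENNReal.mul_top]
      · exact le_top
      · refine mul_ne_zero ?_ hz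
        simp only [ne_eq, ENNReal.ofReal_eq_zero, not_le]
        positivity
  obtain ⟨hw0, w', hw'⟩ := exists_partials_of_hNorm_ne_top htop
  have hpr := fun i => HasWeakPartial.mul hΩ hΩ subset_rfl (hg i) hρM (hgM i) inter_subset_left
    (hw' i)
  have hl : LocallyIntegrableOn (fun x => ρ x * w x) Ω volume :=
    LocallyIntegrableOn.bdd_mul hΩ hρ0 hρM hw0
  apply ennreal_le_of_sq_le_sq
  rw [hNorm_one_sq_eq hΩ hl hpr]
  have hN := hNorm_one_sq_eq hΩ hw0 hw'
  have e0 : ∫⁻ x in Ω, ‖ρ x * w x‖ₑ ^ 2 ≤ ENNReal.ofReal (2 * M ^ 2) * hNorm Ω 1 w ^ 2 := by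
    calc _ ≤ ∫⁻ x in Ω, ENNReal.ofReal (2 * M ^ 2) * ‖w x‖ₑ ^ 2 := by
          refine lintegral_mono_ae ?_
          filter_upwards [hρM] with x hx
          have h1 : ‖ρ x * w x‖ ^ 2 ≤ 2 * M ^ 2 * ‖w x‖ ^ 2 := by
            rw [norm_mul, mul_pow]
            have : ‖ρ x‖ ^ 2 ≤ M ^ 2 := pow_le_pow_left₀ (norm_nonneg _) hx 2
            nlinarith [sq_nonneg ‖w x‖, sq_nonneg M]
          have h2 := ENNReal.ofReal_le_ofReal h1
          rw [ENNReal.ofReal_mul (p := 2 * M ^ 2) (by positivity)] at h2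
          simpa only [ENNReal.ofReal_pow (norm_nonneg _), ofReal_norm] using h2
      _ = ENNReal.ofReal (2 * M ^ 2) * ∫⁻ x in Ω, ‖w x‖ₑ ^ 2 :=
          lintegral_const_mul' _ _ ENNReal.ofReal_ne_top
      _ ≤ _ := by
          rw [hN]
          exact mul_le_mul_right le_self_add _
  have e1 : ∀ i, ∫⁻ x in Ω, ‖Ω.indicator (fun x => g i x * w x + ρ x * w' i x) x‖ₑ ^ 2 ≤
      ENNReal.ofReal (2 * M ^ 2) * hNorm Ω 1 w ^ 2 := by
    intro i
    calc _ ≤ ∫⁻ x in Ω, ENNReal.ofReal (2 * M ^ 2) * (‖w x‖ₑ ^ 2 + ‖w' i x‖ₑ ^ 2) := by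
          refine lintegral_mono_ae ?_
          filter_upwards [hρM, hgM i, ae_restrict_mem hΩ.measurableSet] with x hx hx' hxΩ
          rw [indicator_of_mem hxΩ]
          have h1 : ‖g i x * w x + ρ x * w' i x‖ ^ 2 ≤ 2 * M ^ 2 * (‖w x‖ ^ 2 + ‖w' i x‖ ^ 2) := by
            have h3 : ‖g i x * w x + ρ x * w' i x‖ ≤ M * ‖w x‖ + M * ‖w' i x‖ := by
              refine (norm_add_le _ _).trans ?_
              rw [norm_mul, norm_mul]
              gcongr
            refine (pow_le_pow_left₀ (norm_nonneg _) h3 2).trans ?_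
            nlinarith [mul_nonneg (sq_nonneg M) (sq_nonneg (‖w x‖ - ‖w' i x‖))]
          have h2 := ENNReal.ofReal_le_ofReal h1
          rw [ENNReal.ofReal_mul (p := 2 * M ^ 2) (by positivity),
            ENNReal.ofReal_add (by positivity) (by positivity)] at h2
          simpa only [ENNReal.ofReal_pow (norm_nonneg _), ofReal_norm] using h2
      _ = ENNReal.ofReal (2 * M ^ 2) * ((∫⁻ x in Ω, ‖w x‖ₑ ^ 2) + ∫⁻ x in Ω, ‖w' i x‖ₑ ^ 2) := by
          rw [lintegral_const_mul' _ _ ENNReal.ofReal_ne_top,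
            lintegral_add_left' (hw0.aestronglyMeasurable.enorm.pow_const 2)]
      _ ≤ _ := by
          rw [hN]
          gcongr
          exact Finset.single_le_sum (f := fun i => ∫⁻ x in Ω, ‖w' i x‖ₑ ^ 2)
            (fun _ _ => zero_le) (Finset.mem_univ i)
  calc _ ≤ ENNReal.ofReal (2 * M ^ 2) * hNorm Ω 1 w ^ 2 +
        ∑ i : Fin n, ENNReal.ofReal (2 * M ^ 2) * hNorm Ω 1 w ^ 2 :=
        add_le_add e0 (Finset.sum_le_sum fun i _ => e1 i)
    _ = ENNReal.ofReal ((n + 1) * (2 * M ^ 2)) * hNorm Ω 1 w ^ 2 := by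
        simp only [Finset.sum_const, Finset.card_univ, Fintype.card_fin, nsmul_eq_mul]
        rw [ENNReal.ofReal_mul (p := (n : ℝ) + 1) (by positivity),
          ENNReal.ofReal_add (by positivity) (by positivity), ENNReal.ofReal_natCast,
          ENNReal.ofReal_one]
        ring
    _ ≤ ENNReal.ofReal ((2 * (n + 1) * M) ^ 2) * hNorm Ω 1 w ^ 2 := by
        refine mul_le_mul_left (ENNReal.ofReal_le_ofReal ?_) _
        have hn' : (0:ℝ) ≤ n := n.cast_nonneg
        nlinarith [mul_nonneg hn' (sq_nonneg M), mul_nonneg (mul_nonneg hn' hn') (sq_nonneg M),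
          sq_nonneg M]
    _ = _ := by
        rw [ENNReal.ofReal_pow (by positivity),
          ENNReal.ofReal_mul (q := M) (by positivity), hMdef, ENNReal.ofReal_toReal hlt, ← mul_pow]

/-! ### Essential supports and distances of boundaries -/

theorem isClosed_essSupport (Ω : Set (EuclideanSpace ℝ (Fin n)))
    (u : EuclideanSpace ℝ (Fin n) → ℂ) : IsClosed (essSupport Ω u) := by
  rw [← isOpen_compl_iff, isOpen_iff_mem_nhds]
  intro x hx
  simp only [essSupport, mem_compl_iff, mem_ofPred_eq, not_forall, not_not] at hx
  obtain ⟨V, hV, hxV, h⟩ := hx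
  filter_upwards [hV.mem_nhds hxV] with y hy hyS
  exact hyS V hV hy h

/-- Off the essential support the exceptional set is locally null, and locally null sets are null in
a second countable space. -/
theorem ae_eq_zero_of_notMem_essSupport {Ω : Set (EuclideanSpace ℝ (Fin n))}
    (hΩ : IsOpen Ω) (u : EuclideanSpace ℝ (Fin n) → ℂ) :
    ∀ᵐ x ∂volume.restrict Ω, x ∉ essSupport Ω u → u x = 0 := by
  rw [ae_restrict_iff' hΩ.measurableSet, ae_iff]
  apply measure_null_of_locally_null
  intro x hx
  simp only [Classical.not_imp, mem_ofPred_eq] at hx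
  have hx2 := hx.2.1
  simp only [essSupport, mem_ofPred_eq, not_forall, not_not] at hx2
  obtain ⟨V, hV, hxV, h⟩ := hx2
  refine ⟨_, inter_mem_nhdsWithin _ (hV.mem_nhds hxV), ?_⟩
  rw [EventuallyEq, ae_restrict_iff' (hV.inter hΩ).measurableSet, ae_iff] at h
  refine measure_mono_null ?_ h
  rintro y ⟨hy, hyV⟩
  simp only [Classical.not_imp, mem_ofPred_eq] at hy ⊢
  exact ⟨⟨hyV, hy.1⟩, hy.2.2⟩

theorem essSupport_subset_of_isClosed {Ω T : Set (EuclideanSpace ℝ (Fin n))} (hΩ : IsOpen Ω)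
    (hT : IsClosed T) {u : EuclideanSpace ℝ (Fin n) → ℂ} (h : ∀ x ∈ Ω, x ∉ T → u x = 0) :
    essSupport Ω u ⊆ T := by
  intro x hx
  by_contra hxT
  refine hx Tᶜ hT.isOpen_compl hxT ?_
  filter_upwards [ae_restrict_mem (hT.isOpen_compl.inter hΩ).measurableSet] with y hy
  exact h y hy.2 hy.1

theorem exists_frontier_mem_segment {S : Set (EuclideanSpace ℝ (Fin n))}
    {x z : EuclideanSpace ℝ (Fin n)} (hx : x ∈ S) (hz : z ∉ S) :
    ∃ q ∈ frontier S, q ∈ segment ℝ x z := by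
  have hpc : IsPreconnected (segment ℝ x z) := (convex_segment x z).isPreconnected
  by_contra! hno
  have hcov : ∀ q ∈ segment ℝ x z, q ∈ interior S ∨ q ∈ (closure S)ᶜ := by
    intro q hq
    by_contra! hq'
    exact hno q ⟨not_not.1 hq'.2, hq'.1⟩ hq
  have hxS : x ∈ interior S := (hcov x (left_mem_segment ℝ x z)).resolve_right
    fun h => h (subset_closure hx)
  have hzS : z ∈ (closure S)ᶜ := (hcov z (right_mem_segment ℝ x z)).resolve_left
    fun h => hz (interior_subset h)
  obtain ⟨q, -, hq1, hq2⟩ := hpc _ _ isOpen_interior isClosed_closure.isOpen_compl hcov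
    ⟨x, left_mem_segment ℝ x z, hxS⟩ ⟨z, right_mem_segment ℝ x z, hzS⟩
  exact hq2 (interior_subset_closure hq1)

theorem dist_le_of_mem_segment {x z q : EuclideanSpace ℝ (Fin n)} (hq : q ∈ segment ℝ x z) :
    dist x q ≤ dist x z ∧ dist q z ≤ dist x z := by
  have h := dist_add_dist_of_mem_segment hq
  have h1 : 0 ≤ dist x q := dist_nonneg
  have h2 : 0 ≤ dist q z := dist_nonneg
  constructor <;> linarith

theorem CompactlyIn.subset {Ω₁ Ω : Set (EuclideanSpace ℝ (Fin n))} (h : CompactlyIn Ω₁ Ω) :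
    closure Ω₁ ⊆ Ω :=
  h.2.trans interior_subset

/-- If `z` were outside `Ω`, the segment from `x` would meet the boundary of `Ω` at some `q`, and
its part from `x` to `q` would meet the boundary of `Ω₁`. Two boundary points would then be closer
than the distance of the boundaries. -/
theorem ball_subset_of_setDist {Ω₁ Ω : Set (EuclideanSpace ℝ (Fin n))} (hΩ : IsOpen Ω)
    (h : CompactlyIn Ω₁ Ω) {x z : EuclideanSpace ℝ (Fin n)} (hx : x ∈ Ω₁)
    (hz : dist x z < setDist (frontier Ω) (frontier Ω₁)) : z ∈ Ω := by
  by_contra hzΩ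
  obtain ⟨q, hq, hqs⟩ := exists_frontier_mem_segment (h.subset (subset_closure hx)) hzΩ
  have hqΩ : q ∉ Ω := by
    have := hq.2
    rwa [hΩ.interior_eq] at this
  obtain ⟨p, hp, hps⟩ := exists_frontier_mem_segment hx
    (fun hq1 => hqΩ (h.subset (subset_closure hq1)))
  have h1 : setDist (frontier Ω) (frontier Ω₁) ≤ dist q p := by
    refine csInf_le ⟨0, ?_⟩ ⟨q, hq, p, hp, rfl⟩
    rintro _ ⟨a, _, b, _, rfl⟩
    exact dist_nonneg
  have h2 := (dist_le_of_mem_segment hps).2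
  have h3 := (dist_le_of_mem_segment hqs).1
  rw [dist_comm p q] at h2
  linarith

/-- Both boundaries are compact and nonempty, so the distance is attained, at a point outside `Ω`
and a point inside. The upper bound lets a constant free of `θ` be absorbed into a multiple of
`θ⁻¹`. -/
theorem setDist_pos_and_le {Ω₁ Ω : Set (EuclideanSpace ℝ (Fin n))} (hn : 1 ≤ n) (hΩ : IsOpen Ω)
    (hΩb : Bornology.IsBounded Ω) (h : CompactlyIn Ω₁ Ω) (hne : Ω₁.Nonempty) :
    0 < setDist (frontier Ω) (frontier Ω₁) ∧
      setDist (frontier Ω) (frontier Ω₁) ≤ Metric.diam Ω := by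
  have : Nontrivial (EuclideanSpace ℝ (Fin n)) := by
    refine ⟨0, EuclideanSpace.single ⟨0, hn⟩ 1, fun h => ?_⟩
    have := congrArg norm h
    simp at this
  have hfr : ∀ S : Set (EuclideanSpace ℝ (Fin n)), S.Nonempty → Bornology.IsBounded S →
      (frontier S).Nonempty := by
    intro S hS hSb
    obtain ⟨x, hx⟩ := hS
    obtain ⟨z, hz⟩ : ∃ z, z ∉ S := by
      by_contra! hall
      have : S = univ := eq_univ_of_forall hall
      rw [this] at hSb
      exact NormedSpace.unbounded_univ ℝ (EuclideanSpace ℝ (Fin n)) hSb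
    obtain ⟨q, hq, _⟩ := exists_frontier_mem_segment hx hz
    exact ⟨q, hq⟩
  have hsub : Ω₁ ⊆ Ω := subset_closure.trans h.subset
  have hc : IsCompact (frontier Ω) := hΩb.isCompact_closure.of_isClosed_subset isClosed_frontier
    frontier_subset_closure
  have hc1 : IsCompact (frontier Ω₁) := h.1.of_isClosed_subset isClosed_frontier
    frontier_subset_closure
  have hmem : setDist (frontier Ω) (frontier Ω₁) ∈ image2 dist (frontier Ω) (frontier Ω₁) := by
    refine IsCompact.sInf_mem ?_ ?_
    · rw [← image_uncurry_prod]
      exact (hc.prod hc1).image continuous_dist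
    · exact (hfr Ω (hne.mono hsub) hΩb).image2 (hfr Ω₁ hne (hΩb.subset hsub))
  obtain ⟨q, hq, p, hp, hqp⟩ := hmem
  have hqΩ : q ∉ Ω := by
    have := hq.2
    rwa [hΩ.interior_eq] at this
  have hpΩ : p ∈ Ω := h.subset (frontier_subset_closure hp)
  rw [← hqp]
  refine ⟨dist_pos.2 fun he => hqΩ (he ▸ hpΩ), ?_⟩
  rw [← Metric.diam_closure]
  exact Metric.dist_le_diam_of_mem hΩb.closure (frontier_subset_closure hq) (subset_closure hpΩ)

/-- Doubling acts as a unique continuation property. It shows that patches whose ball misses the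
support of `w` carry no part of `w`. -/
theorem Data.SatisfiesABCD.ae_eq_zero_of_star {G : Data n} {Ω : Set (EuclideanSpace ℝ (Fin n))}
    {m κ : ℕ} {σ A B h : ℝ} {Ck : ℕ → ℝ} (hG : G.SatisfiesABCD Ω m κ σ A B Ck h) (hm : 1 ≤ m)
    {j : Fin G.N} {v : EuclideanSpace ℝ (Fin n) → ℂ} (hv : v ∈ G.Ψ j)
    (h0 : v =ᵐ[volume.restrict (G.star j)] 0) : v =ᵐ[volume.restrict (G.ω j)] 0 := by
  have hω := hG.assumptionB.partition.isOpen j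
  have hs : IsOpen (G.star j) := Metric.isOpen_ball
  have hle := hG.assumptionC.doubling j v hv 1 hm
  rw [hNorm_one_eq_zero hs h0, mul_zero, nonpos_iff_eq_zero] at hle
  have hv0 := (exists_partials_of_hNorm_ne_top (by rw [hle]; exact ENNReal.zero_ne_top)).1
  have h1 : derivNorm (G.ω j) 0 2 v ^ 2 = 0 := by
    have h2 := hNorm_one_sq (G.ω j) v
    rw [hle, zero_pow two_ne_zero, eq_comm, add_eq_zero] at h2
    exact h2.1
  rw [pow_eq_zero_iff two_ne_zero, derivNorm_eq hω (hasWeakDeriv_zero_self hv0),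
    eLpNorm_eq_zero_iff hv0.aestronglyMeasurable two_ne_zero] at h1
  exact h1

theorem dist_le_of_mem_patch {G : Data n} {Ω : Set (EuclideanSpace ℝ (Fin n))}
    {m κ : ℕ} {σ A B h : ℝ} {Ck : ℕ → ℝ} (hG : G.SatisfiesABCD Ω m κ σ A B Ck h) {j : Fin G.N}
    {x y : EuclideanSpace ℝ (Fin n)} (hx : x ∈ closure (G.ω j)) (hy : y ∈ closure (G.ω j)) :
    dist x y ≤ h := by
  have hb := hG.assumptionB.partition.bounded j
  refine (Metric.dist_le_diam_of_mem hb.closure hx hy).trans ?_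
  rw [Metric.diam_closure]
  exact hG.assumptionA.diam_le j

/-! ### The two super-approximation estimates. -/

/-- Quasiconvexity of `Ω` joins points of a patch by chains that may leave the patch but stay in
`Ω`, with length at most `Λ h`; no convexity of `ω_j ∩ Ω` is needed. -/
theorem superapproximation_lipschitz (n m κ : ℕ) (hn : 1 ≤ n) (hm : 1 ≤ m)
    (σ A B : ℝ) (hσ : 0 < σ) (hA : 0 < A) (Ck : ℕ → ℝ)
    (Ω : Set (EuclideanSpace ℝ (Fin n))) (hΩo : IsOpen Ω) (hΩc : IsConnected Ω)
    (hΩb : Bornology.IsBounded Ω) (hL : HasLipschitzBoundary Ω) :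
    ∃ C > (0 : ℝ), ∀ h > (0 : ℝ), ∀ G : Data n, G.SatisfiesABCD Ω m κ σ A B Ck h →
      ∀ ρ : EuclideanSpace ℝ (Fin n) → ℂ, MemWInfty Ω 2 ρ →
      ∀ w ∈ G.space Ω, ∃ w' ∈ G.space Ω,
        hNorm Ω 1 (fun x => ρ x * w x - w' x) ≤
          ENNReal.ofReal (C * h) * wInftyNorm Ω 2 ρ * hNorm Ω 1 w := by
  obtain ⟨Λ, hΛ, hch⟩ := hL.quasiconvex hΩo hΩc.isPreconnected hΩb
  refine ⟨globalConst n κ (|Ck 1| / σ) A Λ, globalConst_pos (by positivity) hA hΛ.le, ?_⟩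
  rintro h hh G hG ρ hρ w ⟨v, hv, hw⟩
  obtain ⟨vt, hvt, -, hle⟩ := hG.exists_approx hn hm hσ hA hh hΩo hΛ.le hρ hv hw
    (fun j => ∃ x ∈ Ω, G.φ j x ≠ 0) (fun j hj => hG.assumptionA.star_subset j hj)
    (fun j hj x hx y hy => by
      obtain ⟨l, hl, hc⟩ := hch x hx.2 y (hG.assumptionA.star_subset j hj hy)
      refine ⟨l, hl.trans (mul_le_mul_of_nonneg_left ?_ hΛ.le), hc⟩
      exact dist_le_of_mem_patch hG (subset_closure hx.1)
        (subset_closure (hG.assumptionA.closure_star j (subset_closure hy))))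
    (fun j hj => Or.inl fun x hx => by
      by_contra hne
      exact hj ⟨x, hx, hne⟩)
  exact ⟨_, ⟨vt, hvt, EventuallyEq.rfl⟩, hle⟩

theorem superapproximation_interior (n m κ : ℕ) (hn : 1 ≤ n) (hm : 1 ≤ m)
    (σ A B : ℝ) (hσ : 0 < σ) (hA : 0 < A) (Ck : ℕ → ℝ)
    (Ω : Set (EuclideanSpace ℝ (Fin n))) (hΩo : IsOpen Ω)
    (hΩb : Bornology.IsBounded Ω) :
    ∃ C' > (0 : ℝ), ∀ Ω₁ : Set (EuclideanSpace ℝ (Fin n)), CompactlyIn Ω₁ Ω →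
      ∀ h > (0 : ℝ), ∀ G : Data n, G.SatisfiesABCD Ω m κ σ A B Ck h →
        ∀ ρ : EuclideanSpace ℝ (Fin n) → ℂ, MemWInfty Ω 2 ρ →
        ∀ w ∈ G.space Ω, essSupport Ω w ⊆ Ω₁ →
          ∃ w' ∈ G.space Ω, IsCompact (essSupport Ω w') ∧ essSupport Ω w' ⊆ Ω ∧
            hNorm Ω 1 (fun x => ρ x * w x - w' x) ≤
              ENNReal.ofReal (C' * (setDist (frontier Ω) (frontier Ω₁))⁻¹ * h) *
                wInftyNorm Ω 2 ρ * hNorm Ω 1 w := by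
  set K := globalConst n κ (|Ck 1| / σ) A 1 with hK
  have hK0 : 0 < K := globalConst_pos (by positivity) hA zero_le_one
  have hdiam : 0 ≤ Metric.diam Ω := Metric.diam_nonneg
  -- The first term covers `h < θ`, through `θ ≤ diam Ω`; the second covers `θ ≤ h`, where it is the
  -- norm of multiplication by `ρ`.
  refine ⟨K * Metric.diam Ω + 2 * (n + 1), by positivity, ?_⟩
  rintro Ω₁ hΩ₁ h hh G hG ρ hρ w ⟨v, hv, hw⟩ hsupp
  have hp := hG.assumptionB.partition
  have hzero : (fun _ => 0 : EuclideanSpace ℝ (Fin n) → ℂ) ∈ G.space Ω :=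
    ⟨fun _ => 0, fun j => (G.Ψ j).zero_mem, ae_of_all _ fun x => by simp⟩
  have hzs : essSupport Ω (fun _ => 0 : EuclideanSpace ℝ (Fin n) → ℂ) = ∅ :=
    subset_empty_iff.1 (essSupport_subset_of_isClosed hΩo isClosed_empty fun _ _ _ => rfl)
  have hwae := ae_eq_zero_of_notMem_essSupport hΩo w
  -- For empty `Ω₁` the infimum defining `θ` takes its default value `0`, so the bound reads zero;
  -- `w` vanishes almost everywhere and the zero approximant is exact.
  rcases Ω₁.eq_empty_or_nonempty with he | hne
  · refine ⟨_, hzero, by rw [hzs]; exact isCompact_empty, by rw [hzs]; exact empty_subset _, ?_⟩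
    rw [hNorm_one_eq_zero hΩo]
    · exact zero_le
    · filter_upwards [hwae] with x hx
      rw [he] at hsupp
      simp [hx fun hx => hsupp hx]
  obtain ⟨hθ0, hθd⟩ := setDist_pos_and_le hn hΩo hΩb hΩ₁ hne
  set θ := setDist (frontier Ω) (frontier Ω₁) with hθ
  -- For `θ ≤ h` the factor `θ⁻¹ h` is at least one, and boundedness of multiplication by `ρ`
  -- suffices with zero as the approximant.
  rcases le_or_gt θ h with hθh | hhθ
  · refine ⟨_, hzero, by rw [hzs]; exact isCompact_empty, by rw [hzs]; exact empty_subset _, ?_⟩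
    simp only [sub_zero]
    refine (hNorm_one_mul_le hΩo hρ).trans ?_
    refine mul_le_mul_left (mul_le_mul_left (ENNReal.ofReal_le_ofReal ?_) _) _
    have h1 : 1 ≤ θ⁻¹ * h := by
      rw [inv_mul_eq_div, le_div_iff₀ hθ0]; linarith
    have h2 : 0 ≤ K * Metric.diam Ω := by positivity
    rw [mul_assoc]
    have hn' : (0:ℝ) ≤ n := n.cast_nonneg
    nlinarith
  -- Active patches are those whose ball meets the support of `w`. Their diameter is at most `h <
  -- θ`, so their closures stay in `Ω`; being convex, they allow chains consisting of one segment.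
  · set P : Fin G.N → Prop := fun j =>
      (∃ x ∈ Ω, G.φ j x ≠ 0) ∧ (G.star j ∩ essSupport Ω w).Nonempty with hP
    have hstarω : ∀ j, G.star j ⊆ G.ω j := fun j =>
      subset_closure.trans (hG.assumptionA.closure_star j)
    have hPω : ∀ j, P j → closure (G.ω j) ⊆ Ω := by
      rintro j ⟨_, x, hxs, hxw⟩ z hz
      refine ball_subset_of_setDist hΩo hΩ₁ (hsupp hxw) (lt_of_le_of_lt ?_ hhθ)
      exact dist_le_of_mem_patch hG (subset_closure (hstarω j hxs)) hz
    obtain ⟨vt, hvt, hvt0, hle⟩ := hG.exists_approx hn hm hσ hA hh hΩo zero_le_one hρ hv hw P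
      (fun j hj => hG.assumptionA.star_subset j hj.1)
      (fun j hj x hx y hy => by
        refine ⟨dist x y, ?_, Chain.of_segment ?_⟩
        · rw [one_mul]
          exact dist_le_of_mem_patch hG (subset_closure hx.1) (subset_closure (hstarω j hy))
        · exact ((hG.assumptionA.convex j).segment_subset hx.1 (hstarω j hy)).trans
            (subset_closure.trans (hPω j hj)))
      (fun j hj => by
        by_cases hφ : ∃ x ∈ Ω, G.φ j x ≠ 0
        · right
          have hsΩ := hG.assumptionA.star_subset j hφ
          refine hG.ae_eq_zero_of_star hm (hv j) ?_
          filter_upwards [hG.ae_eq_on_star hw hsΩ, ae_restrict_of_ae_restrict_of_subset hsΩ hwae,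
            ae_restrict_mem (show MeasurableSet (G.star j) from measurableSet_ball)]
            with x hx1 hx2 hx3
          rw [hx1]
          exact hx2 fun hx => hj ⟨hφ, x, hx3, hx⟩
        · left
          intro x hx
          by_contra hne
          exact hφ ⟨x, hx, hne⟩)
    set T : Set (EuclideanSpace ℝ (Fin n)) := ⋃ j ∈ {j | P j}, closure (G.ω j) with hT
    have hTc : IsCompact T := (Set.toFinite _).isCompact_biUnion fun j _ =>
      (hp.bounded j).isCompact_closure
    have hTΩ : T ⊆ Ω := iUnion₂_subset fun j hj => hPω j hj
    have hsub : essSupport Ω (fun x => ∑ j, (G.φ j x : ℂ) * vt j x) ⊆ T := by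
      refine essSupport_subset_of_isClosed hΩo hTc.isClosed fun x hx hxT => ?_
      refine Finset.sum_eq_zero fun j _ => ?_
      by_cases hj : P j
      · have hxω : x ∉ G.ω j := fun hxω => hxT (mem_iUnion₂.2 ⟨j, hj, subset_closure hxω⟩)
        have : G.φ j x = 0 := by
          by_contra hne
          exact hxω (hp.supp j ⟨hx, subset_closure ⟨hx, hne⟩⟩)
        simp [this]
      · simp [hvt0 j hj]
    refine ⟨_, ⟨vt, hvt, EventuallyEq.rfl⟩, hTc.of_isClosed_subset (isClosed_essSupport _ _) hsub,
      hsub.trans hTΩ, hle.trans ?_⟩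
    refine mul_le_mul_left (mul_le_mul_left (ENNReal.ofReal_le_ofReal ?_) _) _
    refine mul_le_mul_of_nonneg_right ?_ hh.le
    -- It remains to see that `K θ ≤ K diam Ω + 2 (n + 1)`, which follows from `θ ≤ diam Ω`.
    rw [← hK, ← div_eq_mul_inv, le_div_iff₀ hθ0]
    have hn' : (0:ℝ) ≤ n := n.cast_nonneg
    nlinarith

end GFEM

theorem mainTheorem6 (n m κ : ℕ) (hn : 1 ≤ n) (hm : 1 ≤ m)
    (σ A B : ℝ) (hσ : 0 < σ) (hA : 0 < A) (hB : 0 < B) (Ck : ℕ → ℝ)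
    (Ω : Set (EuclideanSpace ℝ (Fin n))) (hΩo : IsOpen Ω) (hΩc : IsConnected Ω)
    (hΩb : Bornology.IsBounded Ω) :
    (GFEM.HasLipschitzBoundary Ω →
      ∃ C > (0 : ℝ), ∀ h > (0 : ℝ), ∀ G : GFEM.Data n, G.SatisfiesABCD Ω m κ σ A B Ck h →
        ∀ ρ : EuclideanSpace ℝ (Fin n) → ℂ, GFEM.MemWInfty Ω 2 ρ →
        ∀ w ∈ G.space Ω, ∃ w' ∈ G.space Ω,
          GFEM.hNorm Ω 1 (fun x => ρ x * w x - w' x) ≤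
            ENNReal.ofReal (C * h) * GFEM.wInftyNorm Ω 2 ρ * GFEM.hNorm Ω 1 w) ∧
    (∃ C' > (0 : ℝ), ∀ Ω₁ : Set (EuclideanSpace ℝ (Fin n)), GFEM.CompactlyIn Ω₁ Ω →
      ∀ h > (0 : ℝ), ∀ G : GFEM.Data n, G.SatisfiesABCD Ω m κ σ A B Ck h →
        ∀ ρ : EuclideanSpace ℝ (Fin n) → ℂ, GFEM.MemWInfty Ω 2 ρ →
        ∀ w ∈ G.space Ω, GFEM.essSupport Ω w ⊆ Ω₁ →
          ∃ w' ∈ G.space Ω, IsCompact (GFEM.essSupport Ω w') ∧ GFEM.essSupport Ω w' ⊆ Ω ∧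
            GFEM.hNorm Ω 1 (fun x => ρ x * w x - w' x) ≤
              ENNReal.ofReal (C' * (GFEM.setDist (frontier Ω) (frontier Ω₁))⁻¹ * h) *
                GFEM.wInftyNorm Ω 2 ρ * GFEM.hNorm Ω 1 w) :=
  ⟨GFEM.superapproximation_lipschitz n m κ hn hm σ A B hσ hA Ck Ω hΩo hΩc hΩb,
    GFEM.superapproximation_interior n m κ hn hm σ A B hσ hA Ck Ω hΩo hΩb⟩
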